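/- Let $d>1$ be a square-free integer, let $\mathcal O$ be the ring of algebraic integers of $\mathbb Q[\sqrt d]$, let $D$ be its discriminant ($D=d$ if $d\equiv 1 \bmod 4$, and $D=4d$ otherwise), and let $R=\ln\epsilon_0$ be its regulator, where $\epsilon_0$ is the least unit of $\mathcal O$ greater than $1$. For $\xi=r+s\sqrt d$ write $\overline\xi=r-s\sqrt d$. A principal fractional ideal $I=\gamma\mathcal O$ is *reduced* if $1\in I$ and no nonzero $\beta\in I$ has both $|\beta|<1$ and $|\overline\beta|<1$. It has a unique standard form $I=\mathbb Z+\frac{b+\sqrt D}{2a}\mathbb Z$ with integers $a>0$ and $b$ such that $4a\mid b^2-D$, and $-a<b\le a$ if $a>\sqrt D$, $\sqrt D-2a<b\le\sqrt D$ if $a<\sqrt D$. An *unreduced distance* of $I$ is a real number $\ln|\gamma|$ with $\mathcal O=\gamma I$; it is determined by $I$ modulo $R$. For a reduced principal ideal $I$ with unreduced distance $x=\delta(I)$, let $I*I$ be the first reduced principal ideal with an unreduced distance exceeding $2x$, and let $\delta(I*I)$ be the least unreduced distance of a reduced principal ideal that exceeds $2x$. **Proposition.** Let $I$ be a reduced principal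 ideal with unreduced distance $\delta(I)$. Then the iterated $*$-squaring $$I\to I^{(2)}=I*I\to I^{(4)}=I^{(2)}*I^{(2)}\to\cdots\to I^{(2^n)}=I^{(2^{n-1})}*I^{(2^{n-1})}\to\cdots$$ is well defined: these ideals and their unreduced distances exist and are unique. Moreover: 1. For every $n\ge 1$, $I^{(2^n)}$ is a reduced principal ideal, and its unreduced distance satisfies $\delta(I^{(2^n)})>2^n\,\delta(I)$. 2. There is an algorithm that computes the standard form of $I^{(2^n)}$ from $D$, the standard form $(a,b)$ of $I$, and $n\ge 0$, in $\mathrm{poly}(\log D,n)$ bit operations. 3. There is an algorithm that, given $D$, the standard form $(a,b)$ of $I$, $n,m\ge0$, and an integer $t$ with $|\delta(I)-t/2^{n+m+2}|\le 2^{-(n+m+2)}$, computes an integer $q$ with $|\delta(I^{(2^n)})-q/2^m|\le 2^{-m}$ in $\mathrm{poly}\bigl(\log D,\,n,\,m,\,\log(1+|\delta(I)|/R)\bigr)$ bit operations; in particular in $\mathrm{poly}(\log D,n,m)$ bit operations if $0\le\delta(I)<R$. The algorithms are programs for a machine with finitely many integer registers, with constants, addition, subtraction, multiplication, integer division, sign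 tests and loops, where each operation is charged according to the binary lengths of its operands (the product of the lengths, each increased by one, for an arithmetic operation). The algorithms and the polynomials do not depend on $d$, $I$, $n$, $m$. -/

import Mathlib

open scoped Pointwise

namespace PrincipalCycle

/-! ### The quadratic field and its algebraic integers -/

/-- The field `ℚ[√d]`: the element `⟨r, s⟩` stands for `r + s√d`. -/
abbrev QuadField (d : ℕ) : Type := QuadraticAlgebra ℚ (d : ℚ) 0

/-- The real number `r + s√d`. -/
noncomputable def val {d : ℕ} (ξ : QuadField d) : ℝ := (ξ.re : ℝ) + (ξ.im : ℝ) * √(d : ℝ)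

/-- The real number `r - s√d`, the conjugate of `r + s√d`. -/
noncomputable def conjVal {d : ℕ} (ξ : QuadField d) : ℝ := (ξ.re : ℝ) - (ξ.im : ℝ) * √(d : ℝ)

/-- The ring `𝒪` of algebraic integers of `ℚ[√d]`. -/
abbrev IntegerRing (d : ℕ) : Subalgebra ℤ (QuadField d) := integralClosure ℤ (QuadField d)

/-- The discriminant `D` of `ℚ[√d]`. -/
def disc (d : ℕ) : ℕ := if d % 4 = 1 then d else 4 * d

/-- `√D` as an element of `ℚ[√d]`. -/
def sqrtDisc (d : ℕ) : QuadField d := ⟨0, if d % 4 = 1 then 1 else 2⟩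

/-- The regulator `R = ln ε₀`, with `ε₀` the least unit of `𝒪` above `1`. -/
noncomputable def regulator (d : ℕ) : ℝ :=
  sInf {r : ℝ | ∃ u : (IntegerRing d)ˣ,
    1 < val ((u : IntegerRing d) : QuadField d) ∧
      r = Real.log (val ((u : IntegerRing d) : QuadField d))}

/-! ### Reduced principal ideals and their distances -/

/-- Fractional ideals are taken as `𝒪`-submodules of `ℚ[√d]`; the principal ones, `γ𝒪`, are those
with `Submodule.IsPrincipal`. -/
abbrev FracIdeal (d : ℕ) : Type := Submodule (IntegerRing d) (QuadField d)

/-- `α` is a minimum of `I`. -/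
def IsMinimum {d : ℕ} (I : FracIdeal d) (α : QuadField d) : Prop :=
  α ∈ I ∧ 0 < val α ∧
    ¬ ∃ β ∈ I, β ≠ 0 ∧ |val β| < |val α| ∧ |conjVal β| < |conjVal α|

/-- `I` is a reduced principal ideal: `I = γ𝒪` for some `γ`, and `1` is a minimum of `I`. -/
def IsReducedPrincipal {d : ℕ} (I : FracIdeal d) : Prop :=
  Submodule.IsPrincipal I ∧ IsMinimum I 1

/-- `x` is a value of the distance `δ(I) = δ(𝒪, I)`, not reduced modulo the regulator: `x = ln |γ|`
for some `γ` with `𝒪 = γI`. -/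
def IsDistance {d : ℕ} (I : FracIdeal d) (x : ℝ) : Prop :=
  ∃ γ : QuadField d, (1 : FracIdeal d) = γ • I ∧ x = Real.log |val γ|

/-- `(J, y)` is the `*`-square of `(I, x)`, where each ideal comes with an unreduced distance: `J`
is the first reduced principal ideal whose unreduced distance exceeds `2x`, and `y` is that
distance. -/
def IsStarSquare {d : ℕ} (p q : FracIdeal d × ℝ) : Prop :=
  IsReducedPrincipal q.1 ∧ IsDistance q.1 q.2 ∧ 2 * p.2 < q.2 ∧
    ∀ (J : FracIdeal d) (y : ℝ), IsReducedPrincipal J → IsDistance J y → 2 * p.2 < y → q.2 ≤ y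

/-- `s` is the sequence of iterated `*`-squares that starts at the ideal `I` with unreduced
distance `x`; so `s n` is `I^(2^n)` with its unreduced distance. -/
def IsStarSequence {d : ℕ} (I : FracIdeal d) (x : ℝ) (s : ℕ → FracIdeal d × ℝ) : Prop :=
  s 0 = (I, x) ∧ ∀ k, IsStarSquare (s k) (s (k + 1))

/-- `b = τ(b, a)`: the integer `b` is the chosen representative of its class modulo `2a`. -/
def IsTau (D : ℕ) (a b : ℤ) : Prop :=
  (√(D : ℝ) < a → -a < b ∧ b ≤ a) ∧
    ((a : ℝ) < √(D : ℝ) → √(D : ℝ) - 2 * a < b ∧ (b : ℝ) ≤ √(D : ℝ))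

/-- `I = ℤ + ((b + √D) / 2a) ℤ` is the standard form of `I`. -/
def IsStandardForm {d : ℕ} (I : FracIdeal d) (a b : ℤ) : Prop :=
  0 < a ∧ IsTau (disc d) a b ∧ 4 * a ∣ b ^ 2 - (disc d : ℤ) ∧
    (I : Set (QuadField d)) =
      {ξ | ∃ x y : ℤ, ξ = (x : QuadField d) +
        (y : QuadField d) * ((1 / (2 * (a : ℚ))) • ((b : QuadField d) + sqrtDisc d))}

/-! ### Register machines with logarithmic (bit) cost -/

/-- Programs over integer registers `0, 1, 2, …`. -/
inductive Prog : Type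
  /-- register `i` receives the constant `c` -/
  | const (i : ℕ) (c : ℤ)
  /-- register `i` receives the sum of registers `j` and `k` -/
  | add (i j k : ℕ)
  /-- register `i` receives the difference of registers `j` and `k` -/
  | sub (i j k : ℕ)
  /-- register `i` receives the product of registers `j` and `k` -/
  | mul (i j k : ℕ)
  /-- register `i` receives the integer quotient of registers `j` and `k` -/
  | div (i j k : ℕ)
  /-- first `P`, then `Q` -/
  | seq (P Q : Prog)
  /-- `P` if register `i` is positive, else `Q` -/
  | ite (i : ℕ) (P Q : Prog)
  /-- repeat `P` as long as register `i` is positive -/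
  | loop (i : ℕ) (P : Prog)

/-- The number of binary digits of `|z|`. -/
def bitLen (z : ℤ) : ℕ := Nat.size z.natAbs

/-- The number of bit operations charged for one arithmetic operation on `y` and `z` (the
schoolbook bound). -/
def opCost (y z : ℤ) : ℕ := (1 + bitLen y) * (1 + bitLen z)

/-- `Runs P σ τ T`: started with register contents `σ`, the program `P` halts with register
contents `τ` after `T` bit operations. -/
inductive Runs : Prog → (ℕ → ℤ) → (ℕ → ℤ) → ℕ → Prop
  | const (σ : ℕ → ℤ) (i : ℕ) (c : ℤ) :
      Runs (.const i c) σ (Function.update σ i c) (1 + bitLen c)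
  | add (σ : ℕ → ℤ) (i j k : ℕ) :
      Runs (.add i j k) σ (Function.update σ i (σ j + σ k)) (opCost (σ j) (σ k))
  | sub (σ : ℕ → ℤ) (i j k : ℕ) :
      Runs (.sub i j k) σ (Function.update σ i (σ j - σ k)) (opCost (σ j) (σ k))
  | mul (σ : ℕ → ℤ) (i j k : ℕ) :
      Runs (.mul i j k) σ (Function.update σ i (σ j * σ k)) (opCost (σ j) (σ k))
  | div (σ : ℕ → ℤ) (i j k : ℕ) :
      Runs (.div i j k) σ (Function.update σ i (σ j / σ k)) (opCost (σ j) (σ k))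
  | seq {P Q : Prog} {σ τ υ : ℕ → ℤ} {S T : ℕ} (hP : Runs P σ τ S) (hQ : Runs Q τ υ T) :
      Runs (.seq P Q) σ υ (S + T)
  | ite_pos {P Q : Prog} {i : ℕ} {σ τ : ℕ → ℤ} {T : ℕ} (hi : 0 < σ i) (hP : Runs P σ τ T) :
      Runs (.ite i P Q) σ τ (1 + bitLen (σ i) + T)
  | ite_neg {P Q : Prog} {i : ℕ} {σ τ : ℕ → ℤ} {T : ℕ} (hi : ¬ 0 < σ i) (hQ : Runs Q σ τ T) :
      Runs (.ite i P Q) σ τ (1 + bitLen (σ i) + T)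
  | loop_stop {P : Prog} {i : ℕ} {σ : ℕ → ℤ} (hi : ¬ 0 < σ i) :
      Runs (.loop i P) σ σ (1 + bitLen (σ i))
  | loop_step {P : Prog} {i : ℕ} {σ τ υ : ℕ → ℤ} {S T : ℕ} (hi : 0 < σ i)
      (hP : Runs P σ τ S) (hL : Runs (.loop i P) τ υ T) :
      Runs (.loop i P) σ υ (1 + bitLen (σ i) + S + T)

/-- The initial register contents: the inputs in registers `0, 1, …`, and `0` elsewhere. -/
def initRegs (inputs : List ℤ) : ℕ → ℤ := fun i => inputs.getD i 0

end PrincipalCycle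

open PrincipalCycle

namespace PrincipalCycle

/-! ### Integer expressions and assignments -/

/-! Write 𝒪 = γI, so that I² = γ⁻²𝒪. If J is a reduced principal ideal with 𝒪 = δJ, then δ is a
minimum of 𝒪 up to sign, so η = γ⁻²δ is one of I², and ln|δ| exceeds 2 ln|γ| exactly when |η| > 1.
The `*`-square of I therefore amounts to the first minimum of the lattice I² beyond 1, and ln|η| is
the increment of the distance over 2 ln|γ|. `PrincipalCycle.exists_isStarSquare` turns a pair of
consecutive minima p ≤ 1 < β of I² into the `*`-square. Uniqueness is easy: the distance determines
δ up to sign, hence the ideal.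

A basis of I² comes from composition of forms (`mem_latt_sq`): with g = gcd(a, b), the lattice gI²
is ℤ + ℤθ₀ with an explicit θ₀. This needs gcd(a, b, (D - b²)/4a) = 1, which holds because D is
fundamental. The first minimum above g is then found by a continued fraction expansion, driven by
the conjugate of θ: the basis e, eθ is replaced by eθ, e + q·eθ, where q is the integer part of
-1/θ' (`IsCFState.step`). The coefficients of e in the basis 1, θ₀ grow geometrically but stay below
a power of D until the bound g is passed, so O(log D) steps suffice. When |e| first exceeds g, the
preceding basis is reduced, so its two members are consecutive minima (`IsSearch.step`,
`IsSearch.exists_isStarSquare`).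

The logarithm of β = |e|/g is obtained from J successive square roots and ln r ≈ r - 1 for r close
to 1 (`log_scaled_bounds`). In units of 2^-(n+m+2), one squaring doubles the error of the distance
and adds at most 1. From an initial error of at most 1, n squarings give at most 2^(n+1) - 1, less
than half of 2^-m, and the final rounding takes the other half.

The length of the input t depends on log(1 + |x|), the claimed cost on log(1 + |x|/R). They differ
by O(log D), because a pigeonhole argument on the cycle of reduced bases gives R ≤ 3D²
(`regulator_bounds`).

On the machine side, `Tri` is a total-correctness judgement in which a single number b bounds the
bit length of all registers and cost is counted in units of one assignment. Both b and the cost turn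
out polynomial. Existence of the `*`-square itself is read off from a run of the program
(`exists_starSquare`). -/

/-- Integer expressions over the registers. -/
inductive Ex : Type
  | lit (c : ℤ)
  | reg (i : ℕ)
  | add (e f : Ex)
  | sub (e f : Ex)
  | mul (e f : Ex)
  | div (e f : Ex)

namespace Ex

/-- The value of an expression. -/
def eval (σ : ℕ → ℤ) : Ex → ℤ
  | lit c => c
  | reg i => σ i
  | add e f => e.eval σ + f.eval σ
  | sub e f => e.eval σ - f.eval σ
  | mul e f => e.eval σ * f.eval σ
  | div e f => e.eval σ / f.eval σ

/-- The number of leaves of an expression. -/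
def leaves : Ex → ℕ
  | lit _ => 1
  | reg _ => 1
  | add e f => e.leaves + f.leaves
  | sub e f => e.leaves + f.leaves
  | mul e f => e.leaves + f.leaves
  | div e f => e.leaves + f.leaves

/-- All registers are below `64`, all constants are at most `32` in absolute value. -/
def Small : Ex → Bool
  | lit c => decide (c.natAbs ≤ 32)
  | reg i => decide (i < 64)
  | add e f => e.Small && f.Small
  | sub e f => e.Small && f.Small
  | mul e f => e.Small && f.Small
  | div e f => e.Small && f.Small

/-- The program that puts the value of an expression into register `t`, with the registers above
`t` for intermediate results. -/
def code (t : ℕ) : Ex → Prog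
  | lit c => .const t c
  | reg i => .seq (.const t 0) (.add t t i)
  | add e f => .seq (e.code t) (.seq (f.code (t + 1)) (.add t t (t + 1)))
  | sub e f => .seq (e.code t) (.seq (f.code (t + 1)) (.sub t t (t + 1)))
  | mul e f => .seq (e.code t) (.seq (f.code (t + 1)) (.mul t t (t + 1)))
  | div e f => .seq (e.code t) (.seq (f.code (t + 1)) (.div t t (t + 1)))

theorem one_le_leaves (e : Ex) : 1 ≤ e.leaves := by
  induction e <;> simp [leaves] <;> omega

theorem eval_congr {σ τ : ℕ → ℤ} (h : ∀ i < 64, σ i = τ i) (e : Ex) (he : e.Small = true) :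
    e.eval σ = e.eval τ := by
  induction e with
  | lit c => rfl
  | reg i => exact h i (by simpa [Small] using he)
  | add e f he' hf' | sub e f he' hf' | mul e f he' hf' | div e f he' hf' =>
    simp only [Small, Bool.and_eq_true] at he
    simp only [eval, he' he.1, hf' he.2]

end Ex

/-- The registers below `64` hold numbers of absolute value at most `2 ^ b`. -/
def Bdd (b : ℕ) (σ : ℕ → ℤ) : Prop := ∀ i < 64, |σ i| ≤ 2 ^ b

/-- Bounds that are at least 2 satisfy x + y ≤ xy, so every operation at most multiplies the bounds
of its operands and the exponent is additive over the leaves. The assumption 5 ≤ b accommodates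
constants up to 32. -/
theorem Ex.abs_eval_le {b : ℕ} (hb : 5 ≤ b) {σ : ℕ → ℤ} (hσ : Bdd b σ) (e : Ex)
    (he : e.Small = true) : |e.eval σ| ≤ 2 ^ (b * e.leaves) := by
  have h2 : ∀ e : Ex, (2 : ℤ) ≤ 2 ^ (b * e.leaves) := fun e => by
    have h1 : 1 ≤ b * e.leaves := Nat.mul_pos (by omega) e.one_le_leaves
    calc (2 : ℤ) = 2 ^ 1 := by norm_num
      _ ≤ _ := pow_le_pow_right₀ (by norm_num) h1
  have hsum : ∀ x y : ℤ, 2 ≤ x → 2 ≤ y → x + y ≤ x * y := fun x y hx hy => by nlinarith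
  induction e with
  | lit c =>
    have : c.natAbs ≤ 32 := by simpa [Small] using he
    have h3 : (2 : ℤ) ^ 5 ≤ 2 ^ (b * 1) := pow_le_pow_right₀ (by norm_num) (by omega)
    simp only [eval, leaves]
    have : |c| ≤ 32 := by rw [Int.abs_eq_natAbs]; exact_mod_cast this
    linarith
  | reg i => simpa [leaves, eval] using hσ i (by simpa [Small] using he)
  | add e f he' hf' =>
    simp only [Small, Bool.and_eq_true] at he
    have h := abs_add_le (e.eval σ) (f.eval σ)
    have := hsum _ _ (h2 e) (h2 f)
    simp only [eval, leaves, mul_add, pow_add]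
    linarith [he' he.1, hf' he.2]
  | sub e f he' hf' =>
    simp only [Small, Bool.and_eq_true] at he
    have h := abs_sub (e.eval σ) (f.eval σ)
    have := hsum _ _ (h2 e) (h2 f)
    simp only [eval, leaves, mul_add, pow_add]
    linarith [he' he.1, hf' he.2]
  | mul e f he' hf' =>
    simp only [Small, Bool.and_eq_true] at he
    simp only [eval, leaves, mul_add, pow_add, abs_mul]
    exact mul_le_mul (he' he.1) (hf' he.2) (abs_nonneg _) (by positivity)
  | div e f he' hf' =>
    simp only [Small, Bool.and_eq_true] at he
    have h1 : |e.eval σ / f.eval σ| ≤ |e.eval σ| := by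
      have := Int.natAbs_ediv_le_natAbs (e.eval σ) (f.eval σ)
      rw [Int.abs_eq_natAbs, Int.abs_eq_natAbs]; exact_mod_cast this
    have h3 : (1 : ℤ) ≤ 2 ^ (b * f.leaves) := by linarith [h2 f]
    simp only [eval, leaves, mul_add, pow_add]
    nlinarith [he' he.1, h2 e]

theorem bitLen_le {z : ℤ} {k : ℕ} (h : |z| ≤ 2 ^ k) : bitLen z ≤ k + 1 := by
  rw [bitLen, Nat.size_le]
  have h1 : (z.natAbs : ℤ) ≤ ((2 ^ k : ℕ) : ℤ) := by
    rw [← Int.abs_eq_natAbs]; exact_mod_cast h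
  have h2 : z.natAbs ≤ 2 ^ k := by exact_mod_cast h1
  have h3 : 0 < 2 ^ k := by positivity
  rw [pow_succ]; omega

theorem opCost_le {y z : ℤ} {k : ℕ} (hy : |y| ≤ 2 ^ k) (hz : |z| ≤ 2 ^ k) :
    opCost y z ≤ (k + 2) ^ 2 := by
  rw [opCost, pow_two]
  exact Nat.mul_le_mul (by linarith [bitLen_le hy]) (by linarith [bitLen_le hz])

/-- The summand (40b + 2)² added to T is a credit: of the two credits left over by the operands of a
binary operation, one pays for the operation and the other is passed on. Registers from t upwards
are scratch space, so the registers below t survive. -/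
theorem Ex.code_runs {b : ℕ} (hb : 5 ≤ b) (e : Ex) (he : e.Small = true) (hl : e.leaves ≤ 40) :
    ∀ t : ℕ, 64 ≤ t → ∀ σ : ℕ → ℤ, Bdd b σ →
      ∃ (τ : ℕ → ℤ) (T : ℕ), Runs (e.code t) σ τ T ∧
        T + (40 * b + 2) ^ 2 ≤ 3 * e.leaves * (40 * b + 2) ^ 2 ∧
        τ t = e.eval σ ∧ ∀ i < t, τ i = σ i := by
  have hbin : ∀ (e f : Ex) (op : ℕ → ℕ → ℕ → Prog) (g : ℤ → ℤ → ℤ),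
      (∀ (σ : ℕ → ℤ) (i j k : ℕ),
        Runs (op i j k) σ (Function.update σ i (g (σ j) (σ k))) (opCost (σ j) (σ k))) →
      e.Small = true → f.Small = true → e.leaves + f.leaves ≤ 40 →
      (∀ (t : ℕ), 64 ≤ t → ∀ σ, Bdd b σ → ∃ (τ : ℕ → ℤ) (T : ℕ), Runs (e.code t) σ τ T ∧
        T + (40 * b + 2) ^ 2 ≤ 3 * e.leaves * (40 * b + 2) ^ 2 ∧ τ t = e.eval σ ∧
          ∀ i < t, τ i = σ i) →
      (∀ (t : ℕ), 64 ≤ t → ∀ σ, Bdd b σ → ∃ (τ : ℕ → ℤ) (T : ℕ), Runs (f.code t) σ τ T ∧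
        T + (40 * b + 2) ^ 2 ≤ 3 * f.leaves * (40 * b + 2) ^ 2 ∧ τ t = f.eval σ ∧
          ∀ i < t, τ i = σ i) →
      ∀ (t : ℕ), 64 ≤ t → ∀ σ, Bdd b σ → ∃ (τ : ℕ → ℤ) (T : ℕ),
        Runs (.seq (e.code t) (.seq (f.code (t + 1)) (op t t (t + 1)))) σ τ T ∧
        T + (40 * b + 2) ^ 2 ≤ 3 * (e.leaves + f.leaves) * (40 * b + 2) ^ 2 ∧
        τ t = g (e.eval σ) (f.eval σ) ∧ ∀ i < t, τ i = σ i := by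
    intro e f op g hop he hf hl h1 h2 t ht σ hσ
    have hle : ∀ e : Ex, e.Small = true → e.leaves ≤ 40 → |e.eval σ| ≤ 2 ^ (40 * b) :=
      fun e he hl => (e.abs_eval_le hb hσ he).trans
        (pow_le_pow_right₀ (by norm_num) (by rw [mul_comm]; exact Nat.mul_le_mul_right _ hl))
    obtain ⟨τ₁, T₁, r₁, c₁, v₁, u₁⟩ := h1 t ht σ hσ
    have hσ₁ : Bdd b τ₁ := fun i hi => by rw [u₁ i (by omega)]; exact hσ i hi
    obtain ⟨τ₂, T₂, r₂, c₂, v₂, u₂⟩ := h2 (t + 1) (by omega) τ₁ hσ₁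
    have e1 : τ₂ t = e.eval σ := by rw [u₂ t (by omega), v₁]
    have e2 : τ₂ (t + 1) = f.eval σ := by
      rw [v₂]; exact f.eval_congr (fun i hi => u₁ i (by omega)) hf
    refine ⟨_, _, Runs.seq r₁ (Runs.seq r₂ (hop τ₂ t t (t + 1))), ?_, ?_, ?_⟩
    · have h40 := opCost_le (hle e he (by omega)) (hle f hf (by omega))
      rw [e1, e2, mul_add, add_mul]
      omega
    · simp [e1, e2]
    · intro i hi
      rw [Function.update_of_ne (by omega), u₂ i (by omega), u₁ i hi]
  have hK : 2 * (b + 4) ≤ (40 * b + 2) ^ 2 := by nlinarith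
  induction e with
  | lit c =>
    intro t ht σ hσ
    refine ⟨_, _, Runs.const σ t c, ?_, by simp [eval], fun i hi => by
      rw [Function.update_of_ne (by omega)]⟩
    have : c.natAbs ≤ 32 := by simpa [Small] using he
    have := Nat.size_le_size this
    have h32 : Nat.size 32 = 6 := by decide
    simp only [bitLen, leaves]
    omega
  | reg i =>
    intro t ht σ hσ
    have hi : i < 64 := by simpa [Small] using he
    refine ⟨_, _, Runs.seq (Runs.const σ t 0) (Runs.add _ t t i), ?_, ?_, fun j hj => ?_⟩
    · have := bitLen_le (hσ i hi)
      rw [Function.update_self, Function.update_of_ne (by omega)]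
      simp only [opCost, leaves, bitLen, Int.natAbs_zero, Nat.size_zero] at *
      omega
    · rw [Function.update_self, Function.update_self, Function.update_of_ne (by omega)]
      simp [eval]
    · rw [Function.update_of_ne (by omega), Function.update_of_ne (by omega)]
  | add e f he' hf' =>
    simp only [Small, Bool.and_eq_true, leaves] at he hl
    exact hbin e f .add (· + ·) (fun σ i j k => .add σ i j k) he.1 he.2 hl
      (he' he.1 (by omega)) (hf' he.2 (by omega))
  | sub e f he' hf' =>
    simp only [Small, Bool.and_eq_true, leaves] at he hl
    exact hbin e f .sub (· - ·) (fun σ i j k => .sub σ i j k) he.1 he.2 hl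
      (he' he.1 (by omega)) (hf' he.2 (by omega))
  | mul e f he' hf' =>
    simp only [Small, Bool.and_eq_true, leaves] at he hl
    exact hbin e f .mul (· * ·) (fun σ i j k => .mul σ i j k) he.1 he.2 hl
      (he' he.1 (by omega)) (hf' he.2 (by omega))
  | div e f he' hf' =>
    simp only [Small, Bool.and_eq_true, leaves] at he hl
    exact hbin e f .div (· / ·) (fun σ i j k => .div σ i j k) he.1 he.2 hl
      (he' he.1 (by omega)) (hf' he.2 (by omega))

/-- The assignment of the value of an expression to a register. -/
def asg (i : ℕ) (e : Ex) : Prog := .seq (e.code 64) (.seq (.const i 0) (.add i i 64))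

/-! ### Total correctness with a cost bound -/

/-- The number of bit operations allowed for one assignment to registers of `b` bits. -/
def unitCost (b : ℕ) : ℕ := 130 * (40 * b + 2) ^ 2

/-- Started in a state that agrees with `σ` on the registers below `64`, the program `P` halts
after at most `N * unitCost b` bit operations in a state with the property `Q`, provided that the
registers have at most `b` bits. -/
def Tri (b N : ℕ) (P : Prog) (σ : ℕ → ℤ) (Q : (ℕ → ℤ) → Prop) : Prop :=
  ∀ σ' : ℕ → ℤ, (∀ i < 64, σ' i = σ i) → Bdd b σ →
    ∃ (τ τ' : ℕ → ℤ) (T : ℕ), Runs P σ' τ' T ∧ T ≤ N * unitCost b ∧ (∀ i < 64, τ' i = τ i) ∧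
      Bdd b τ ∧ Q τ

theorem Tri.asg {b : ℕ} (hb : 5 ≤ b) {σ : ℕ → ℤ} {Q : (ℕ → ℤ) → Prop} {i : ℕ} {e : Ex}
    (he : e.Small = true) (hl : e.leaves ≤ 40) (hi : i < 64) (hv : Bdd b σ → |e.eval σ| ≤ 2 ^ b)
    (hQ : Q (Function.update σ i (e.eval σ))) : Tri b 1 (asg i e) σ Q := by
  intro σ' hσ' hσ
  have hB' : Bdd b σ' := fun j hj => by rw [hσ' j hj]; exact hσ j hj
  obtain ⟨τ, T, r, hT, hv1, hv2⟩ := e.code_runs hb he hl 64 le_rfl σ' hB'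
  have hev : e.eval σ' = e.eval σ := e.eval_congr hσ' he
  refine ⟨_, _, _, Runs.seq r (Runs.seq (Runs.const τ i 0) (Runs.add _ i i 64)), ?_, ?_, ?_, hQ⟩
  · rw [Function.update_self, Function.update_of_ne (by omega), hv1, hev]
    have h1 := bitLen_le (hv hσ)
    have h0 : bitLen 0 = 0 := by decide
    -- Of the factor 130 in `unitCost`, 3 · 40 pays for the evaluation and the remainder for copying
    -- the result into register i.
    have h2 : 3 * e.leaves * (40 * b + 2) ^ 2 ≤ 3 * 40 * (40 * b + 2) ^ 2 :=
      Nat.mul_le_mul_right _ (by omega)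
    have hK : 2 * (b + 4) ≤ (40 * b + 2) ^ 2 := by nlinarith
    simp only [opCost, unitCost, h0]
    omega
  · intro j hj
    rw [Function.update_self, Function.update_of_ne (show 64 ≠ i by omega), hv1, hev, zero_add]
    by_cases h : j = i
    · subst h; simp
    · rw [Function.update_of_ne h, Function.update_of_ne h, Function.update_of_ne h, hv2 j hj,
        hσ' j hj]
  · intro j hj
    by_cases h : j = i
    · subst h; simpa using hv hσ
    · rw [Function.update_of_ne h]; exact hσ j hj

theorem Tri.mono {b N M : ℕ} {P : Prog} {σ : ℕ → ℤ} {Q R : (ℕ → ℤ) → Prop} (h : Tri b N P σ Q)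
    (hN : N ≤ M) (hQ : ∀ τ, Bdd b τ → Q τ → R τ) : Tri b M P σ R := by
  intro σ' h1 h2
  obtain ⟨τ, τ', T, r, hT, h3, h4, h5⟩ := h σ' h1 h2
  exact ⟨τ, τ', T, r, hT.trans (Nat.mul_le_mul_right _ hN), h3, h4, hQ τ h4 h5⟩

theorem Tri.of_bdd {b N : ℕ} {P : Prog} {σ : ℕ → ℤ} {Q : (ℕ → ℤ) → Prop}
    (h : Bdd b σ → Tri b N P σ Q) : Tri b N P σ Q := fun σ' h1 h2 => h h2 σ' h1 h2

theorem Tri.seq {b N M : ℕ} {P P' : Prog} {σ : ℕ → ℤ} {Q R : (ℕ → ℤ) → Prop}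
    (h : Tri b N P σ R) (h' : ∀ τ, R τ → Tri b M P' τ Q) : Tri b (N + M) (.seq P P') σ Q := by
  intro σ' h1 h2
  obtain ⟨τ, τ', T, r, hT, h3, h4, h5⟩ := h σ' h1 h2
  obtain ⟨υ, υ', S, s, hS, h6, h7, h8⟩ := h' τ h5 τ' h3 h4
  exact ⟨υ, υ', T + S, .seq r s, by rw [add_mul]; omega, h6, h7, h8⟩

theorem Tri.asg_seq {b : ℕ} (hb : 5 ≤ b) {σ : ℕ → ℤ} {Q : (ℕ → ℤ) → Prop} {i M : ℕ} {e : Ex}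
    {P : Prog} (he : e.Small = true) (hl : e.leaves ≤ 40) (hi : i < 64)
    (hv : Bdd b σ → |e.eval σ| ≤ 2 ^ b)
    (hP : Tri b M P (Function.update σ i (e.eval σ)) Q) :
    Tri b (M + 1) (.seq (PrincipalCycle.asg i e) P) σ Q := by
  rw [add_comm]
  exact Tri.seq (R := fun τ => τ = Function.update σ i (e.eval σ)) (Tri.asg hb he hl hi hv rfl)
    (fun τ h => h ▸ hP)

theorem one_add_bitLen_le_unitCost {b : ℕ} (hb : 5 ≤ b) {z : ℤ} (hz : |z| ≤ 2 ^ b) :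
    1 + bitLen z ≤ unitCost b := by
  have h1 := bitLen_le hz
  have hK : 2 * (b + 4) ≤ (40 * b + 2) ^ 2 := by nlinarith
  simp only [unitCost]
  omega

theorem Tri.ite {b N : ℕ} (hb : 5 ≤ b) {P P' : Prog} {i : ℕ} (hi : i < 64) {σ : ℕ → ℤ}
    {Q : (ℕ → ℤ) → Prop} (h : 0 < σ i → Tri b N P σ Q) (h' : σ i ≤ 0 → Tri b N P' σ Q) :
    Tri b (N + 1) (.ite i P P') σ Q := by
  intro σ' h1 h2
  have hc : 1 + bitLen (σ' i) ≤ unitCost b :=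
    one_add_bitLen_le_unitCost hb (by rw [h1 i hi]; exact h2 i hi)
  by_cases hp : 0 < σ i
  · obtain ⟨τ, τ', T, r, hT, h3⟩ := h hp σ' h1 h2
    exact ⟨τ, τ', _, .ite_pos (by rwa [h1 i hi]) r, by rw [add_mul]; omega, h3⟩
  · obtain ⟨τ, τ', T, r, hT, h3⟩ := h' (not_lt.1 hp) σ' h1 h2
    exact ⟨τ, τ', _, .ite_neg (by rwa [h1 i hi]) r, by rw [add_mul]; omega, h3⟩

/-- A loop with an invariant that depends on the number of passes, which is at most `K`. -/
theorem Tri.loop {b K N : ℕ} (hb : 5 ≤ b) {P : Prog} {i : ℕ} (hi : i < 64) {σ : ℕ → ℤ}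
    (Inv : ℕ → (ℕ → ℤ) → Prop) (h0 : Inv 0 σ)
    (hK : ∀ k σ, Bdd b σ → Inv k σ → 0 < σ i → k < K)
    (step : ∀ k σ, Bdd b σ → Inv k σ → 0 < σ i → Tri b N P σ (Inv (k + 1))) :
    Tri b (K * (N + 1) + 1) (.loop i P) σ (fun τ => (∃ k ≤ K, Inv k τ) ∧ τ i ≤ 0) := by
  -- Induction on a bound j for the number K - k of passes that remain, for all indices k of the
  -- invariant at once.
  suffices H : ∀ j k σ, k ≤ K → K - k ≤ j → Inv k σ → Tri b (j * (N + 1) + 1) (.loop i P) σ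
      (fun τ => (∃ k ≤ K, Inv k τ) ∧ τ i ≤ 0) from H K 0 σ (Nat.zero_le K) le_rfl h0
  intro j
  induction j with
  | zero =>
    intro k σ hk hj hI σ' h1 h2
    have hc : 1 + bitLen (σ' i) ≤ unitCost b :=
      one_add_bitLen_le_unitCost hb (by rw [h1 i hi]; exact h2 i hi)
    have hp : ¬ 0 < σ i := fun hp => by have := hK k σ h2 hI hp; omega
    exact ⟨σ, σ', _, Runs.loop_stop (by rwa [h1 i hi]), by simpa using hc, h1, h2, ⟨k, hk, hI⟩,
      not_lt.1 hp⟩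
  | succ j ih =>
    intro k σ hk hj hI σ' h1 h2
    have hc : 1 + bitLen (σ' i) ≤ unitCost b :=
      one_add_bitLen_le_unitCost hb (by rw [h1 i hi]; exact h2 i hi)
    by_cases hp : 0 < σ i
    · have hlt := hK k σ h2 hI hp
      obtain ⟨τ, τ', T, r, hT, h3, h4, h5⟩ := step k σ h2 hI hp σ' h1 h2
      obtain ⟨υ, υ', S, s, hS, h6⟩ := ih (k + 1) τ hlt (by omega) h5 τ' h3 h4
      refine ⟨υ, υ', _, .loop_step (by rwa [h1 i hi]) r s, ?_, h6⟩
      have : ((j + 1) * (N + 1) + 1) * unitCost b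
        = unitCost b + N * unitCost b + (j * (N + 1) + 1) * unitCost b := by ring
      omega
    · refine ⟨σ, σ', _, Runs.loop_stop (by rwa [h1 i hi]), ?_, h1, h2, ⟨k, hk, hI⟩, not_lt.1 hp⟩
      exact hc.trans (Nat.le_mul_of_pos_left _ (by positivity))

/-! ### The two real embeddings -/

/-- `ℚ[√d]` is a field. -/
class NonsquareRat (d : ℕ) : Prop extends Fact (∀ r : ℚ, r ^ 2 ≠ (d : ℚ) + 0 * r)

theorem not_isSquare_of_squarefree {d : ℕ} (hd : Squarefree d) (h1 : 1 < d) : ¬ IsSquare d := by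
  rintro ⟨k, rfl⟩
  have := Nat.isUnit_iff.1 (hd k dvd_rfl)
  subst this; omega

theorem nonsquareRat {d : ℕ} (hd : Squarefree d) (h1 : 1 < d) : NonsquareRat d where
  out r hr := by
    have h : IsSquare ((d : ℕ) : ℚ) := ⟨r, by linarith [pow_two r]⟩
    exact not_isSquare_of_squarefree hd h1 (Rat.isSquare_natCast_iff.1 h)

/-- `r + s√d` as a ring homomorphism. -/
noncomputable def valHom (d : ℕ) : QuadField d →+* ℝ where
  toFun := val
  map_one' := by simp [val, QuadraticAlgebra.re_one, QuadraticAlgebra.im_one]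
  map_zero' := by simp [val]
  map_add' x y := by simp [val]; ring
  map_mul' x y := by
    have h : √(d : ℝ) * √(d : ℝ) = d := Real.mul_self_sqrt (Nat.cast_nonneg d)
    simp [val]; linear_combination (-(x.im : ℝ) * y.im) * h

/-- `r - s√d` as a ring homomorphism. -/
noncomputable def conjHom (d : ℕ) : QuadField d →+* ℝ where
  toFun := conjVal
  map_one' := by simp [conjVal, QuadraticAlgebra.re_one, QuadraticAlgebra.im_one]
  map_zero' := by simp [conjVal]
  map_add' x y := by simp [conjVal]; ring
  map_mul' x y := by
    have h : √(d : ℝ) * √(d : ℝ) = d := Real.mul_self_sqrt (Nat.cast_nonneg d)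
    simp [conjVal]; linear_combination (-(x.im : ℝ) * y.im) * h

variable {d : ℕ}

theorem val_add (x y : QuadField d) : val (x + y) = val x + val y := map_add (valHom d) x y
theorem val_sub (x y : QuadField d) : val (x - y) = val x - val y := map_sub (valHom d) x y
theorem val_neg (x : QuadField d) : val (-x) = - val x := map_neg (valHom d) x
theorem val_mul (x y : QuadField d) : val (x * y) = val x * val y := map_mul (valHom d) x y
theorem val_intCast (n : ℤ) : val (n : QuadField d) = n := map_intCast (valHom d) n
theorem val_one : val (1 : QuadField d) = 1 := map_one (valHom d)
theorem val_zero : val (0 : QuadField d) = 0 := map_zero (valHom d)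
theorem conjVal_add (x y : QuadField d) : conjVal (x + y) = conjVal x + conjVal y :=
  map_add (conjHom d) x y
theorem conjVal_sub (x y : QuadField d) : conjVal (x - y) = conjVal x - conjVal y :=
  map_sub (conjHom d) x y
theorem conjVal_mul (x y : QuadField d) : conjVal (x * y) = conjVal x * conjVal y :=
  map_mul (conjHom d) x y
theorem conjVal_intCast (n : ℤ) : conjVal (n : QuadField d) = n := map_intCast (conjHom d) n
theorem conjVal_one : conjVal (1 : QuadField d) = 1 := map_one (conjHom d)
theorem conjVal_zero : conjVal (0 : QuadField d) = 0 := map_zero (conjHom d)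

theorem val_injective [NonsquareRat d] : Function.Injective (val : QuadField d → ℝ) :=
  (valHom d).injective

theorem conjVal_injective [NonsquareRat d] : Function.Injective (conjVal : QuadField d → ℝ) :=
  (conjHom d).injective

theorem val_ne_zero [NonsquareRat d] {x : QuadField d} (hx : x ≠ 0) : val x ≠ 0 := fun h =>
  hx (val_injective (h.trans val_zero.symm))

theorem conjVal_ne_zero [NonsquareRat d] {x : QuadField d} (hx : x ≠ 0) : conjVal x ≠ 0 := fun h =>
  hx (conjVal_injective (h.trans conjVal_zero.symm))

theorem val_inv [NonsquareRat d] (x : QuadField d) : val x⁻¹ = (val x)⁻¹ := map_inv₀ (valHom d) x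

theorem conjVal_inv [NonsquareRat d] (x : QuadField d) : conjVal x⁻¹ = (conjVal x)⁻¹ :=
  map_inv₀ (conjHom d) x

theorem eq_or_eq_neg_of_abs_val_eq [NonsquareRat d] {x y : QuadField d}
    (h : |val x| = |val y|) : x = y ∨ x = -y := by
  rcases abs_eq_abs.1 h with h | h
  · exact .inl (val_injective h)
  · exact .inr (val_injective (by rw [h, val_neg]))

/-! ### Quadratic irrationalities -/

/-- `(B + √D) / 2A`. -/
def quadIrr (d : ℕ) (A B : ℤ) : QuadField d :=
  (1 / (2 * (A : ℚ))) • ((B : QuadField d) + sqrtDisc d)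

theorem val_ratSmul (r : ℚ) (x : QuadField d) : val (r • x) = r * val x := by
  simp [val]; ring

theorem conjVal_ratSmul (r : ℚ) (x : QuadField d) : conjVal (r • x) = r * conjVal x := by
  simp [conjVal]; ring

theorem val_sqrtDisc : val (sqrtDisc d) = √(disc d : ℝ) := by
  unfold val sqrtDisc disc
  split_ifs
  · simp
  · push_cast
    rw [Real.sqrt_mul (by norm_num), show (4 : ℝ) = 2 ^ 2 by norm_num,
      Real.sqrt_sq (by norm_num)]
    simp

theorem conjVal_sqrtDisc : conjVal (sqrtDisc d) = -√(disc d : ℝ) := by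
  rw [← val_sqrtDisc]
  simp [val, conjVal, sqrtDisc]

theorem val_quadIrr (A B : ℤ) : val (quadIrr d A B) = (B + √(disc d : ℝ)) / (2 * A) := by
  rw [quadIrr, val_ratSmul, val_add, val_intCast, val_sqrtDisc]
  push_cast; ring

theorem conjVal_quadIrr (A B : ℤ) : conjVal (quadIrr d A B) = (B - √(disc d : ℝ)) / (2 * A) := by
  rw [quadIrr, conjVal_ratSmul, conjVal_add, conjVal_intCast, conjVal_sqrtDisc]
  push_cast; ring

theorem five_le_disc (h1 : 1 < d) : 5 ≤ disc d := by
  unfold disc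
  split_ifs <;> omega

theorem sq_ne_disc_mul_sq [NonsquareRat d] {x y : ℤ} (hy : y ≠ 0) :
    x ^ 2 ≠ (disc d : ℤ) * y ^ 2 := by
  intro h
  have hyq : (y : ℚ) ≠ 0 := by exact_mod_cast hy
  unfold disc at h
  split_ifs at h
  · apply (NonsquareRat.toFact (d := d)).out (x / y)
    have : (x : ℚ) ^ 2 = d * y ^ 2 := by exact_mod_cast h
    field_simp; linarith
  · apply (NonsquareRat.toFact (d := d)).out (x / (2 * y))
    have : (x : ℚ) ^ 2 = (4 * d) * y ^ 2 := by exact_mod_cast h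
    field_simp; linarith

theorem intCast_ne_mul_sqrt_disc [NonsquareRat d] {x y : ℤ} (hy : y ≠ 0) :
    (x : ℝ) ≠ y * √(disc d : ℝ) := by
  intro h
  have h2 : (x : ℝ) ^ 2 = (disc d : ℝ) * y ^ 2 := by
    rw [h, mul_pow, Real.sq_sqrt (Nat.cast_nonneg _)]; ring
  exact sq_ne_disc_mul_sq (d := d) hy (by exact_mod_cast h2)

/-! ### Lattices -/

/-- The additive group generated by `p` and `q`. -/
def latt (p q : QuadField d) : Set (QuadField d) := {ξ | ∃ x y : ℤ, ξ = x * p + y * q}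

theorem left_mem_latt (p q : QuadField d) : p ∈ latt p q := ⟨1, 0, by simp⟩

theorem right_mem_latt (p q : QuadField d) : q ∈ latt p q := ⟨0, 1, by simp⟩

theorem latt_step (p q : QuadField d) (k : ℤ) : latt q (p + k * q) = latt p q := by
  ext ξ
  constructor
  · rintro ⟨x, y, rfl⟩
    exact ⟨y, x + y * k, by push_cast; ring⟩
  · rintro ⟨x, y, rfl⟩
    exact ⟨y - x * k, x, by push_cast; ring⟩

theorem latt_shift (p q : QuadField d) (k : ℤ) : latt p (q + k * p) = latt p q := by
  ext ξ
  constructor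
  · rintro ⟨x, y, rfl⟩
    exact ⟨x + y * k, y, by push_cast; ring⟩
  · rintro ⟨x, y, rfl⟩
    exact ⟨x - y * k, y, by push_cast; ring⟩

theorem neg_mem_latt {p q ξ : QuadField d} (h : ξ ∈ latt p q) : -ξ ∈ latt p q := by
  obtain ⟨x, y, rfl⟩ := h
  exact ⟨-x, -y, by push_cast; ring⟩

theorem mul_mem_latt_iff [NonsquareRat d] {c : QuadField d} (hc : c ≠ 0) (p q ξ : QuadField d) :
    c * ξ ∈ latt (c * p) (c * q) ↔ ξ ∈ latt p q := by
  constructor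
  · rintro ⟨x, y, h⟩
    exact ⟨x, y, mul_left_cancel₀ hc (by rw [h]; ring)⟩
  · rintro ⟨x, y, rfl⟩
    exact ⟨x, y, by ring⟩

/-- In a plane lattice with basis `(p, p')`, `(q, q')`, where `0 < p < q` and `p'`, `q'` have
opposite signs and `|q'| < |p'|`, a point `(z, z')` with `|z| < q` and `|z'| ≤ |p'|` is a multiple
of the first basis vector. -/
theorem coeff_eq_zero_of_consecutive {p q p' q' : ℝ} (hp : 0 < p) (hq : p < q)
    (hs : p' * q' < 0) {x y : ℤ} (h : |x * p + y * q| < q) (h' : |x * p' + y * q'| ≤ |p'|) :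
    y = 0 := by
  -- Let y > 0. If x ≥ 0, the first coordinate is at least q. If x ≤ -1, then xp' and yq' have the
  -- same sign, so the second coordinate exceeds |p'| in absolute value. Negative y reduces to this
  -- case by negation.
  have key : ∀ x y : ℤ, |x * p + y * q| < q → |x * p' + y * q'| ≤ |p'| → ¬ 0 < y := by
    intro x y h h' hy
    have hy1 : (1 : ℝ) ≤ y := by exact_mod_cast hy
    rcases le_or_gt 0 x with hx | hx
    · have hx0 : (0 : ℝ) ≤ x := by exact_mod_cast hx
      have := (abs_lt.1 h).2
      nlinarith [mul_nonneg hx0 hp.le]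
    · have hx1 : (x : ℝ) ≤ -1 := by exact_mod_cast (show x ≤ -1 by omega)
      rcases mul_neg_iff.1 hs with ⟨h1, h2⟩ | ⟨h1, h2⟩
      · rw [abs_of_pos h1] at h'
        have := (abs_le.1 h').1
        nlinarith
      · rw [abs_of_neg h1] at h'
        have := (abs_le.1 h').2
        nlinarith
  rcases lt_trichotomy y 0 with hy | hy | hy
  · refine absurd (neg_pos.2 hy) (key (-x) (-y) ?_ ?_)
    · rw [← abs_neg] at h; push_cast; convert h using 2; ring
    · rw [← abs_neg] at h'; push_cast; convert h' using 2; ring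
  · exact hy
  · exact absurd hy (key x y h h')

/-! ### Reduced ideals and their standard forms -/

/-- `θ = (B + √D) / 2A` is reduced: `θ > 1` and its conjugate lies between `-1` and `0`. -/
def IsRed (D : ℕ) (A B : ℤ) : Prop :=
  0 < A ∧ 2 * A < B + √(D : ℝ) ∧ √(D : ℝ) - 2 * A < B ∧ B < √(D : ℝ)

theorem IsRed.one_lt_val {A B : ℤ} (h : IsRed (disc d) A B) : 1 < val (quadIrr d A B) := by
  have hA : (0 : ℝ) < A := by exact_mod_cast h.1
  rw [val_quadIrr, lt_div_iff₀ (by positivity)]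
  linarith [h.2.1]

theorem IsRed.conjVal_neg {A B : ℤ} (h : IsRed (disc d) A B) : conjVal (quadIrr d A B) < 0 := by
  have hA : (0 : ℝ) < A := by exact_mod_cast h.1
  rw [conjVal_quadIrr, div_lt_iff₀ (by positivity)]
  linarith [h.2.2.2]

theorem IsRed.neg_one_lt_conjVal {A B : ℤ} (h : IsRed (disc d) A B) :
    -1 < conjVal (quadIrr d A B) := by
  have hA : (0 : ℝ) < A := by exact_mod_cast h.1
  rw [conjVal_quadIrr, lt_div_iff₀ (by positivity)]
  linarith [h.2.2.1]

theorem isRed_of_val {A B : ℤ} (hA : 0 < A) (h1 : 1 < val (quadIrr d A B))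
    (h2 : -1 < conjVal (quadIrr d A B)) (h3 : conjVal (quadIrr d A B) < 0) :
    IsRed (disc d) A B := by
  have hA' : (0 : ℝ) < A := by exact_mod_cast hA
  rw [val_quadIrr, lt_div_iff₀ (by positivity)] at h1
  rw [conjVal_quadIrr, lt_div_iff₀ (by positivity)] at h2
  rw [conjVal_quadIrr, div_lt_iff₀ (by positivity)] at h3
  exact ⟨hA, by linarith, by linarith, by linarith⟩

/-- From 2A < B + √D and B < √D follows A < √D, so only the second window of `IsTau` is relevant,
and it is part of reducedness. -/
theorem IsRed.isTau {D : ℕ} {A B : ℤ} (h : IsRed D A B) : IsTau D A B := by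
  obtain ⟨h1, h2, h3, h4⟩ := h
  exact ⟨fun h => by linarith, fun _ => ⟨h3, h4.le⟩⟩

theorem IsStandardForm.coe_eq {I : FracIdeal d} {a b : ℤ} (h : IsStandardForm I a b) :
    (I : Set (QuadField d)) = latt 1 (quadIrr d a b) := by
  rw [h.2.2.2]; simp [latt, quadIrr]

/-- Since 1 is a minimum, θ and its conjugate cannot both be below 1 in absolute value. If a > √D,
the window |b| ≤ a would make both small, so a < √D. The second window then puts the conjugate
between -1 and 0, which forces θ > 1. Equalities are excluded because √D is irrational. -/
theorem IsStandardForm.isRed [NonsquareRat d] {I : FracIdeal d} {a b : ℤ}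
    (h : IsStandardForm I a b) (hI : IsMinimum I 1) : IsRed (disc d) a b := by
  obtain ⟨ha, htau, hdvd, -⟩ := id h
  have ha' : (0 : ℝ) < a := by exact_mod_cast ha
  have hs0 : (0 : ℝ) ≤ √(disc d : ℝ) := Real.sqrt_nonneg _
  have hne : ∀ x : ℤ, (x : ℝ) ≠ √(disc d : ℝ) := fun x => by
    simpa using intCast_ne_mul_sqrt_disc (d := d) (x := x) one_ne_zero
  have hmem : quadIrr d a b ∈ I := by
    have := right_mem_latt (1 : QuadField d) (quadIrr d a b)
    rwa [← h.coe_eq] at this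
  have hs1 : 0 < √(disc d : ℝ) := lt_of_le_of_ne hs0 (by simpa using hne 0)
  have hnz : quadIrr d a b ≠ 0 := by
    intro h0
    have h1 := congrArg val h0
    rw [val_zero, val_quadIrr, div_eq_zero_iff] at h1
    rcases h1 with h1 | h1
    · exact hne (-b) (by push_cast; linarith)
    · linarith
  have hno : ¬ (|val (quadIrr d a b)| < 1 ∧ |conjVal (quadIrr d a b)| < 1) := fun hlt =>
    hI.2.2 ⟨_, hmem, hnz, by simpa [val_one] using hlt.1, by simpa [conjVal_one] using hlt.2⟩
  rw [val_quadIrr, conjVal_quadIrr, abs_lt, abs_lt, lt_div_iff₀ (by positivity),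
    lt_div_iff₀ (by positivity), div_lt_iff₀ (by positivity), div_lt_iff₀ (by positivity)] at hno
  have hale : ¬ √(disc d : ℝ) < a := fun hlt => by
    have h1 := htau.1 hlt
    have h2 : (-a : ℝ) < b := by exact_mod_cast h1.1
    have h3 : (b : ℝ) ≤ a := by exact_mod_cast h1.2
    exact hno ⟨⟨by linarith, by linarith⟩, by linarith, by linarith⟩
  have halt : (a : ℝ) < √(disc d : ℝ) := lt_of_le_of_ne (not_lt.1 hale) (hne a)
  obtain ⟨h1, h2⟩ := htau.2 halt
  have h2' := lt_of_le_of_ne h2 (hne b)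
  refine ⟨ha, ?_, h1, h2'⟩
  by_contra hcon
  have hcon' : (b : ℝ) + √(disc d : ℝ) < 2 * a := by
    refine lt_of_le_of_ne (not_lt.1 hcon) fun h => hne (2 * a - b) (by push_cast; linarith)
  exact hno ⟨⟨by linarith, by linarith⟩, by linarith, by linarith⟩

/-! ### Generators of principal ideals and the characterization of the `*`-square. -/

theorem one_mem_one : (1 : QuadField d) ∈ (1 : FracIdeal d) := Submodule.one_le.1 le_rfl

theorem mul_mem_one {x y : QuadField d} (hx : x ∈ (1 : FracIdeal d))
    (hy : y ∈ (1 : FracIdeal d)) : x * y ∈ (1 : FracIdeal d) := by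
  rw [Submodule.mem_one] at *
  obtain ⟨x, rfl⟩ := hx
  obtain ⟨y, rfl⟩ := hy
  exact ⟨x * y, map_mul _ _ _⟩

theorem ne_zero_of_one_eq_smul {I : FracIdeal d} {γ : QuadField d}
    (h : (1 : FracIdeal d) = γ • I) : γ ≠ 0 := by
  rintro rfl
  have h1 := one_mem_one (d := d)
  rw [h, Submodule.mem_smul_pointwise_iff_exists] at h1
  obtain ⟨x, -, hx⟩ := h1
  simp at hx

theorem mem_iff_of_one_eq_smul [NonsquareRat d] {I : FracIdeal d} {γ : QuadField d}
    (h : (1 : FracIdeal d) = γ • I) (ξ : QuadField d) : ξ ∈ I ↔ γ * ξ ∈ (1 : FracIdeal d) := by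
  rw [h, Submodule.mem_smul_pointwise_iff_exists]
  constructor
  · intro hξ
    exact ⟨ξ, hξ, rfl⟩
  · rintro ⟨η, hη, h2⟩
    rw [smul_eq_mul] at h2
    rwa [← mul_left_cancel₀ (ne_zero_of_one_eq_smul h) h2]

/-- Each candidate is minimal against the other, so the distances agree. Equal distances give
generators equal up to sign, hence equal ideals. -/
theorem IsStarSquare.unique [NonsquareRat d] {p q q' : FracIdeal d × ℝ} (h : IsStarSquare p q)
    (h' : IsStarSquare p q') : q = q' := by
  obtain ⟨h1, h2, h3, h4⟩ := h
  obtain ⟨h1', h2', h3', h4'⟩ := h'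
  have he : q.2 = q'.2 := le_antisymm (h4 _ _ h1' h2' h3') (h4' _ _ h1 h2 h3)
  refine Prod.ext ?_ he
  obtain ⟨γ, hγ, hx⟩ := h2
  obtain ⟨δ, hδ, hy⟩ := h2'
  have h0 := abs_pos.2 (val_ne_zero (ne_zero_of_one_eq_smul hγ))
  have h0' := abs_pos.2 (val_ne_zero (ne_zero_of_one_eq_smul hδ))
  have : |val γ| = |val δ| := Real.log_injOn_pos h0 h0' (by rw [← hx, ← hy, he])
  ext ξ
  rw [mem_iff_of_one_eq_smul hγ, mem_iff_of_one_eq_smul hδ]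
  rcases eq_or_eq_neg_of_abs_val_eq this with rfl | rfl
  · rfl
  · rw [neg_mul, Submodule.neg_mem_iff]

/-- If `L = γ⁻²𝒪` has a basis `p, β` of consecutive minima with `p ≤ 1 < β`, then `β` gives the
`*`-square. -/
theorem exists_isStarSquare [NonsquareRat d] {I : FracIdeal d} {γ p β : QuadField d}
    (hγ : (1 : FracIdeal d) = γ • I)
    (hL : ∀ ξ, γ ^ 2 * ξ ∈ (1 : FracIdeal d) ↔ ξ ∈ latt p β)
    (hp0 : 0 < val p) (hp1 : val p ≤ 1) (hβ : 1 < val β) (hs : conjVal p * conjVal β < 0)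
    (hlt : |conjVal β| < |conjVal p|) {A B : ℤ} (hAB : IsRed (disc d) A B)
    (hdvd : 4 * A ∣ B ^ 2 - (disc d : ℤ)) (hθ : latt p β = latt β (β * quadIrr d A B)) :
    ∃ J : FracIdeal d, IsStarSquare (I, Real.log |val γ|)
      (J, 2 * Real.log |val γ| + Real.log (val β)) ∧ IsStandardForm J A B := by
  have hγ0 := ne_zero_of_one_eq_smul hγ
  have hβ0 : β ≠ 0 := by rintro rfl; rw [val_zero] at hβ; linarith
  -- The ideal is J = c⁻¹𝒪 = β⁻¹L, which moves the minimum β of L to 1.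
  set c := γ ^ 2 * β with hc
  have hc0 : c ≠ 0 := mul_ne_zero (pow_ne_zero _ hγ0) hβ0
  have hone : (1 : FracIdeal d) = c • (c⁻¹ • (1 : FracIdeal d)) := by
    rw [smul_smul, mul_inv_cancel₀ hc0, one_smul]
  have hmem := mem_iff_of_one_eq_smul hone
  have hJ : ∀ ξ, ξ ∈ c⁻¹ • (1 : FracIdeal d) ↔ β * ξ ∈ latt p β := fun ξ => by
    rw [hmem, hc, mul_assoc, hL]
  have hval : Real.log |val c| = 2 * Real.log |val γ| + Real.log (val β) := by
    have h1 : |val γ| ≠ 0 := abs_ne_zero.2 (val_ne_zero hγ0)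
    rw [hc, pow_two, val_mul, val_mul, abs_mul, abs_mul, Real.log_mul (mul_ne_zero h1 h1)
      (by positivity), Real.log_mul h1 h1, abs_of_pos (show 0 < val β by linarith)]
    ring
  have hp : val p < val β := by linarith
  refine ⟨c⁻¹ • (1 : FracIdeal d), ⟨⟨⟨c⁻¹, ?_⟩, ?_, ?_, ?_⟩, ⟨c, hone, hval.symm⟩, ?_, ?_⟩,
    hAB.1, hAB.isTau, hdvd, ?_⟩
  · ext ξ
    rw [hmem, Submodule.mem_span_singleton, Submodule.mem_one]
    constructor
    · rintro ⟨o, ho⟩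
      refine ⟨o, ?_⟩
      rw [Algebra.smul_def, ho]; field_simp
    · rintro ⟨o, rfl⟩
      refine ⟨o, ?_⟩
      rw [Algebra.smul_def]; field_simp
  · rw [hJ, mul_one]; exact right_mem_latt _ _
  · rw [val_one]; exact one_pos
  -- An element η of J below 1 in both embeddings gives βη in L with |βη| < β and |(βη)'| < |p'|. It
  -- is then an integer multiple of p, and the strict bound on the conjugate makes it 0.
  · rintro ⟨η, hη, hη0, h1, h2⟩
    rw [val_one, abs_one] at h1
    rw [conjVal_one, abs_one] at h2
    obtain ⟨x, y, hxy⟩ := (hJ η).1 hη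
    have hv : |val (β * η)| < val β := by
      rw [val_mul, abs_mul, abs_of_pos (show 0 < val β by linarith)]
      nlinarith
    have hcv : |conjVal (β * η)| < |conjVal p| := by
      rw [conjVal_mul, abs_mul]
      nlinarith [abs_nonneg (conjVal β)]
    have hy : y = 0 := by
      refine coeff_eq_zero_of_consecutive hp0 hp hs (x := x) ?_ ?_
      · rwa [hxy, val_add, val_mul, val_mul, val_intCast, val_intCast] at hv
      · rw [hxy, conjVal_add, conjVal_mul, conjVal_mul, conjVal_intCast, conjVal_intCast] at hcv
        exact hcv.le
    rw [hxy, hy, conjVal_add, conjVal_mul, conjVal_mul, conjVal_intCast, conjVal_intCast,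
      Int.cast_zero, zero_mul, add_zero, abs_mul] at hcv
    have hx : x = 0 := by
      by_contra hx
      have : (1 : ℝ) ≤ |(x : ℝ)| := by exact_mod_cast Int.one_le_abs hx
      nlinarith [abs_nonneg (conjVal p)]
    rw [hx, hy] at hxy
    simp only [Int.cast_zero, zero_mul, add_zero, mul_eq_zero] at hxy
    tauto
  · simp only; linarith [Real.log_pos hβ]
  · intro J y hJ' ⟨δ, hδ, hy⟩ hlt'
    simp only at hlt' ⊢
    by_contra hcon
    rw [not_le] at hcon
    have hδ0 := ne_zero_of_one_eq_smul hδ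
    have hδmem : δ ∈ (1 : FracIdeal d) := by
      have := (mem_iff_of_one_eq_smul hδ 1).1 hJ'.2.1
      rwa [mul_one] at this
    -- A competitor with smaller distance yields η in L with 1 < |η| < β.
    set η := (γ ^ 2)⁻¹ * δ with hη
    have hη0 : η ≠ 0 := mul_ne_zero (inv_ne_zero (pow_ne_zero _ hγ0)) hδ0
    have hγη : γ ^ 2 * η = δ := by rw [hη]; field_simp
    have hlog : Real.log |val δ| = 2 * Real.log |val γ| + Real.log |val η| := by
      have h1 : |val γ| ≠ 0 := abs_ne_zero.2 (val_ne_zero hγ0)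
      rw [← hγη, pow_two, val_mul, val_mul, abs_mul, abs_mul, Real.log_mul (mul_ne_zero h1 h1)
        (abs_ne_zero.2 (val_ne_zero hη0)), Real.log_mul h1 h1]
      ring
    have hηpos := abs_pos.2 (val_ne_zero hη0)
    have h1 : 1 < |val η| := by
      rw [← Real.log_pos_iff hηpos.le]; linarith
    have h2 : |val η| < val β := by
      rw [← Real.log_lt_log_iff hηpos (by linarith)]; linarith
    obtain ⟨x, y, hxy⟩ := (hL η).1 (by rwa [hγη])
    -- Otherwise p/η, an element of the competing ideal, would be below 1 in both embeddings,
    -- although 1 is a minimum of that ideal.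
    have h3 : |conjVal η| ≤ |conjVal p| := by
      by_contra hcon
      rw [not_le] at hcon
      refine hJ'.2.2.2 ⟨p * η⁻¹, ?_, ?_, ?_, ?_⟩
      · rw [mem_iff_of_one_eq_smul hδ, ← hγη, show γ ^ 2 * η * (p * η⁻¹) = γ ^ 2 * p by field_simp,
          hL]
        exact left_mem_latt _ _
      · refine mul_ne_zero ?_ (inv_ne_zero hη0)
        rintro rfl; rw [val_zero] at hp0; exact lt_irrefl _ hp0
      · rw [val_mul, val_inv, abs_mul, abs_inv, val_one, abs_one, ← div_eq_mul_inv,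
          div_lt_one hηpos, abs_of_pos hp0]
        linarith
      · rw [conjVal_mul, conjVal_inv, abs_mul, abs_inv, conjVal_one, abs_one, ← div_eq_mul_inv,
          div_lt_one (abs_pos.2 (conjVal_ne_zero hη0))]
        exact hcon
    have hy0 : y = 0 := by
      refine coeff_eq_zero_of_consecutive hp0 hp hs (x := x) ?_ ?_
      · rwa [hxy, val_add, val_mul, val_mul, val_intCast, val_intCast] at h2
      · rwa [hxy, conjVal_add, conjVal_mul, conjVal_mul, conjVal_intCast, conjVal_intCast] at h3
    rw [hy0, Int.cast_zero, zero_mul, add_zero] at hxy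
    rw [hxy, conjVal_mul, conjVal_intCast, abs_mul] at h3
    rw [hxy, val_mul, val_intCast, abs_mul, abs_of_pos hp0] at h1
    have hpc : 0 < |conjVal p| := lt_of_le_of_lt (abs_nonneg _) hlt
    -- Now η = xp with |x| ≤ 1 and p ≤ 1, against |η| > 1.
    have : |(x : ℝ)| ≤ 1 := by
      by_contra h; rw [not_le] at h; nlinarith
    nlinarith
  · have : ∀ ξ, ξ ∈ c⁻¹ • (1 : FracIdeal d) ↔ ξ ∈ latt 1 (quadIrr d A B) := fun ξ => by
      rw [hJ, hθ, ← mul_mem_latt_iff hβ0 1, mul_one]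
    ext ξ
    rw [SetLike.mem_coe, this]
    simp [latt, quadIrr]

/-! ### Existence of the standard form -/

theorem mem_one_iff_isIntegral {ξ : QuadField d} : ξ ∈ (1 : FracIdeal d) ↔ IsIntegral ℤ ξ := by
  rw [Submodule.mem_one]
  constructor
  · rintro ⟨y, rfl⟩; exact y.2
  · intro h; exact ⟨⟨ξ, h⟩, rfl⟩

/-- The nontrivial automorphism. -/
def conjAlgHom (d : ℕ) : QuadField d →ₐ[ℤ] QuadField d :=
  ((starRingEnd (QuadField d)) : QuadField d →+* QuadField d).toIntAlgHom

theorem isIntegral_sqrt : IsIntegral ℤ (⟨0, 1⟩ : QuadField d) := by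
  refine IsIntegral.of_pow (n := 2) (by norm_num) ?_
  have : (⟨0, 1⟩ : QuadField d) ^ 2 = ((d : ℤ) : QuadField d) := by
    ext
    · simp [pow_two]
    · simp [pow_two]
  rw [this]
  exact isIntegral_algebraMap (R := ℤ) (x := (d : ℤ))

theorem exists_int_of_isIntegral {r : ℚ} (h : IsIntegral ℤ (algebraMap ℚ (QuadField d) r)) :
    ∃ k : ℤ, (k : ℚ) = r := by
  have h2 : IsIntegral ℤ r :=
    (isIntegral_algebraMap_iff (QuadraticAlgebra.algebraMap_injective (R := ℚ))).1 h
  exact IsIntegrallyClosed.isIntegral_iff.1 h2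

/-- Both ξ + ξ̄ and √d(ξ - ξ̄) are rational and integral over ℤ. The denominators are cruder than
necessary, but only their boundedness is needed. -/
theorem exists_int_re_im {ξ : QuadField d} (h : IsIntegral ℤ ξ) :
    (∃ k : ℤ, (k : ℚ) = 2 * ξ.re) ∧ ∃ k : ℤ, (k : ℚ) = 2 * d * ξ.im := by
  have hs : IsIntegral ℤ (star ξ) := h.map (conjAlgHom d)
  constructor
  · refine exists_int_of_isIntegral (d := d) ?_
    convert h.add hs
    ext <;> simp <;> ring
  · refine exists_int_of_isIntegral (d := d) ?_
    convert isIntegral_sqrt.mul (h.sub hs)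
    ext <;> simp <;> ring

/-- `(σ + √D) / 2` with `σ ≡ D mod 2` is an algebraic integer. -/
theorem exists_half_mem_one (d : ℕ) : ∃ σ : ℤ, quadIrr d 1 σ ∈ (1 : FracIdeal d) := by
  by_cases hd : d % 4 = 1
  · refine ⟨1, ?_⟩
    rw [mem_one_iff_isIntegral]
    obtain ⟨k, hk⟩ : ∃ k : ℕ, d = 4 * k + 1 := ⟨d / 4, by omega⟩
    have hkq : (d : ℚ) = 4 * k + 1 := by exact_mod_cast hk
    refine ⟨Polynomial.X ^ 2 - Polynomial.X - Polynomial.C (k : ℤ), ?_, ?_⟩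
    · monicity!
    · simp only [Polynomial.eval₂_sub, Polynomial.eval₂_pow, Polynomial.eval₂_X,
        Polynomial.eval₂_C]
      ext <;> simp [quadIrr, sqrtDisc, hd, pow_two, hkq, QuadraticAlgebra.re_one, QuadraticAlgebra.im_one] <;> ring
  · refine ⟨0, ?_⟩
    rw [mem_one_iff_isIntegral]
    have : quadIrr d 1 0 = ⟨0, 1⟩ := by
      ext <;> simp [quadIrr, sqrtDisc, hd]
    rw [this]
    exact isIntegral_sqrt

theorem mul_mem_of_mem_one {I : FracIdeal d} {o ξ : QuadField d} (ho : o ∈ (1 : FracIdeal d))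
    (hξ : ξ ∈ I) : o * ξ ∈ I := by
  obtain ⟨o, rfl⟩ := Submodule.mem_one.1 ho
  rw [← Algebra.smul_def]
  exact I.smul_mem o hξ

theorem intCast_mul_mem {I : FracIdeal d} (k : ℤ) {ξ : QuadField d} (hξ : ξ ∈ I) :
    (k : QuadField d) * ξ ∈ I := by
  rw [← zsmul_eq_mul]; exact zsmul_mem hξ k

/-- The rational numbers in an ideal with minimum `1` are the integers. -/
theorem exists_int_of_im_eq_zero {I : FracIdeal d} (hI : IsMinimum I 1) {ξ : QuadField d}
    (hξ : ξ ∈ I) (him : ξ.im = 0) : ∃ k : ℤ, ξ = k := by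
  -- The fractional part of ξ also lies in I and has both embeddings in [0, 1), so it must vanish.
  refine ⟨⌊ξ.re⌋, ?_⟩
  by_contra hne
  have hmem : ξ - (⌊ξ.re⌋ : QuadField d) ∈ I := by
    refine I.sub_mem hξ ?_
    have := intCast_mul_mem ⌊ξ.re⌋ hI.1
    rwa [mul_one] at this
  have h1 : ((Int.fract ξ.re : ℚ) : ℝ) < 1 := by exact_mod_cast Int.fract_lt_one ξ.re
  have h2 : (0 : ℝ) ≤ (Int.fract ξ.re : ℚ) := by exact_mod_cast Int.fract_nonneg ξ.re
  have h3 : ((Int.fract ξ.re : ℚ) : ℝ) = ξ.re - ⌊ξ.re⌋ := by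
    rw [Int.fract]; push_cast; rfl
  refine hI.2.2 ⟨_, hmem, sub_ne_zero.2 hne, ?_, ?_⟩
  · rw [val_one, abs_one, val_sub, val_intCast, val, him, Rat.cast_zero, zero_mul, add_zero, ← h3,
      abs_of_nonneg h2]
    exact h1
  · rw [conjVal_one, abs_one, conjVal_sub, conjVal_intCast, conjVal, him, Rat.cast_zero, zero_mul,
      sub_zero, ← h3, abs_of_nonneg h2]
    exact h1

theorem im_quadIrr_pos {A B : ℤ} (hA : 0 < A) : 0 < (quadIrr d A B).im := by
  have : (0 : ℚ) < A := by exact_mod_cast hA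
  simp only [quadIrr, sqrtDisc, QuadraticAlgebra.im_smul, QuadraticAlgebra.im_add,
    QuadraticAlgebra.im_intCast, smul_eq_mul]
  split_ifs <;> positivity

/-- A reduced principal ideal is generated by `1` and some `α` as an additive group. -/
theorem exists_eq_latt [NonsquareRat d] (hd0 : 0 < d) {I : FracIdeal d} {γ : QuadField d}
    (hγ : (1 : FracIdeal d) = γ • I) (hI : IsMinimum I 1) :
    ∃ α : QuadField d, 0 < α.im ∧ (I : Set (QuadField d)) = latt 1 α := by
  -- I = η𝒪, so the imaginary parts of its elements have the common denominator N. Scaled by N they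
  -- form a subgroup of ℤ, and α is an element over a generator of that subgroup. What remains is
  -- rational, hence an integer.
  set η := γ⁻¹ with hη
  set N : ℕ := 2 * d * η.re.den * η.im.den with hN
  have hNpos : 0 < N := by
    have := η.re.den_pos
    have := η.im.den_pos
    positivity
  have hden : ∀ ξ ∈ I, ∃ k : ℤ, (k : ℚ) = N * ξ.im := by
    intro ξ hξ
    have h1 := (mem_iff_of_one_eq_smul hγ ξ).1 hξ
    rw [mem_one_iff_isIntegral] at h1
    obtain ⟨⟨k, hk⟩, l, hl⟩ := exists_int_re_im h1
    have hξe : ξ = η * (γ * ξ) := by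
      rw [hη, ← mul_assoc, inv_mul_cancel₀ (ne_zero_of_one_eq_smul hγ), one_mul]
    have him : ξ.im = η.re * (γ * ξ).im + η.im * (γ * ξ).re := by
      conv_lhs => rw [hξe]
      simp only [QuadraticAlgebra.im_mul]; ring
    have h1 := Rat.mul_den_eq_num η.re
    have h2 := Rat.mul_den_eq_num η.im
    refine ⟨l * η.re.num * η.im.den + d * k * η.im.num * η.re.den, ?_⟩
    rw [him, hN]
    push_cast
    rw [hk, hl, ← h1, ← h2]
    ring
  let H : AddSubgroup ℤ :=
    { carrier := {k | ∃ ξ ∈ I, (k : ℚ) = N * ξ.im}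
      zero_mem' := ⟨0, I.zero_mem, by simp⟩
      add_mem' := by
        rintro a b ⟨ξ, h1, h2⟩ ⟨η, h3, h4⟩
        exact ⟨ξ + η, I.add_mem h1 h3, by push_cast; rw [h2, h4]; simp; ring⟩
      neg_mem' := by
        rintro a ⟨ξ, h1, h2⟩
        exact ⟨-ξ, I.neg_mem h1, by push_cast; rw [h2]; simp⟩ }
  obtain ⟨g₀, hg₀⟩ := Int.subgroup_cyclic H
  obtain ⟨g, hg0, hg⟩ : ∃ g : ℤ, 0 ≤ g ∧ ∀ k, k ∈ H ↔ ∃ j : ℤ, k = j * g := by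
    refine ⟨|g₀|, abs_nonneg _, fun k => ?_⟩
    rw [hg₀, AddSubgroup.mem_closure_singleton]
    simp only [smul_eq_mul]
    rcases abs_choice g₀ with h | h <;> rw [h]
    · exact exists_congr fun j => eq_comm
    · constructor
      · rintro ⟨j, rfl⟩; exact ⟨-j, by ring⟩
      · rintro ⟨j, rfl⟩; exact ⟨-j, by ring⟩
  have hNq : (0 : ℚ) < N := by exact_mod_cast hNpos
  -- The subgroup is nonzero because I contains 1 and hence the irrational integer (σ + √D)/2.
  have hgpos : 0 < g := by
    refine lt_of_le_of_ne hg0 fun h0 => ?_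
    obtain ⟨σ, hσ⟩ := exists_half_mem_one d
    have hm := mul_mem_of_mem_one hσ hI.1
    rw [mul_one] at hm
    obtain ⟨k, hk⟩ := hden _ hm
    obtain ⟨j, hj⟩ := (hg k).1 ⟨_, hm, hk⟩
    have := mul_pos hNq (im_quadIrr_pos (d := d) (B := σ) one_pos)
    rw [← hk, hj, ← h0] at this
    simp at this
  obtain ⟨α, hα, hαg⟩ := (hg g).2 ⟨1, by ring⟩
  have hgq : (0 : ℚ) < g := by exact_mod_cast hgpos
  refine ⟨α, ?_, ?_⟩
  · rw [hαg] at hgq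
    exact pos_of_mul_pos_right hgq hNq.le
  · ext ξ
    constructor
    · intro hξ
      obtain ⟨k, hk⟩ := hden ξ hξ
      obtain ⟨j, hj⟩ := (hg k).1 ⟨ξ, hξ, hk⟩
      obtain ⟨x, hx⟩ := exists_int_of_im_eq_zero hI (I.sub_mem hξ (intCast_mul_mem j hα)) (by
        have : (N : ℚ) * ξ.im = N * (j * α.im) := by
          rw [← hk, hj]; push_cast; rw [hαg]; ring
        have := mul_left_cancel₀ hNq.ne' this
        simp [this, QuadraticAlgebra.re_intCast, QuadraticAlgebra.im_intCast])
      exact ⟨x, j, by rw [mul_one, ← hx]; ring⟩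
    · rintro ⟨x, y, rfl⟩
      exact I.add_mem (intCast_mul_mem x hI.1) (intCast_mul_mem y hα)

theorem val_C (r : ℚ) : val (QuadraticAlgebra.C r : QuadField d) = r := by
  simp [val]

theorem quadIrr_add_int [NonsquareRat d] {A B : ℤ} (hA : A ≠ 0) (k : ℤ) :
    quadIrr d A B + k = quadIrr d A (B + 2 * A * k) := by
  have hA' : (A : ℝ) ≠ 0 := by exact_mod_cast hA
  apply val_injective
  rw [val_add, val_quadIrr, val_quadIrr, val_intCast]
  push_cast
  field_simp
  ring

/-- I contains ω = (σ + √D)/2. Writing ω = k + aα gives α = (b + √D)/2a with b = σ - 2k. Then ωα -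
(k + b)α = (D - b²)/4a is a rational element of I, hence an integer, which is the divisibility
condition. A shift of α by an integer moves b modulo 2a into its window. -/
theorem exists_isStandardForm [NonsquareRat d] (hd0 : 0 < d) {I : FracIdeal d} {γ : QuadField d}
    (hγ : (1 : FracIdeal d) = γ • I) (hI : IsMinimum I 1) :
    ∃ a b : ℤ, IsStandardForm I a b := by
  obtain ⟨α, hα, hIα⟩ := exists_eq_latt hd0 hγ hI
  have hmem : ∀ ξ, ξ ∈ I ↔ ξ ∈ latt 1 α := fun ξ => by rw [← hIα]; rfl
  have hαI : α ∈ I := (hmem α).2 (right_mem_latt _ _)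
  obtain ⟨σ, hσ⟩ := exists_half_mem_one d
  have hm := mul_mem_of_mem_one hσ hI.1
  obtain ⟨k, a, hka⟩ := (hmem _).1 hm
  rw [mul_one, mul_one] at hka
  have ha : 0 < a := by
    have h1 := im_quadIrr_pos (d := d) (B := σ) one_pos
    rw [hka] at h1
    simp [QuadraticAlgebra.re_intCast, QuadraticAlgebra.im_intCast] at h1
    have := pos_of_mul_pos_left h1 hα.le
    exact_mod_cast this
  have haR : (0 : ℝ) < a := by exact_mod_cast ha
  set b := σ - 2 * k with hb
  have hαq : α = quadIrr d a b := by
    have h1 := congrArg val hka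
    rw [val_add, val_mul, val_intCast, val_intCast, val_quadIrr, Int.cast_one] at h1
    apply val_injective
    rw [val_quadIrr, eq_div_iff (by positivity), hb]
    push_cast
    linarith
  have hdvd : 4 * a ∣ b ^ 2 - (disc d : ℤ) := by
    have h1 := mul_mem_of_mem_one hσ hαI
    have h2 : quadIrr d 1 σ * α - ((k + b : ℤ) : QuadField d) * α ∈ I :=
      I.sub_mem h1 (intCast_mul_mem _ hαI)
    have hs : √(disc d : ℝ) ^ 2 = (disc d : ℝ) := Real.sq_sqrt (Nat.cast_nonneg _)
    obtain ⟨r, hr⟩ : ∃ r : ℚ, r = ((disc d : ℚ) - b ^ 2) / (4 * a) := ⟨_, rfl⟩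
    have hrR : (r : ℝ) = ((disc d : ℝ) - b ^ 2) / (4 * a) := by rw [hr]; push_cast; rfl
    have hkb : (σ : ℝ) = b + 2 * k := by rw [hb]; push_cast; ring
    have hval : quadIrr d 1 σ * α - ((k + b : ℤ) : QuadField d) * α
        = QuadraticAlgebra.C r := by
      apply val_injective
      rw [val_sub, val_mul, val_mul, val_intCast, hαq, val_quadIrr, val_quadIrr, val_C,
        hrR, hkb]
      push_cast
      field_simp
      linear_combination 4 * hs
    rw [hval] at h2
    obtain ⟨c, hc⟩ := exists_int_of_im_eq_zero hI h2 (QuadraticAlgebra.im_C _)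
    have hc' := congrArg QuadraticAlgebra.re hc
    rw [QuadraticAlgebra.re_C, QuadraticAlgebra.re_intCast, hr,
      div_eq_iff (by exact_mod_cast (by omega : 4 * a ≠ 0))] at hc'
    refine ⟨-c, ?_⟩
    have : (disc d : ℤ) - b ^ 2 = c * (4 * a) := by exact_mod_cast hc'
    linarith
  have hs0 : (0 : ℝ) ≤ √(disc d : ℝ) := Real.sqrt_nonneg _
  -- The window for b is (t - 2a, t] in both cases of `IsTau`.
  obtain ⟨t, ht⟩ : ∃ t : ℝ, t = if √(disc d : ℝ) < a then (a : ℝ) else √(disc d : ℝ) := ⟨_, rfl⟩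
  set j := ⌊(t - b) / (2 * a)⌋ with hj
  have h1 : ((b + 2 * a * j : ℤ) : ℝ) ≤ t := by
    have := Int.floor_le ((t - b) / (2 * a))
    rw [← hj, le_div_iff₀ (by positivity)] at this
    push_cast; linarith
  have h2 : t - 2 * a < ((b + 2 * a * j : ℤ) : ℝ) := by
    have := Int.lt_floor_add_one ((t - b) / (2 * a))
    rw [← hj, div_lt_iff₀ (by positivity)] at this
    push_cast; linarith
  refine ⟨a, b + 2 * a * j, ha, ⟨fun h => ?_, fun h => ?_⟩, ?_, ?_⟩
  · rw [if_pos h] at ht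
    rw [ht] at h1 h2
    constructor
    · have : ((-a : ℤ) : ℝ) < ((b + 2 * a * j : ℤ) : ℝ) := by push_cast at *; linarith
      exact_mod_cast this
    · exact_mod_cast h1
  · rw [if_neg (not_lt.2 h.le)] at ht
    rw [ht] at h1 h2
    exact ⟨h2, h1⟩
  · obtain ⟨c, hc⟩ := hdvd
    exact ⟨c + b * j + a * j ^ 2, by linear_combination hc⟩
  · have : (I : Set (QuadField d)) = latt 1 (quadIrr d a (b + 2 * a * j)) := by
      rw [← quadIrr_add_int ha.ne', hIα, hαq]
      have := latt_shift 1 (quadIrr d a b) j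
      rw [mul_one] at this
      exact this.symm
    rw [this]; simp [latt, quadIrr]

/-! ### Squaring an ideal -/

/-- In the standard form of a fundamental discriminant, `a`, `b` and `(D - b²) / 4a` are coprime. -/
theorem isCoprime_gcd_of_disc (hd : Squarefree d) {a b c : ℤ}
    (h : (disc d : ℤ) = b ^ 2 + 4 * a * c) : IsCoprime (Int.gcd a b : ℤ) c := by
  rw [Int.isCoprime_iff_gcd_eq_one]
  by_contra hne
  obtain ⟨p, hp, hpd⟩ := Nat.exists_prime_and_dvd hne
  have hpg : (p : ℤ) ∣ (Int.gcd a b : ℤ) :=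
    (Int.natCast_dvd_natCast.2 hpd).trans (Int.gcd_dvd_left _ _)
  have hpa : (p : ℤ) ∣ a := hpg.trans (Int.gcd_dvd_left _ _)
  have hpb : (p : ℤ) ∣ b := hpg.trans (Int.gcd_dvd_right _ _)
  have hpc : (p : ℤ) ∣ c := (Int.natCast_dvd_natCast.2 hpd).trans (Int.gcd_dvd_right _ _)
  obtain ⟨a, rfl⟩ := hpa
  obtain ⟨b, rfl⟩ := hpb
  obtain ⟨c, rfl⟩ := hpc
  have hsq : ∀ k : ℤ, ¬ (d : ℤ) = (p * p) * k := by
    intro k hk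
    have h1 : ((p * p : ℕ) : ℤ) ∣ (d : ℤ) := ⟨k, by push_cast; exact hk⟩
    have h2 := Nat.isUnit_iff.1 (hd p (Int.natCast_dvd_natCast.1 h1))
    exact hp.one_lt.ne' h2
  unfold disc at h
  split_ifs at h with h4
  · exact hsq (b ^ 2 + 4 * a * c) (by rw [h]; ring)
  · push_cast at h
    -- For p = 2 the equation becomes d = b² + 4ac, so d is 0 or 1 mod 4: the former contradicts
    -- squarefreeness, the latter the current case D = 4d. For odd p, p² divides 4d and hence d.
    rcases hp.eq_two_or_odd' with rfl | hodd
    · have h5 : (d : ℤ) = b ^ 2 + 4 * (a * c) := by push_cast at h; linarith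
      rcases Int.even_or_odd b with ⟨e, rfl⟩ | ⟨e, rfl⟩
      · exact hsq (e ^ 2 + a * c) (by rw [h5]; push_cast; ring)
      · have : (d : ℤ) = 4 * (e ^ 2 + e + a * c) + 1 := by rw [h5]; ring
        omega
    · have h1 : (p : ℤ) * p ∣ d * 4 := ⟨b ^ 2 + 4 * a * c, by linarith⟩
      have h2 : IsCoprime ((p : ℤ) * p) 4 := by
        have : Nat.Coprime (p * p) 4 := by
          have h2 : Nat.Coprime p 2 := by simpa using hodd
          have : Nat.Coprime p (2 ^ 2) := h2.pow_right 2
          exact Nat.Coprime.mul_left this this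
        exact_mod_cast Nat.isCoprime_iff_coprime.2 this
      obtain ⟨k, hk⟩ := h2.dvd_of_dvd_mul_right h1
      exact hsq k hk

/-- An element of 𝒪 is its own product with 1, and both factors are γ times elements of ℤ + ℤα. So
γ⁻²𝒪 is spanned by 1, α and α². -/
theorem mem_latt_mul_latt [NonsquareRat d] {I : FracIdeal d} {γ α : QuadField d}
    (hγ : (1 : FracIdeal d) = γ • I) (hI : (I : Set (QuadField d)) = latt 1 α) (ξ : QuadField d) :
    γ ^ 2 * ξ ∈ (1 : FracIdeal d) ↔ ∃ x y z : ℤ, ξ = x + y * α + z * α ^ 2 := by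
  have hmem : ∀ ξ, ξ ∈ I ↔ ξ ∈ latt 1 α := fun ξ => by rw [← hI]; rfl
  have hγ0 := ne_zero_of_one_eq_smul hγ
  have hin : ∀ ξ, ξ ∈ latt 1 α → γ * ξ ∈ (1 : FracIdeal d) := fun ξ h =>
    (mem_iff_of_one_eq_smul hγ ξ).1 ((hmem ξ).2 h)
  have hex : ∀ o, o ∈ (1 : FracIdeal d) → ∃ x y : ℤ, o = γ * (x * 1 + y * α) := fun o ho => by
    obtain ⟨x, y, h⟩ := (hmem (γ⁻¹ * o)).1
      ((mem_iff_of_one_eq_smul hγ _).2 (by rwa [← mul_assoc, mul_inv_cancel₀ hγ0, one_mul]))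
    exact ⟨x, y, by rw [← h, ← mul_assoc, mul_inv_cancel₀ hγ0, one_mul]⟩
  constructor
  · intro h
    obtain ⟨x, y, h1⟩ := hex _ h
    obtain ⟨x', y', h2⟩ := hex _ one_mem_one
    refine ⟨x * x', x * y' + x' * y, y * y', mul_left_cancel₀ (pow_ne_zero 2 hγ0) ?_⟩
    rw [h1, ← mul_one (γ * _)]
    nth_rw 2 [h2]
    push_cast
    ring
  · rintro ⟨x, y, z, rfl⟩
    have e1 := hin _ (left_mem_latt 1 α)
    have e2 := hin _ (right_mem_latt 1 α)
    have h1 := intCast_mul_mem x (mul_mem_one e1 e1)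
    have h2 := intCast_mul_mem y (mul_mem_one e1 e2)
    have h3 := intCast_mul_mem z (mul_mem_one e2 e2)
    convert Submodule.add_mem _ (Submodule.add_mem _ h1 h2) h3 using 1
    ring

/-- A basis of the square of the ideal with the standard form `(a, b)`, where `a = a₁g`,
`b = b₁g` and `ua₁ + vb₁ = 1`. -/
theorem mem_latt_sq [NonsquareRat d] {I : FracIdeal d} {γ : QuadField d}
    (hγ : (1 : FracIdeal d) = γ • I) {a₁ b₁ g c u v : ℤ} (ha : a₁ ≠ 0) (hg : g ≠ 0)
    (hI : (I : Set (QuadField d)) = latt 1 (quadIrr d (a₁ * g) (b₁ * g)))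
    (huv : u * a₁ + v * b₁ = 1) (hD : (disc d : ℤ) = (b₁ * g) ^ 2 + 4 * (a₁ * g) * c)
    (hgc : IsCoprime g c) (ξ : QuadField d) :
    γ ^ 2 * ξ ∈ (1 : FracIdeal d) ↔
      (g : QuadField d) * ξ ∈ latt 1 (quadIrr d (a₁ ^ 2) (b₁ * g + 2 * a₁ * v * c)) := by
  have ha' : (a₁ : ℝ) ≠ 0 := by exact_mod_cast ha
  have hg' : (g : ℝ) ≠ 0 := by exact_mod_cast hg
  have hgK : (g : QuadField d) ≠ 0 := by exact_mod_cast hg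
  have hs : √(disc d : ℝ) ^ 2 = (b₁ * g) ^ 2 + 4 * (a₁ * g) * c := by
    rw [Real.sq_sqrt (Nat.cast_nonneg _)]; exact_mod_cast hD
  have huv' : (u : ℝ) * a₁ + v * b₁ = 1 := by exact_mod_cast huv
  set α := quadIrr d (a₁ * g) (b₁ * g) with hα
  set θ := quadIrr d (a₁ ^ 2) (b₁ * g + 2 * a₁ * v * c) with hθ
  have e1 : (g : QuadField d) * α = a₁ * θ - v * c := by
    apply val_injective
    simp only [val_sub, val_mul, val_intCast, hα, hθ, val_quadIrr]
    push_cast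
    field_simp
    ring
  have e2 : (g : QuadField d) * α ^ 2 = b₁ * θ + c * u := by
    apply val_injective
    simp only [pow_two, val_add, val_mul, val_intCast, hα, hθ, val_quadIrr]
    push_cast
    field_simp
    linear_combination hs - 4 * g * c * a₁ * huv'
  have huvK : (u : QuadField d) * a₁ + v * b₁ = 1 := by exact_mod_cast huv
  have e3 : θ = u * (g * α) + v * (g * α ^ 2) := by
    rw [e1, e2]; linear_combination (-θ) * huvK
  obtain ⟨p, r, hpr⟩ := hgc
  have hprK : (p : QuadField d) * g + r * c = 1 := by exact_mod_cast hpr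
  -- In gI² lie g and a₁·gα² - b₁·gα = c. These are coprime, so 1 lies in it as well.
  have e4 : (1 : QuadField d) = p * g + r * (a₁ * (g * α ^ 2) - b₁ * (g * α)) := by
    rw [e1, e2]
    linear_combination (-1 : QuadField d) * hprK - r * c * huvK
  rw [mem_latt_mul_latt hγ hI]
  constructor
  · rintro ⟨x, y, z, rfl⟩
    refine ⟨x * g - y * (v * c) + z * (c * u), y * a₁ + z * b₁, ?_⟩
    push_cast
    linear_combination (y : QuadField d) * e1 + z * e2
  · rintro ⟨x, y, hxy⟩
    refine ⟨x * p, y * u - x * r * b₁, y * v + x * r * a₁, mul_left_cancel₀ hgK ?_⟩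
    rw [hxy]
    push_cast
    linear_combination (x : QuadField d) * e4 + y * e3

/-! ### The continued fraction step -/

/-- `e` and `eθ` with `θ = (B + √D) / 2A` are a basis of the lattice `L`, with the conjugate of `θ`
between `-1` and `0`, and `C` is the integer `(D - B²) / 4A`. -/
structure IsCFState (L : Set (QuadField d)) (e : QuadField d) (A B C : ℤ) : Prop where
  disc_eq : (disc d : ℤ) = B ^ 2 + 4 * A * C
  neg_one_lt : -1 < conjVal (quadIrr d A B)
  lt_zero : conjVal (quadIrr d A B) < 0
  ne_zero : e ≠ 0
  latt_eq : latt e (e * quadIrr d A B) = L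

/-- The partial quotient `⌊(B + √D) / 2C⌋` in terms of `s = ⌊√D⌋`. -/
def partialQuot (s B C : ℤ) : ℤ := (B + s) / (2 * C) - if 0 < C then 0 else 1

theorem sqrt_disc_sq (d : ℕ) : √(disc d : ℝ) ^ 2 = (disc d : ℝ) := Real.sq_sqrt (Nat.cast_nonneg _)

theorem natSqrt_lt_sqrt [NonsquareRat d] : ((Nat.sqrt (disc d) : ℤ) : ℝ) < √(disc d : ℝ) := by
  refine lt_of_le_of_ne ?_ (by
    simpa using intCast_ne_mul_sqrt_disc (d := d) (x := (Nat.sqrt (disc d) : ℤ)) one_ne_zero)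
  exact_mod_cast Real.nat_sqrt_le_real_sqrt

theorem sqrt_lt_natSqrt_add_one : √(disc d : ℝ) < ((Nat.sqrt (disc d) : ℤ) : ℝ) + 1 := by
  exact_mod_cast Real.real_sqrt_lt_nat_sqrt_succ

theorem sqrt_disc_pos [NonsquareRat d] : 0 < √(disc d : ℝ) :=
  lt_of_le_of_lt (by positivity) (natSqrt_lt_sqrt (d := d))

/-- Replacing √D by s is harmless because s < √D < s + 1 and the other terms are integers. For C < 0
the integer quotient, taken with nonnegative remainder, is rounded up, which explains the correction
by 1 in `partialQuot`. Both inequalities are strict. -/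
theorem partialQuot_lt [NonsquareRat d] {B C : ℤ} (hC : C ≠ 0) :
    partialQuot (Nat.sqrt (disc d)) B C < (B + √(disc d : ℝ)) / (2 * C) ∧
      (B + √(disc d : ℝ)) / (2 * C) < partialQuot (Nat.sqrt (disc d)) B C + 1 := by
  have h1 := natSqrt_lt_sqrt (d := d)
  have h2 := sqrt_lt_natSqrt_add_one (d := d)
  set s : ℤ := ((Nat.sqrt (disc d) : ℕ) : ℤ) with hs
  have h3 := Int.mul_ediv_add_emod (B + s) (2 * C)
  have h4 := Int.emod_nonneg (B + s) (show 2 * C ≠ 0 by omega)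
  have h5 := Int.emod_lt_abs (B + s) (show 2 * C ≠ 0 by omega)
  set z := (B + s) / (2 * C) with hz
  set r := (B + s) % (2 * C) with hr
  have h3R : (B : ℝ) + s = 2 * C * z + r := by exact_mod_cast h3.symm
  have h4R : (0 : ℝ) ≤ r := by exact_mod_cast h4
  unfold partialQuot
  rw [← hz]
  rcases lt_or_gt_of_ne hC with hC | hC
  · rw [abs_of_neg (by omega)] at h5
    have h5R : (r : ℝ) + 1 ≤ -(2 * C) := by exact_mod_cast h5
    have hCR : (C : ℝ) < 0 := by exact_mod_cast hC
    rw [if_neg (by omega), lt_div_iff_of_neg (by linarith), div_lt_iff_of_neg (by linarith)]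
    push_cast
    constructor <;> nlinarith
  · rw [abs_of_pos (by omega)] at h5
    have h5R : (r : ℝ) + 1 ≤ 2 * C := by exact_mod_cast h5
    have hCR : (0 : ℝ) < C := by exact_mod_cast hC
    rw [if_pos hC, lt_div_iff₀ (by linarith), div_lt_iff₀ (by linarith)]
    push_cast
    constructor <;> nlinarith

theorem IsCFState.ne_zero' [NonsquareRat d] {L : Set (QuadField d)} {e : QuadField d} {A B C : ℤ}
    (h : IsCFState L e A B C) : A ≠ 0 ∧ C ≠ 0 := by
  have h1 := sq_ne_disc_mul_sq (d := d) (x := B) one_ne_zero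
  constructor <;> rintro rfl <;> exact h1 (by rw [h.disc_eq]; ring)

theorem quadIrr_ne_zero [NonsquareRat d] {A B : ℤ} (hA : A ≠ 0) : quadIrr d A B ≠ 0 := by
  intro h
  have h1 := congrArg val h
  have hA' : (A : ℝ) ≠ 0 := by exact_mod_cast hA
  rw [val_zero, val_quadIrr, div_eq_zero_iff] at h1
  have h2 := intCast_ne_mul_sqrt_disc (d := d) (x := -B) (y := 1) one_ne_zero
  rcases h1 with h1 | h1
  · exact h2 (by push_cast; linarith)
  · exact hA' (by linarith)

theorem val_sub_conjVal_quadIrr {A B : ℤ} :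
    val (quadIrr d A B) - conjVal (quadIrr d A B) = √(disc d : ℝ) / A := by
  rw [val_quadIrr, conjVal_quadIrr]; field_simp; ring

theorem IsCFState.pos_of_val_pos [NonsquareRat d] {L : Set (QuadField d)} {e : QuadField d}
    {A B C : ℤ} (h : IsCFState L e A B C) (h1 : 0 < val (quadIrr d A B)) : 0 < A := by
  have h2 := val_sub_conjVal_quadIrr (d := d) (A := A) (B := B)
  have h3 : 0 < √(disc d : ℝ) / A := by rw [← h2]; linarith [h.lt_zero]
  have := (div_pos_iff_of_pos_left (sqrt_disc_pos (d := d))).1 h3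
  exact_mod_cast this

theorem quadIrr_inv [NonsquareRat d] {L : Set (QuadField d)} {e : QuadField d} {A B C : ℤ}
    (h : IsCFState L e A B C) (q : ℤ) :
    quadIrr d C (2 * C * q - B) = q + (quadIrr d A B)⁻¹ := by
  obtain ⟨hA, hC⟩ := h.ne_zero'
  have hA' : (A : ℝ) ≠ 0 := by exact_mod_cast hA
  have hC' : (C : ℝ) ≠ 0 := by exact_mod_cast hC
  have hs : √(disc d : ℝ) ^ 2 = B ^ 2 + 4 * A * C := by
    rw [sqrt_disc_sq]; exact_mod_cast h.disc_eq
  have hne := val_ne_zero (quadIrr_ne_zero (d := d) (B := B) hA)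
  rw [val_quadIrr] at hne
  have hne' : (B : ℝ) + √(disc d : ℝ) ≠ 0 := fun h => hne (by rw [h, zero_div])
  apply val_injective
  rw [val_add, val_inv, val_intCast, val_quadIrr, val_quadIrr]
  push_cast
  field_simp
  linear_combination hs

/-- Here θ is replaced by q + 1/θ. The relation D - B² = 4AC gives -1/θ' = (B + √D)/2C > 1, and q is
its integer part, so q ≥ 1 and q + 1/θ' again lies between -1 and 0. The value of θ itself plays no
part in the choice of q, so a basis need not be reduced for the step to apply. -/
theorem IsCFState.step [NonsquareRat d] {L : Set (QuadField d)} {e : QuadField d} {A B C q : ℤ}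
    (h : IsCFState L e A B C) (hq : q = partialQuot (Nat.sqrt (disc d)) B C) :
    1 ≤ q ∧ IsCFState L (e * quadIrr d A B) C (2 * C * q - B) (A + q * B - C * q ^ 2) ∧
      e * quadIrr d A B * quadIrr d C (2 * C * q - B) = e + q * (e * quadIrr d A B) := by
  obtain ⟨hA, hC⟩ := h.ne_zero'
  have hA' : (A : ℝ) ≠ 0 := by exact_mod_cast hA
  have hC' : (C : ℝ) ≠ 0 := by exact_mod_cast hC
  have hθ := quadIrr_ne_zero (d := d) (B := B) hA
  obtain ⟨h1, h2⟩ := partialQuot_lt (d := d) (B := B) hC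
  rw [← hq] at h1 h2
  have hs : √(disc d : ℝ) ^ 2 = B ^ 2 + 4 * A * C := by
    rw [sqrt_disc_sq]; exact_mod_cast h.disc_eq
  have hneg := h.lt_zero
  have hconj : (conjVal (quadIrr d A B))⁻¹ = -((B + √(disc d : ℝ)) / (2 * C)) := by
    rw [inv_eq_iff_eq_inv, conjVal_quadIrr, ← one_div, eq_div_iff, div_mul_eq_mul_div,
      div_eq_iff (by simpa using hA')]
    · field_simp
      linear_combination hs
    · rw [conjVal_quadIrr] at hneg
      intro h0
      rw [neg_eq_zero, div_eq_zero_iff] at h0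
      have h3 := intCast_ne_mul_sqrt_disc (d := d) (x := -B) (y := 1) one_ne_zero
      rcases h0 with h0 | h0
      · exact h3 (by push_cast; linarith)
      · exact hC' (by linarith)
  have hinv := quadIrr_inv h q
  have hrel : e * quadIrr d A B * quadIrr d C (2 * C * q - B) = e + q * (e * quadIrr d A B) := by
    rw [hinv]; field_simp; ring
  have hone : 1 < (B + √(disc d : ℝ)) / (2 * C) := by
    have h4 := h.neg_one_lt
    have h3 : (conjVal (quadIrr d A B))⁻¹ < -1 := by
      rw [inv_lt_of_neg hneg (by norm_num)]; simpa using h4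
    linarith
  have hcv : conjVal (quadIrr d C (2 * C * q - B)) = q - (B + √(disc d : ℝ)) / (2 * C) := by
    rw [hinv, conjVal_add, conjVal_inv, conjVal_intCast, hconj]; ring
  refine ⟨?_, ⟨?_, by rw [hcv]; linarith, by rw [hcv]; linarith, mul_ne_zero h.ne_zero hθ, ?_⟩,
    hrel⟩
  · have : (0 : ℝ) < q := by linarith
    exact_mod_cast this
  · rw [h.disc_eq]; ring
  · rw [hrel, latt_step, h.latt_eq]

/-- The bound for the quantities in the search for the first minimum above `G`. -/
theorem IsCFState.abs_mul_le [NonsquareRat d] {L : Set (QuadField d)} {e : QuadField d}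
    {A B C : ℤ} (h : IsCFState L e A B C) : |(B : ℝ)| ≤ 2 * |(A : ℝ)| + √(disc d : ℝ) := by
  have hA' : (A : ℝ) ≠ 0 := by exact_mod_cast h.ne_zero'.1
  have h1 : (B : ℝ) = conjVal (quadIrr d A B) * (2 * A) + √(disc d : ℝ) := by
    rw [conjVal_quadIrr]; field_simp; ring
  have h2 : |conjVal (quadIrr d A B)| ≤ 1 := abs_le.2 ⟨h.neg_one_lt.le, by linarith [h.lt_zero]⟩
  calc |(B : ℝ)| ≤ |conjVal (quadIrr d A B) * (2 * A)| + |√(disc d : ℝ)| := by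
        conv_lhs => rw [h1]
        exact abs_add_le _ _
    _ ≤ _ := by
        rw [abs_mul, abs_mul, abs_of_pos (sqrt_disc_pos (d := d)), abs_two]
        nlinarith [abs_nonneg (A : ℝ)]

/-! ### The regulator -/

/-- A reduced basis of the ideal `L`. -/
def IsRedState (L : Set (QuadField d)) (t : QuadField d × ℤ × ℤ × ℤ) : Prop :=
  IsCFState L t.1 t.2.1 t.2.2.1 t.2.2.2 ∧ IsRed (disc d) t.2.1 t.2.2.1

theorem IsRedState.exists_next [NonsquareRat d] {L : Set (QuadField d)}
    {t : QuadField d × ℤ × ℤ × ℤ} (h : IsRedState L t) :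
    ∃ t' : QuadField d × ℤ × ℤ × ℤ, IsRedState L t' ∧ t'.1 = t.1 * quadIrr d t.2.1 t.2.2.1 := by
  obtain ⟨h1, h2⟩ := h
  obtain ⟨hq, hs, -⟩ := h1.step rfl
  have hinv := quadIrr_inv h1 (partialQuot (Nat.sqrt (disc d)) t.2.2.1 t.2.2.2)
  have hpos : 0 < (val (quadIrr d t.2.1 t.2.2.1))⁻¹ := inv_pos.2 (by linarith [h2.one_lt_val])
  have hv : 1 < val (quadIrr d t.2.2.2 (2 * t.2.2.2 *
      partialQuot (Nat.sqrt (disc d)) t.2.2.1 t.2.2.2 - t.2.2.1)) := by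
    rw [hinv, val_add, val_intCast, val_inv]
    have : (1 : ℝ) ≤ partialQuot (Nat.sqrt (disc d)) t.2.2.1 t.2.2.2 := by exact_mod_cast hq
    linarith
  exact ⟨(_, _, _, _), ⟨hs, isRed_of_val (hs.pos_of_val_pos (by linarith)) hv hs.neg_one_lt
    hs.lt_zero⟩, rfl⟩

theorem IsRed.le_natSqrt {A B : ℤ} (h : IsRed (disc d) A B) :
    A ≤ Nat.sqrt (disc d) ∧ |B| ≤ Nat.sqrt (disc d) := by
  obtain ⟨h1, h2, h3, h4⟩ := h
  have h5 := sqrt_lt_natSqrt_add_one (d := d)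
  have h1R : (0 : ℝ) < A := by exact_mod_cast h1
  constructor
  · have : (A : ℝ) < ((Nat.sqrt (disc d) : ℤ) : ℝ) + 1 := by linarith
    exact Int.lt_add_one_iff.1 (by exact_mod_cast this)
  · have h6 : (B : ℝ) < ((Nat.sqrt (disc d) : ℤ) : ℝ) + 1 := by linarith
    have h7 : (-B : ℝ) < ((Nat.sqrt (disc d) : ℤ) : ℝ) + 1 := by linarith
    rw [abs_le']
    exact ⟨Int.lt_add_one_iff.1 (by exact_mod_cast h6), Int.lt_add_one_iff.1 (by exact_mod_cast h7)⟩

theorem IsRed.val_le {A B : ℤ} (h : IsRed (disc d) A B) : val (quadIrr d A B) ≤ √(disc d : ℝ) := by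
  obtain ⟨h1, h2, h3, h4⟩ := h
  have h1R : (1 : ℝ) ≤ A := by exact_mod_cast h1
  rw [val_quadIrr, div_le_iff₀ (by positivity)]
  nlinarith [Real.sqrt_nonneg (disc d : ℝ)]

/-- A reduced principal ideal with its standard form. -/
structure IsReducedForm (I : FracIdeal d) (γ : QuadField d) (a b : ℤ) : Prop where
  one_eq : (1 : FracIdeal d) = γ • I
  isMin : IsMinimum I 1
  isStd : IsStandardForm I a b

theorem IsStandardForm.isCFState [NonsquareRat d] {I : FracIdeal d} {a b : ℤ}
    (h : IsStandardForm I a b) (hI : IsMinimum I 1) :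
    IsCFState (I : Set (QuadField d)) 1 a b ((disc d - b ^ 2) / (4 * a)) := by
  have hr := h.isRed hI
  refine ⟨?_, hr.neg_one_lt_conjVal, hr.conjVal_neg, one_ne_zero, by rw [h.coe_eq, one_mul]⟩
  have : 4 * a ∣ (disc d : ℤ) - b ^ 2 := by
    have := h.2.2.1
    rwa [← dvd_neg, neg_sub] at this
  have := Int.mul_ediv_cancel' this
  linarith

/-- Pigeonhole: reduced bases have at most s(2s + 1) ≤ 3D pairs (A, B), where s = ⌊√D⌋, so among 3D
+ 1 successive bases of I two share the same θ. Their ratio is a unit, and each step multiplies by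
at most √D. -/
theorem exists_unit_le [NonsquareRat d] {I : FracIdeal d} {γ : QuadField d} {a b : ℤ}
    (h : IsReducedForm I γ a b) :
    ∃ u : (IntegerRing d)ˣ, 1 < val ((u : IntegerRing d) : QuadField d) ∧
      val ((u : IntegerRing d) : QuadField d) ≤ √(disc d : ℝ) ^ (3 * disc d) := by
  have hst : IsRedState (I : Set (QuadField d)) (1, a, b, (disc d - b ^ 2) / (4 * a)) :=
    ⟨h.isStd.isCFState h.isMin, h.isStd.isRed h.isMin⟩
  choose f hf using fun t : {t // IsRedState (I : Set (QuadField d)) t} => t.2.exists_next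
  let S : ℕ → {t // IsRedState (I : Set (QuadField d)) t} := fun k =>
    (fun t => ⟨f t, (hf t).1⟩)^[k] ⟨_, hst⟩
  have hS0 : (S 0).1.1 = 1 := rfl
  have hSs : ∀ k, (S (k + 1)).1.1 = (S k).1.1 * quadIrr d (S k).1.2.1 (S k).1.2.2.1 := by
    intro k
    have : S (k + 1) = ⟨f (S k), (hf (S k)).1⟩ := Function.iterate_succ_apply' _ _ _
    rw [this]
    exact (hf (S k)).2
  have hpos : ∀ k, 0 < val (S k).1.1 := by
    intro k
    induction k with
    | zero => rw [hS0, val_one]; exact one_pos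
    | succ k ih =>
      rw [hSs, val_mul]
      exact mul_pos ih (by linarith [(S k).2.2.one_lt_val])
  have hmono : StrictMono fun k => val (S k).1.1 := by
    refine strictMono_nat_of_lt_succ fun k => ?_
    rw [hSs, val_mul]
    nlinarith [hpos k, (S k).2.2.one_lt_val]
  have hle : ∀ k, val (S k).1.1 ≤ √(disc d : ℝ) ^ k := by
    intro k
    induction k with
    | zero => rw [hS0, val_one]; simp
    | succ k ih =>
      rw [hSs, val_mul, pow_succ]
      exact mul_le_mul ih (S k).2.2.val_le (by linarith [(S k).2.2.one_lt_val]) (by positivity)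
  set s := Nat.sqrt (disc d) with hs
  have hsD : s * s ≤ disc d := Nat.sqrt_le _
  have hs1 : 1 ≤ s := by
    have := ((S 0).2.2).le_natSqrt.1
    have := (S 0).2.2.1
    omega
  obtain ⟨i, hi, j, hj, hij, heq⟩ := Finset.exists_ne_map_eq_of_card_lt_of_maps_to
    (s := Finset.range (3 * disc d + 1))
    (t := Finset.Icc (1 : ℤ) s ×ˢ Finset.Icc (-s : ℤ) s)
    (f := fun k => ((S k).1.2.1, (S k).1.2.2.1)) (by
      rw [Finset.card_product, Int.card_Icc, Int.card_Icc, Finset.card_range]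
      have e1 : ((s : ℤ) + 1 - 1).toNat = s := by omega
      have e2 : ((s : ℤ) + 1 - (-s)).toNat = 2 * s + 1 := by omega
      rw [e1, e2]
      nlinarith) (by
      intro k _
      have h1 := (S k).2.2.le_natSqrt
      have h2 := (S k).2.2.1
      have h3 := abs_le.1 h1.2
      simp only [Finset.coe_product, Set.mem_prod, Finset.mem_coe, Finset.mem_Icc]
      omega)
  wlog hlt : i < j generalizing i j
  · exact this j hj i hi hij.symm heq.symm (by omega)
  simp only [Prod.mk.injEq] at heq
  simp only [Finset.mem_range] at hi hj
  have hi0 : (S i).1.1 ≠ 0 := (S i).2.1.ne_zero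
  -- Equal pairs (A, B) mean that multiplication by u carries one basis of I to another, so uI = I
  -- and thus u𝒪 = 𝒪.
  set u := (S j).1.1 * ((S i).1.1)⁻¹ with hu
  have hui : u * (S i).1.1 = (S j).1.1 := by rw [hu]; field_simp
  have hu0 : u ≠ 0 := mul_ne_zero (S j).2.1.ne_zero (inv_ne_zero hi0)
  have huI : ∀ ξ, ξ ∈ I ↔ u * ξ ∈ I := by
    have hm : ∀ k ξ, ξ ∈ I ↔
        ξ ∈ latt (S k).1.1 ((S k).1.1 * quadIrr d (S k).1.2.1 (S k).1.2.2.1) := fun k ξ => by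
      rw [(S k).2.1.latt_eq]; rfl
    intro ξ
    rw [hm i ξ, hm j, ← mul_mem_latt_iff hu0, ← mul_assoc, hui, heq.1, heq.2]
  have hγ0 := ne_zero_of_one_eq_smul h.one_eq
  have hu1 : ∀ o, o ∈ (1 : FracIdeal d) ↔ u * o ∈ (1 : FracIdeal d) := by
    intro o
    have e1 : ∀ o, o ∈ (1 : FracIdeal d) ↔ γ⁻¹ * o ∈ I := fun o => by
      rw [mem_iff_of_one_eq_smul h.one_eq, ← mul_assoc, mul_inv_cancel₀ hγ0, one_mul]
    rw [e1, huI, e1, show γ⁻¹ * (u * o) = u * (γ⁻¹ * o) by ring]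
  have m1 : u ∈ (1 : FracIdeal d) := by
    have := (hu1 1).1 one_mem_one
    rwa [mul_one] at this
  have m2 : u⁻¹ ∈ (1 : FracIdeal d) := by
    rw [hu1, mul_inv_cancel₀ hu0]; exact one_mem_one
  refine ⟨⟨⟨u, mem_one_iff_isIntegral.1 m1⟩, ⟨u⁻¹, mem_one_iff_isIntegral.1 m2⟩,
    Subtype.ext (mul_inv_cancel₀ hu0), Subtype.ext (inv_mul_cancel₀ hu0)⟩, ?_, ?_⟩
  · change 1 < val u
    rw [hu, val_mul, val_inv, ← div_eq_mul_inv, one_lt_div (hpos i)]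
    exact hmono hlt
  · change val u ≤ _
    have h1 : 1 ≤ val (S i).1.1 := by
      have := hmono.monotone (Nat.zero_le i)
      simpa only [hS0, val_one] using this
    have hD1 : 1 ≤ √(disc d : ℝ) := by
      have h2 := natSqrt_lt_sqrt (d := d)
      have h3 : (1 : ℝ) ≤ ((Nat.sqrt (disc d) : ℤ) : ℝ) := by exact_mod_cast hs1
      linarith
    calc val u ≤ val (S j).1.1 := by
          rw [hu, val_mul, val_inv, ← div_eq_mul_inv]
          exact div_le_self (hpos j).le h1
      _ ≤ √(disc d : ℝ) ^ j := hle j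
      _ ≤ _ := pow_le_pow_right₀ hD1 (by omega)

/-- Both w and w⁻¹ lie in I. As |w⁻¹| < 1 and 1 is a minimum, |w'| ≤ 1. If w were below θ, it would
be an integer multiple of 1, and |w'| ≤ 1 would contradict w > 1. This keeps units above 1 away from
1, so that the infimum in `regulator` is positive. -/
theorem le_val_unit [NonsquareRat d] {I : FracIdeal d} {a b : ℤ}
    (h : IsStandardForm I a b) (hI : IsMinimum I 1) (u : (IntegerRing d)ˣ)
    (hu : 1 < val ((u : IntegerRing d) : QuadField d)) :
    val (quadIrr d a b) ≤ val ((u : IntegerRing d) : QuadField d) := by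
  set w : QuadField d := ((u : IntegerRing d) : QuadField d) with hw
  set w' : QuadField d := (((u⁻¹ : (IntegerRing d)ˣ) : IntegerRing d) : QuadField d) with hw'
  have hww : w * w' = 1 := by
    exact congrArg Subtype.val (Units.mul_inv u)
  have m1 : w ∈ I := by
    have := mul_mem_of_mem_one (mem_one_iff_isIntegral.2 (u : IntegerRing d).2) hI.1
    rwa [mul_one] at this
  have m2 : w' ∈ I := by
    have := mul_mem_of_mem_one
      (mem_one_iff_isIntegral.2 ((u⁻¹ : (IntegerRing d)ˣ) : IntegerRing d).2) hI.1
    rwa [mul_one] at this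
  have hw'0 : w' ≠ 0 := right_ne_zero_of_mul_eq_one hww
  have hr := h.isRed hI
  by_contra hcon
  rw [not_le] at hcon
  have e1 : val w * val w' = 1 := by rw [← val_mul, hww, val_one]
  have e2 : conjVal w * conjVal w' = 1 := by rw [← conjVal_mul, hww, conjVal_one]
  have hw'lt : |val w'| < 1 := by
    have : |val w| * |val w'| = 1 := by rw [← abs_mul, e1, abs_one]
    rw [abs_of_pos (by linarith)] at this
    nlinarith [abs_pos.2 (val_ne_zero hw'0)]
  have hc : |conjVal w| ≤ 1 := by
    by_contra hc
    rw [not_le] at hc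
    refine hI.2.2 ⟨w', m2, hw'0, by rwa [val_one, abs_one], ?_⟩
    rw [conjVal_one, abs_one]
    have : |conjVal w| * |conjVal w'| = 1 := by rw [← abs_mul, e2, abs_one]
    nlinarith [abs_pos.2 (conjVal_ne_zero hw'0)]
  obtain ⟨x, y, hxy⟩ : w ∈ latt 1 (quadIrr d a b) := by rw [← h.coe_eq]; exact m1
  have hy : y = 0 := by
    refine coeff_eq_zero_of_consecutive (p := 1) (p' := 1)
      (q' := conjVal (quadIrr d a b)) one_pos hr.one_lt_val
      (by linarith [hr.conjVal_neg]) (x := x) ?_ ?_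
    · have : |val w| < val (quadIrr d a b) := by rwa [abs_of_pos (by linarith)]
      rwa [hxy, val_add, val_mul, val_mul, val_intCast, val_intCast, val_one] at this
    · rw [hxy, conjVal_add, conjVal_mul, conjVal_mul, conjVal_intCast, conjVal_intCast,
        conjVal_one] at hc
      rwa [abs_one]
  have h1 : val w = x := by rw [hxy, hy, mul_one, Int.cast_zero, zero_mul, add_zero, val_intCast]
  have h2 : conjVal w = x := by
    rw [hxy, hy, mul_one, Int.cast_zero, zero_mul, add_zero, conjVal_intCast]
  rw [h2, ← h1] at hc
  linarith [le_abs_self (val w)]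

theorem regulator_bounds [NonsquareRat d] {I : FracIdeal d} {γ : QuadField d} {a b : ℤ}
    (h : IsReducedForm I γ a b) (h1 : 1 ≤ disc d) :
    0 < regulator d ∧ regulator d ≤ 3 * disc d * disc d := by
  obtain ⟨u, hu1, hu2⟩ := exists_unit_le h
  have hr := (h.isStd.isRed h.isMin).one_lt_val
  constructor
  · refine lt_of_lt_of_le (Real.log_pos hr) (le_csInf ⟨_, u, hu1, rfl⟩ ?_)
    rintro r ⟨w, hw, rfl⟩
    exact Real.log_le_log (by linarith) (le_val_unit h.isStd h.isMin w hw)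
  · have hle : regulator d ≤ Real.log (val ((u : IntegerRing d) : QuadField d)) := by
      refine csInf_le ⟨0, ?_⟩ ⟨u, hu1, rfl⟩
      rintro r ⟨w, hw, rfl⟩
      exact (Real.log_pos hw).le
    refine hle.trans ?_
    · have hD : (1 : ℝ) ≤ disc d := by exact_mod_cast h1
      calc Real.log (val ((u : IntegerRing d) : QuadField d))
          ≤ Real.log (√(disc d : ℝ) ^ (3 * disc d)) := Real.log_le_log (by linarith) hu2
        _ = 3 * disc d * Real.log (√(disc d : ℝ)) := by rw [Real.log_pow]; push_cast; ring
        _ ≤ 3 * disc d * disc d := by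
          refine mul_le_mul_of_nonneg_left ?_ (by positivity)
          have h2 := Real.log_le_sub_one_of_pos (sqrt_disc_pos (d := d))
          have h3 : √(disc d : ℝ) ≤ disc d := by
            rw [Real.sqrt_le_left (by linarith)]; nlinarith
          linarith

/-- By R ≤ 3D² one has 1 + R ≤ (4D)³, so measuring the distance in multiples of R changes its
logarithm by only O(log D). -/
theorem log_one_add_le_of_regulator [NonsquareRat d] {I : FracIdeal d} {γ : QuadField d} {a b : ℤ}
    (h : IsReducedForm I γ a b) (h1 : 1 ≤ disc d) (x : ℝ) :
    Real.log (1 + |x|) ≤ 3 * Real.log (4 * disc d) + Real.log (1 + |x| / regulator d) := by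
  obtain ⟨hR, hR'⟩ := regulator_bounds h h1
  have hD : (1 : ℝ) ≤ disc d := by exact_mod_cast h1
  have hx := abs_nonneg x
  have h2 : 0 < 1 + |x| / regulator d := by positivity
  have h3 : 1 + |x| ≤ (1 + regulator d) * (1 + |x| / regulator d) := by
    have : regulator d * (|x| / regulator d) = |x| := by field_simp
    nlinarith [div_nonneg hx hR.le]
  calc Real.log (1 + |x|) ≤ Real.log ((1 + regulator d) * (1 + |x| / regulator d)) :=
        Real.log_le_log (by linarith) h3
    _ = Real.log (1 + regulator d) + Real.log (1 + |x| / regulator d) :=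
        Real.log_mul (by linarith) h2.ne'
    _ ≤ _ := by
        refine add_le_add_left (α := ℝ) ?_ _
        rw [← Nat.cast_ofNat (n := 3), ← Real.log_pow]
        refine Real.log_le_log (by linarith) ?_
        nlinarith [mul_nonneg (show (0:ℝ) ≤ disc d by linarith) (show (0:ℝ) ≤ disc d by linarith)]

/-! ### The search for the first minimum above a bound -/

/-- The element `x + yθ₀` with `θ₀ = (B₀ + √D) / 2A₀`. -/
def latElt (d : ℕ) (A₀ B₀ x y : ℤ) : QuadField d := x + y * quadIrr d A₀ B₀

/-- The data of the search: `θ₀ = (B₀ + √D) / 2A₀` has its conjugate between `-1` and `0`, and the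
first minimum above `G` in the lattice with basis `1, θ₀` is wanted. -/
structure IsSearchData (d : ℕ) (A₀ B₀ G : ℤ) : Prop where
  pos : 0 < A₀
  neg_one_lt : -1 < conjVal (quadIrr d A₀ B₀)
  lt_zero : conjVal (quadIrr d A₀ B₀) < 0
  one_le : 1 ≤ G
  le_disc : A₀ ≤ disc d
  le_disc' : G ≤ disc d
  four_le : 4 ≤ disc d

/-- The state of the search after `k` steps. -/
structure IsSearch (d : ℕ) (A₀ B₀ G : ℤ) (k : ℕ) (A B C x y x' y' : ℤ) : Prop where
  isCF : IsCFState (latt 1 (quadIrr d A₀ B₀)) (latElt d A₀ B₀ x y) A B C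
  next : latElt d A₀ B₀ x y * quadIrr d A B = latElt d A₀ B₀ x' y'
  conj_le : |conjVal (latElt d A₀ B₀ x y)| ≤ 1
  -- Up to sign, A/A₀ is the norm of e. This bounds A as long as |e| ≤ G.
  abs_eq : |(A : ℝ)| = A₀ * (|val (latElt d A₀ B₀ x y)| * |conjVal (latElt d A₀ B₀ x y)|)
  nonneg : 0 ≤ y
  le : y ≤ y'
  one_le : 1 ≤ y'
  -- The sum of the two coefficients grows by a factor of at least 3/2 per step, its square by at
  -- least 2. The next field, a bound by y alone, follows from the sum one step earlier, with + 1
  -- for the start y = 0.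
  pow_le : (2 : ℤ) ^ k ≤ (y + y') ^ 2
  pow_le' : (2 : ℤ) ^ k ≤ 2 * (2 * y) ^ 2 + 1
  -- While θ is negative the bound G cannot be passed. This makes the basis before the exit reduced.
  small : |val (latElt d A₀ B₀ x y)| ≤ G → val (quadIrr d A B) < 0 →
    |val (latElt d A₀ B₀ x' y')| ≤ G
  large : (G : ℝ) < |val (latElt d A₀ B₀ x y)| → y ≤ 2 * (disc d : ℤ) ^ 4 ∧
    1 < val (quadIrr d A B) ∧ ∃ f A' B', |val f| ≤ G ∧ latElt d A₀ B₀ x y = f * quadIrr d A' B' ∧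
      IsRed (disc d) A' B' ∧ latt f (latElt d A₀ B₀ x y) = latt 1 (quadIrr d A₀ B₀)

theorem latElt_one (A₀ B₀ : ℤ) : latElt d A₀ B₀ 1 0 = 1 := by simp [latElt]

theorem latElt_theta (A₀ B₀ : ℤ) : latElt d A₀ B₀ 0 1 = quadIrr d A₀ B₀ := by simp [latElt]

theorem IsSearchData.init [NonsquareRat d] {A₀ B₀ G C : ℤ} (h : IsSearchData d A₀ B₀ G)
    (hC : (disc d : ℤ) = B₀ ^ 2 + 4 * A₀ * C) : IsSearch d A₀ B₀ G 0 A₀ B₀ C 1 0 0 1 := by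
  have hG : (1 : ℝ) ≤ G := by exact_mod_cast h.one_le
  have hA : (0 : ℝ) < A₀ := by exact_mod_cast h.pos
  constructor
  · rw [latElt_one]
    exact ⟨hC, h.neg_one_lt, h.lt_zero, one_ne_zero, by rw [one_mul]⟩
  · rw [latElt_one, latElt_theta, one_mul]
  · rw [latElt_one, conjVal_one, abs_one]
  · rw [latElt_one, conjVal_one, val_one, abs_one, abs_of_pos hA]; ring
  · rfl
  · norm_num
  · rfl
  · norm_num
  · norm_num
  -- The value θ₀ exceeds its conjugate, which is above -1, so a negative θ₀ has absolute value
  -- below 1 ≤ G.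
  · intro _ hneg
    rw [latElt_theta, abs_of_neg hneg]
    have h1 := val_sub_conjVal_quadIrr (d := d) (A := A₀) (B := B₀)
    have h2 : 0 < √(disc d : ℝ) / A₀ := div_pos (sqrt_disc_pos (d := d)) hA
    linarith [h.neg_one_lt]
  · intro h
    rw [latElt_one, val_one, abs_one] at h
    linarith

theorem val_sub_conjVal_latElt (A₀ B₀ x y : ℤ) :
    val (latElt d A₀ B₀ x y) - conjVal (latElt d A₀ B₀ x y) = y * (√(disc d : ℝ) / A₀) := by
  simp only [latElt, val_add, conjVal_add, val_mul, conjVal_mul, val_intCast, conjVal_intCast]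
  rw [← val_sub_conjVal_quadIrr (B := B₀)]
  ring

theorem IsSearchData.abs_coeff_le [NonsquareRat d] {A₀ B₀ G x y : ℤ} (h : IsSearchData d A₀ B₀ G)
    (hc : |conjVal (latElt d A₀ B₀ x y)| ≤ 1) : |x| ≤ 1 + |y| := by
  have h1 : (x : ℝ) = conjVal (latElt d A₀ B₀ x y) - y * conjVal (quadIrr d A₀ B₀) := by
    simp only [latElt, conjVal_add, conjVal_mul, conjVal_intCast]; ring
  have h2 : |conjVal (quadIrr d A₀ B₀)| ≤ 1 :=
    abs_le.2 ⟨h.neg_one_lt.le, by linarith [h.lt_zero]⟩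
  have h3 : |(x : ℝ)| ≤ 1 + |(y : ℝ)| := by
    rw [h1]
    refine (abs_sub _ _).trans (add_le_add hc ?_)
    rw [abs_mul]
    nlinarith [abs_nonneg (y : ℝ)]
  exact_mod_cast h3

/-- The sizes of the numbers in the search. -/
theorem IsSearch.bounds [NonsquareRat d] {A₀ B₀ G A B C x y x' y' : ℤ} {k : ℕ}
    (h : IsSearch d A₀ B₀ G k A B C x y x' y') (h₀ : IsSearchData d A₀ B₀ G)
    (hG : |val (latElt d A₀ B₀ x y)| ≤ G) :
    |A| ≤ (disc d : ℤ) ^ 2 ∧ |B| ≤ 3 * (disc d : ℤ) ^ 2 ∧ |C| ≤ 3 * (disc d : ℤ) ^ 4 ∧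
      y ≤ (disc d : ℤ) ^ 2 ∧ y' ≤ 2 * (disc d : ℤ) ^ 4 ∧
      |conjVal (latElt d A₀ B₀ x' y')| ≤ 1 := by
  obtain ⟨D, hD⟩ : ∃ D : ℝ, D = disc d := ⟨_, rfl⟩
  have hD4 : (4 : ℝ) ≤ D := by rw [hD]; exact_mod_cast h₀.four_le
  have hS := sqrt_disc_sq d
  have hSpos := sqrt_disc_pos (d := d)
  set S := √(disc d : ℝ) with hSdef
  rw [← hD] at hS
  have hS2 : 2 ≤ S := by nlinarith
  have hSD : S ≤ D := by nlinarith
  have hA₀ : (0 : ℝ) < A₀ := by exact_mod_cast h₀.pos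
  have hA₀D : (A₀ : ℝ) ≤ D := by rw [hD]; exact_mod_cast h₀.le_disc
  have hGD : (G : ℝ) ≤ D := by rw [hD]; exact_mod_cast h₀.le_disc'
  have hG1 : (1 : ℝ) ≤ G := by exact_mod_cast h₀.one_le
  have hD2 : 4 * D ≤ D ^ 2 := by nlinarith
  have hD3 : 4 * D ^ 2 ≤ D ^ 3 := by nlinarith
  have hD4' : 4 * D ^ 3 ≤ D ^ 4 := by nlinarith [pow_pos (show 0 < D by linarith) 3]
  obtain ⟨hA, hC⟩ := h.isCF.ne_zero'
  have hA1 : (1 : ℝ) ≤ |(A : ℝ)| := by exact_mod_cast Int.one_le_abs hA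
  -- From the norm identity |A| = A₀|e||e'| with A₀ ≤ D, |e| ≤ G ≤ D and |e'| ≤ 1.
  have hAb : |(A : ℝ)| ≤ D ^ 2 := by
    rw [h.abs_eq, pow_two]
    refine mul_le_mul hA₀D ?_ (by positivity) (by linarith)
    calc _ ≤ D * 1 := mul_le_mul (hG.trans hGD) h.conj_le (abs_nonneg _) (by linarith)
      _ = D := mul_one D
  have hBb : |(B : ℝ)| ≤ 3 * D ^ 2 := by
    have := h.isCF.abs_mul_le
    rw [← hSdef] at this
    linarith
  have hCb : |(C : ℝ)| ≤ 3 * D ^ 4 := by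
    have h1 : 4 * ((A : ℝ) * C) = D - B ^ 2 := by
      have : (disc d : ℝ) = B ^ 2 + 4 * A * C := by exact_mod_cast h.isCF.disc_eq
      rw [hD, this]; ring
    have h2 : 4 * (|(A : ℝ)| * |(C : ℝ)|) ≤ D + |(B : ℝ)| ^ 2 := by
      rw [← abs_mul, ← abs_of_pos (show (0 : ℝ) < 4 by norm_num), ← abs_mul, h1, sq_abs]
      refine (abs_sub _ _).trans (le_of_eq ?_)
      rw [abs_of_pos (by linarith : 0 < D), abs_of_nonneg (sq_nonneg _)]
    have h3 : |(B : ℝ)| ^ 2 ≤ (3 * D ^ 2) ^ 2 := pow_le_pow_left₀ (abs_nonneg _) hBb 2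
    nlinarith [abs_nonneg (C : ℝ)]
  -- The coefficient y is recovered from e - e' = y√D/A₀. The bound for y' uses eθ in place of e.
  have hyb : (y : ℝ) ≤ D ^ 2 := by
    have h1 := val_sub_conjVal_latElt (d := d) A₀ B₀ x y
    rw [← hSdef, ← mul_div_assoc, eq_div_iff hA₀.ne'] at h1
    have h2 : val (latElt d A₀ B₀ x y) - conjVal (latElt d A₀ B₀ x y) ≤ D + 1 := by
      linarith [(abs_le.1 hG).2, (abs_le.1 h.conj_le).1]
    have h3 : (y : ℝ) * S ≤ (D + 1) * D := by
      rw [← h1]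
      calc _ ≤ (D + 1) * (A₀ : ℝ) := mul_le_mul_of_nonneg_right h2 hA₀.le
        _ ≤ _ := by nlinarith
    have h4 : (0 : ℝ) ≤ y := by exact_mod_cast h.nonneg
    nlinarith
  have hconj' : |conjVal (latElt d A₀ B₀ x' y')| ≤ 1 := by
    rw [← h.next, conjVal_mul, abs_mul]
    have h2 : |conjVal (quadIrr d A B)| ≤ 1 :=
      abs_le.2 ⟨h.isCF.neg_one_lt.le, by linarith [h.isCF.lt_zero]⟩
    exact mul_le_one₀ h.conj_le (abs_nonneg _) h2
  have hyb' : (y' : ℝ) ≤ 2 * D ^ 4 := by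
    have h1 := val_sub_conjVal_latElt (d := d) A₀ B₀ x' y'
    rw [← hSdef, ← mul_div_assoc, eq_div_iff hA₀.ne'] at h1
    have hθ : |val (quadIrr d A B)| ≤ 2 * D ^ 2 := by
      rw [val_quadIrr, abs_div, div_le_iff₀ (by simpa using hA), ← hSdef, abs_mul, abs_two]
      have := abs_add_le (B : ℝ) S
      rw [abs_of_pos hSpos] at this
      nlinarith
    have hv : |val (latElt d A₀ B₀ x' y')| ≤ D * (2 * D ^ 2) := by
      rw [← h.next, val_mul, abs_mul]
      exact mul_le_mul (hG.trans hGD) hθ (abs_nonneg _) (by linarith)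
    have h2 : val (latElt d A₀ B₀ x' y') - conjVal (latElt d A₀ B₀ x' y') ≤ 2 * D ^ 3 + 1 := by
      have := (abs_le.1 hv).2
      have := (abs_le.1 hconj').1
      nlinarith
    have h3 : (y' : ℝ) * S ≤ (2 * D ^ 3 + 1) * D := by
      rw [← h1]
      calc _ ≤ (2 * D ^ 3 + 1) * (A₀ : ℝ) := mul_le_mul_of_nonneg_right h2 hA₀.le
        _ ≤ _ := mul_le_mul_of_nonneg_left hA₀D (by positivity)
    have h4 : (1 : ℝ) ≤ y' := by exact_mod_cast h.one_le
    nlinarith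
  rw [hD] at hAb hBb hCb hyb hyb'
  refine ⟨?_, ?_, ?_, ?_, ?_, hconj'⟩
  · exact_mod_cast hAb
  · exact_mod_cast hBb
  · exact_mod_cast hCb
  · exact_mod_cast hyb
  · exact_mod_cast hyb'

/-- Two facts about values carry the step. If q + 1/θ is negative, then θ < 0 and |q + 1/θ| ≤ 1/|θ|,
so the element after eθ is at most |e| ≤ G. If |eθ| > G, then θ cannot be negative, and |e| ≤ G
gives θ > 1, so θ is reduced. -/
theorem IsSearch.step [NonsquareRat d] {A₀ B₀ G A B C x y x' y' q : ℤ} {k : ℕ}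
    (h : IsSearch d A₀ B₀ G k A B C x y x' y') (h₀ : IsSearchData d A₀ B₀ G)
    (hG : |val (latElt d A₀ B₀ x y)| ≤ G)
    (hq : q = partialQuot (Nat.sqrt (disc d)) B C) :
    IsSearch d A₀ B₀ G (k + 1) C (2 * C * q - B) (A + q * B - C * q ^ 2) x' y'
      (x + q * x') (y + q * y') := by
  obtain ⟨hAb, hBb, hCb, hyb, hyb', hconj'⟩ := h.bounds h₀ hG
  obtain ⟨hq1, hst, hrel⟩ := h.isCF.step hq
  obtain ⟨hA, hC⟩ := h.isCF.ne_zero'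
  have hinv := quadIrr_inv h.isCF q
  have hA' : (A : ℝ) ≠ 0 := by exact_mod_cast hA
  have hq1R : (1 : ℝ) ≤ q := by exact_mod_cast hq1
  have hnext : latElt d A₀ B₀ x' y' * quadIrr d C (2 * C * q - B)
      = latElt d A₀ B₀ (x + q * x') (y + q * y') := by
    rw [← h.next, hrel, h.next]
    simp only [latElt]; push_cast; ring
  rw [h.next] at hst hrel
  have hynew : y + y' ≤ y + q * y' := by nlinarith [h.one_le]
  have hvq : val (quadIrr d C (2 * C * q - B)) = q + (val (quadIrr d A B))⁻¹ := by
    rw [hinv, val_add, val_intCast, val_inv]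
  have hvn : |val (latElt d A₀ B₀ x' y')|
      = |val (latElt d A₀ B₀ x y)| * |val (quadIrr d A B)| := by
    rw [← h.next, val_mul, abs_mul]
  constructor
  · exact hst
  · exact hnext
  · exact hconj'
  · have h1 : |(C : ℝ)| = |(A : ℝ)| * (|val (quadIrr d A B)| * |conjVal (quadIrr d A B)|) := by
      rw [← abs_mul, ← abs_mul, val_quadIrr, conjVal_quadIrr, ← abs_neg]
      congr 1
      have hs : √(disc d : ℝ) ^ 2 = B ^ 2 + 4 * A * C := by
        rw [sqrt_disc_sq]; exact_mod_cast h.isCF.disc_eq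
      field_simp
      linear_combination hs
    rw [h1, h.abs_eq, ← h.next, val_mul, conjVal_mul, abs_mul, abs_mul]
    ring
  · linarith [h.one_le]
  · linarith [h.nonneg]
  · linarith [h.nonneg, h.one_le]
  · have := h.pow_le
    -- Uses y ≤ y' and q ≥ 1: the new sum is at least y + 2y'.
    have h2 : (y + y') * 3 ≤ (y' + (y + q * y')) * 2 := by linarith [h.le]
    rw [pow_succ]
    nlinarith [h.nonneg, h.one_le]
  · have := h.pow_le
    rw [pow_succ]
    nlinarith [h.nonneg, h.one_le, h.le]
  · intro h1 h2
    rw [← hnext]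
    rw [hvq] at h2
    have hθneg : val (quadIrr d A B) < 0 := by
      rw [← inv_lt_zero]; linarith
    rw [val_mul, abs_mul, hvq, abs_of_neg h2]
    have h3 : -(q + (val (quadIrr d A B))⁻¹) ≤ |val (quadIrr d A B)|⁻¹ := by
      rw [abs_of_neg hθneg, inv_neg]; linarith
    calc _ ≤ |val (latElt d A₀ B₀ x' y')| * |val (quadIrr d A B)|⁻¹ :=
          mul_le_mul_of_nonneg_left h3 (abs_nonneg _)
      _ = |val (latElt d A₀ B₀ x y)| := by
          rw [hvn, mul_assoc, mul_inv_cancel₀ (abs_ne_zero.2 hθneg.ne), mul_one]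
      _ ≤ G := hG
  · intro hlarge
    have hθ0 : 0 ≤ val (quadIrr d A B) := by
      by_contra hneg
      exact absurd (h.small hG (not_le.1 hneg)) (not_le.2 hlarge)
    have hθ1 : 1 < val (quadIrr d A B) := by
      rw [hvn, abs_of_nonneg hθ0] at hlarge
      by_contra hcon
      nlinarith [abs_nonneg (val (latElt d A₀ B₀ x y))]
    refine ⟨hyb', ?_, latElt d A₀ B₀ x y, A, B, hG, h.next.symm,
      isRed_of_val (h.isCF.pos_of_val_pos (by linarith)) hθ1 h.isCF.neg_one_lt h.isCF.lt_zero, ?_⟩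
    · rw [hvq]
      have : 0 < (val (quadIrr d A B))⁻¹ := inv_pos.2 (by linarith)
      linarith
    · rw [← h.next]; exact h.isCF.latt_eq

/-- The end of the search gives the `*`-square. -/
theorem IsSearch.exists_isStarSquare [NonsquareRat d] {A₀ B₀ G A B C x y x' y' : ℤ} {k : ℕ}
    (h : IsSearch d A₀ B₀ G k A B C x y x' y') (h₀ : IsSearchData d A₀ B₀ G)
    (hG : (G : ℝ) < |val (latElt d A₀ B₀ x y)|) {I : FracIdeal d} {γ : QuadField d}
    (hγ : (1 : FracIdeal d) = γ • I)
    (hL : ∀ ξ, γ ^ 2 * ξ ∈ (1 : FracIdeal d) ↔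
      (G : QuadField d) * ξ ∈ latt 1 (quadIrr d A₀ B₀)) :
    IsRed (disc d) A B ∧ |val (latElt d A₀ B₀ x y)| ≤ G * √(disc d : ℝ) ∧
    ∃ J : FracIdeal d, IsStarSquare (I, Real.log |val γ|)
      (J, 2 * Real.log |val γ| + Real.log (|val (latElt d A₀ B₀ x y)| / G)) ∧
      IsStandardForm J A B := by
  obtain ⟨-, hθ1, f, A', B', hf, he, hred', hlatt⟩ := h.large hG
  set e := latElt d A₀ B₀ x y with hedef
  have hG1 : (1 : ℝ) ≤ G := by exact_mod_cast h₀.one_le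
  have hG0 : (G : QuadField d) ≠ 0 := by
    have := h₀.one_le
    exact_mod_cast (by omega : G ≠ 0)
  have hred : IsRed (disc d) A B :=
    isRed_of_val (h.isCF.pos_of_val_pos (by linarith)) hθ1 h.isCF.neg_one_lt h.isCF.lt_zero
  have hv' := hred'.one_lt_val
  have hve : val e = val f * val (quadIrr d A' B') := by rw [he, val_mul]
  have hfne : f ≠ 0 := by
    rintro rfl
    exact h.isCF.ne_zero (by rw [← hedef, he, zero_mul])
  refine ⟨hred, ?_, ?_⟩
  · rw [hve, abs_mul, abs_of_pos (by linarith : 0 < val (quadIrr d A' B'))]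
    exact mul_le_mul hf hred'.val_le (by linarith) (by linarith)
  -- The element f may be negative. The scaling c = ε/G makes it positive and carries ℤ + ℤθ₀ to
  -- γ⁻²𝒪, where p = cf and β = ce.
  obtain ⟨ε, hε, hεf⟩ : ∃ ε : QuadField d, (ε = 1 ∨ ε = -1) ∧ 0 < val (ε * f) := by
    rcases lt_or_gt_of_ne (val_ne_zero hfne) with hlt | hlt
    · exact ⟨-1, .inr rfl, by rw [neg_one_mul, val_neg]; linarith⟩
    · exact ⟨1, .inl rfl, by rwa [one_mul]⟩
  have hεε : ε * ε = 1 := by rcases hε with rfl | rfl <;> ring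
  have hvε : |val ε| = 1 := by
    rcases hε with rfl | rfl
    · rw [val_one, abs_one]
    · rw [val_neg, val_one, abs_neg, abs_one]
  set c := ε * (G : QuadField d)⁻¹ with hc
  have hc0 : c ≠ 0 := mul_ne_zero (by rintro rfl; simp at hεε) (inv_ne_zero hG0)
  have hlattc : ∀ p q : QuadField d, ∀ ξ, ξ ∈ latt (c * p) (c * q) ↔
      (G : QuadField d) * ξ ∈ latt p q := by
    intro p q ξ
    have e1 : ξ = c * (ε * (G * ξ)) := by
      rw [hc, show ε * (G : QuadField d)⁻¹ * (ε * (G * ξ)) = (ε * ε) * ((G : QuadField d)⁻¹ * G) * ξ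
        by ring, hεε, inv_mul_cancel₀ hG0]
      ring
    conv_lhs => rw [e1]
    rw [mul_mem_latt_iff hc0]
    rcases hε with rfl | rfl
    · rw [one_mul]
    · rw [neg_one_mul]
      exact ⟨fun h => by simpa using neg_mem_latt h, neg_mem_latt⟩
  have hvcf : val (c * f) = |val f| / G := by
    have : val (c * f) = val (ε * f) / G := by
      rw [hc, show ε * (G : QuadField d)⁻¹ * f = (ε * f) * (G : QuadField d)⁻¹ by ring, val_mul,
        val_inv, val_intCast, div_eq_mul_inv]
    rw [this, ← abs_of_pos hεf, val_mul, abs_mul, hvε, one_mul]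
  have hvce : val (c * e) = |val e| / G := by
    rw [he, ← mul_assoc, val_mul, hvcf, val_mul, abs_mul,
      abs_of_pos (by linarith : 0 < val (quadIrr d A' B'))]
    ring
  have hcce : conjVal (c * e) = conjVal (c * f) * conjVal (quadIrr d A' B') := by
    rw [he, ← mul_assoc, conjVal_mul]
  have hccf0 : conjVal (c * f) ≠ 0 := conjVal_ne_zero (mul_ne_zero hc0 hfne)
  rw [← hvce]
  refine PrincipalCycle.exists_isStarSquare (p := c * f) hγ ?_ ?_ ?_ ?_ ?_ ?_ hred ?_ ?_
  · intro ξ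
    rw [hL, ← hlatt, hlattc]
  · rw [hvcf]; exact div_pos (abs_pos.2 (val_ne_zero hfne)) (by linarith)
  · rw [hvcf, div_le_one (by linarith)]; exact hf
  · rw [hvce, one_lt_div (by linarith)]; exact hG
  · rw [hcce, ← mul_assoc]
    exact mul_neg_of_pos_of_neg (mul_self_pos.2 hccf0) hred'.conjVal_neg
  · rw [hcce, abs_mul]
    have : |conjVal (quadIrr d A' B')| < 1 :=
      abs_lt.2 ⟨hred'.neg_one_lt_conjVal, by linarith [hred'.conjVal_neg]⟩
    nlinarith [abs_pos.2 hccf0]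
  · exact ⟨-C, by rw [h.isCF.disc_eq]; ring⟩
  · ext ξ
    rw [hlattc, mul_assoc c e, hlattc, hlatt, h.isCF.latt_eq]

/-! ### Subprograms -/

instance : Add Ex := ⟨Ex.add⟩
instance : Sub Ex := ⟨Ex.sub⟩
instance : Mul Ex := ⟨Ex.mul⟩
instance : Div Ex := ⟨Ex.div⟩

theorem Ex.eval_add (σ : ℕ → ℤ) (e f : Ex) : (e + f).eval σ = e.eval σ + f.eval σ := rfl
theorem Ex.eval_sub (σ : ℕ → ℤ) (e f : Ex) : (e - f).eval σ = e.eval σ - f.eval σ := rfl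
theorem Ex.eval_mul (σ : ℕ → ℤ) (e f : Ex) : (e * f).eval σ = e.eval σ * f.eval σ := rfl
theorem Ex.eval_div (σ : ℕ → ℤ) (e f : Ex) : (e / f).eval σ = e.eval σ / f.eval σ := rfl
theorem Ex.eval_reg (σ : ℕ → ℤ) (i : ℕ) : (Ex.reg i).eval σ = σ i := rfl
theorem Ex.eval_lit (σ : ℕ → ℤ) (c : ℤ) : (Ex.lit c).eval σ = c := rfl

/-- The value of a register. -/
abbrev reg (i : ℕ) : Ex := Ex.reg i

/-- A constant. -/
abbrev lit (c : ℤ) : Ex := Ex.lit c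

/-- Newton's iteration for the integer square root of register `40`, with the result in register
`41`. -/
def sqrtProg : Prog :=
  .seq (asg 41 (reg 40)) <| .seq (asg 42 (reg 40 - reg 40 / reg 41)) <|
    .loop 42 <| .seq (asg 41 ((reg 41 + reg 40 / reg 41) / lit 2)) (asg 42 (reg 41 - reg 40 / reg 41))

/-- Arithmetic-geometric mean: with s = ⌊√X⌋, (s - r)² ≥ 0 gives (2s - r)r ≤ s² ≤ X, so Newton's
iteration never falls below s. -/
theorem sqrt_le_newton {X r : ℕ} (hr : 0 < r) : Nat.sqrt X ≤ (r + X / r) / 2 := by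
  have hs := Nat.sqrt_le X
  set s := Nat.sqrt X
  rw [Nat.le_div_iff_mul_le (by norm_num)]
  rcases le_or_gt (s * 2) r with h | h
  · exact h.trans (Nat.le_add_right _ _)
  · have h1 : s * 2 - r ≤ X / r := by
      rw [Nat.le_div_iff_mul_le hr]
      refine le_trans ?_ hs
      obtain ⟨t, ht⟩ := Nat.exists_eq_add_of_lt h
      have : s * 2 - r = t + 1 := by omega
      rw [this]
      zify at ht ⊢
      nlinarith [sq_nonneg ((s : ℤ) - r)]
    omega

/-- For r > s the quotient X / r is at most s, so the excess over s at least halves. Starting from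
X, the iteration ends after at most b + 1 passes. -/
theorem newton_sub_le {X r : ℕ} (hr : Nat.sqrt X < r) :
    2 * ((r + X / r) / 2 - Nat.sqrt X) ≤ r - Nat.sqrt X := by
  have h1 : X / r < Nat.sqrt X + 1 := by
    rw [Nat.div_lt_iff_lt_mul (by omega)]
    exact lt_of_lt_of_le (Nat.lt_succ_sqrt X) (Nat.mul_le_mul_left _ hr)
  omega

theorem sqrtProg_tri {b : ℕ} (hb : 5 ≤ b) {σ : ℕ → ℤ} {X : ℕ} (hX : σ 40 = X) :
    Tri b (3 * b + 6) sqrtProg σ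
      (fun τ => τ 41 = Nat.sqrt X ∧ ∀ j, j ≠ 41 → j ≠ 42 → τ j = σ j) := by
  refine Tri.of_bdd fun hσ => ?_
  have hXb : (X : ℤ) ≤ 2 ^ b := by
    have := hσ 40 (by norm_num)
    rw [hX] at this
    exact (le_abs_self _).trans this
  have habs : ∀ r : ℕ, r ≤ X → |(r : ℤ) - X / r| ≤ 2 ^ b := fun r hr => by
    have h1 : ((X / r : ℕ) : ℤ) ≤ X := by exact_mod_cast Nat.div_le_self X r
    have h2 : (r : ℤ) ≤ X := by exact_mod_cast hr
    have h3 : (0 : ℤ) ≤ ((X / r : ℕ) : ℤ) := Int.natCast_nonneg _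
    push_cast at h1 h3
    rw [abs_le]; constructor <;> linarith
  have hloop : ∀ σ₁ : ℕ → ℤ, σ₁ 40 = X → σ₁ 41 = X → σ₁ 42 = X - X / X →
      (∀ j, j ≠ 41 → j ≠ 42 → σ₁ j = σ j) →
      Tri b ((b + 1) * (2 + 1) + 1) (.loop 42 <| .seq (asg 41 ((reg 41 + reg 40 / reg 41) / lit 2))
        (asg 42 (reg 41 - reg 40 / reg 41))) σ₁
        (fun τ => τ 41 = Nat.sqrt X ∧ ∀ j, j ≠ 41 → j ≠ 42 → τ j = σ j) := by
    intro σ₁ h40 h41 h42 hfr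
    refine (Tri.loop (K := b + 1) (N := 2) hb (by norm_num) (fun k τ => ∃ r : ℕ, τ 41 = r ∧
      τ 42 = r - X / r ∧ Nat.sqrt X ≤ r ∧ r ≤ X ∧ 2 ^ k * (r - Nat.sqrt X) ≤ X ∧
      ∀ j, j ≠ 41 → j ≠ 42 → τ j = σ j) ?_ ?_ ?_).mono le_rfl ?_
    · exact ⟨X, h41, h42, Nat.sqrt_le_self X, le_rfl, by rw [pow_zero, one_mul]; omega, hfr⟩
    · rintro k τ - ⟨r, e1, e2, h1, h2, h3, h4⟩ hp
      have hlt : Nat.sqrt X < r := by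
        refine lt_of_le_of_ne h1 fun h => ?_
        have h5 : r ≤ X / r := by
          rcases Nat.eq_zero_or_pos r with h0 | h0
          · rw [h0]; exact Nat.zero_le _
          · rw [Nat.le_div_iff_mul_le h0, ← h]; exact Nat.sqrt_le X
        have h6 : (r : ℤ) ≤ X / r := by exact_mod_cast h5
        omega
      have : 2 ^ k ≤ X := le_trans (Nat.le_mul_of_pos_right _ (by omega)) h3
      have h7 : (2 : ℤ) ^ k ≤ 2 ^ b := le_trans (by exact_mod_cast this) hXb
      have := (pow_le_pow_iff_right₀ (by norm_num : (1 : ℤ) < 2)).1 h7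
      omega
    · rintro k τ - ⟨r, e1, e2, h1, h2, h3, h4⟩ hp
      have hlt : Nat.sqrt X < r := by
        refine lt_of_le_of_ne h1 fun h => ?_
        have h5 : r ≤ X / r := by
          rcases Nat.eq_zero_or_pos r with h0 | h0
          · rw [h0]; exact Nat.zero_le _
          · rw [Nat.le_div_iff_mul_le h0, ← h]; exact Nat.sqrt_le X
        have h6 : (r : ℤ) ≤ X / r := by exact_mod_cast h5
        omega
      have e40 : τ 40 = X := by rw [h4 40 (by norm_num) (by norm_num), hX]
      have hn1 := sqrt_le_newton (X := X) (r := r) (by omega)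
      have hn2 := newton_sub_le hlt
      have hn3 : (r + X / r) / 2 ≤ X := by omega
      have hev : ((reg 41 + reg 40 / reg 41) / lit 2 : Ex).eval τ = (((r + X / r) / 2 : ℕ) : ℤ) := by
        simp only [Ex.eval_add, Ex.eval_div, Ex.eval_reg, Ex.eval_lit, e1, e40]
        push_cast; rfl
      refine Tri.asg_seq hb rfl (by decide) (by norm_num) ?_ (Tri.asg hb rfl (by decide)
        (by norm_num) ?_ ?_)
      · intro _
        rw [hev, abs_of_nonneg (Int.natCast_nonneg _)]
        exact le_trans (by exact_mod_cast hn3) hXb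
      · intro _
        rw [hev]
        simp only [Ex.eval_sub, Ex.eval_div, Ex.eval_reg, Function.update_apply]
        simpa [e40] using habs _ hn3
      · rw [hev]
        refine ⟨(r + X / r) / 2, by simp, by
          simp [Ex.eval_sub, Ex.eval_div, Ex.eval_reg, e40], hn1, hn3, ?_, fun j hj hj' => ?_⟩
        · calc 2 ^ (k + 1) * ((r + X / r) / 2 - Nat.sqrt X)
              = 2 ^ k * (2 * ((r + X / r) / 2 - Nat.sqrt X)) := by ring
            _ ≤ 2 ^ k * (r - Nat.sqrt X) := Nat.mul_le_mul_left _ hn2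
            _ ≤ X := h3
        · rw [Function.update_of_ne hj', Function.update_of_ne hj, h4 j hj hj']
    -- On exit r ≤ X / r, hence r² ≤ X, and r is the integer square root. The case r = 0 is covered
    -- since division by 0 gives 0.
    · rintro τ - ⟨⟨k, -, r, e1, e2, h1, h2, h3, h4⟩, hle⟩
      refine ⟨?_, h4⟩
      rw [e1]
      have h5 : r * r ≤ X := by
        rw [e2] at hle
        have h6 : r ≤ X / r := by
          have : (r : ℤ) ≤ X / r := by linarith
          exact_mod_cast this
        exact (Nat.mul_le_mul_right _ h6).trans (Nat.div_mul_le_self _ _)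
      have := Nat.le_sqrt.2 h5
      exact_mod_cast le_antisymm this h1
  refine (Tri.asg_seq (M := (b + 1) * (2 + 1) + 1 + 1) hb rfl (by decide) (by norm_num) ?_
    (Tri.asg_seq hb rfl (by decide) (by norm_num) ?_ (hloop _ ?_ ?_ ?_ ?_))).mono (by omega)
    (fun _ _ h => h)
  · intro _; simpa [Ex.eval_reg, hX] using hXb
  · intro _
    simpa [Ex.eval_reg, Ex.eval_sub, Ex.eval_div, Function.update_apply, hX] using habs X le_rfl
  · simp [hX]
  · simp [Ex.eval_reg, hX]
  · simp [Ex.eval_reg, Ex.eval_sub, Ex.eval_div, hX]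
  · intro j hj hj'
    rw [Function.update_of_ne hj', Function.update_of_ne hj]

/-- Register `44` receives `2` to the power of register `43`. -/
def powProg : Prog :=
  .seq (asg 44 (lit 1)) <| .seq (asg 45 (reg 43)) <|
    .loop 45 <| .seq (asg 44 (reg 44 * lit 2)) (asg 45 (reg 45 - lit 1))

theorem powProg_tri {b : ℕ} (hb : 5 ≤ b) {σ : ℕ → ℤ} {n : ℕ} (hn : σ 43 = n) (hnb : n ≤ b) :
    Tri b (3 * b + 6) powProg σ
      (fun τ => τ 44 = 2 ^ n ∧ ∀ j, j ≠ 44 → j ≠ 45 → τ j = σ j) := by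
  have h2 : ∀ k ≤ b, |(2 : ℤ) ^ k| ≤ 2 ^ b := fun k hk => by
    rw [abs_of_pos (by positivity)]; exact pow_le_pow_right₀ (by norm_num) hk
  have hnle : ∀ k : ℤ, 0 ≤ k → k ≤ n → |k| ≤ 2 ^ b := fun k h0 hk => by
    rw [abs_of_nonneg h0]
    have : (b : ℤ) ≤ 2 ^ b := by exact_mod_cast Nat.lt_two_pow_self.le
    omega
  refine (Tri.asg_seq (M := (n * (2 + 1) + 1) + 1) hb rfl (by decide) (by norm_num) ?_
    (Tri.asg_seq hb rfl (by decide) (by norm_num) ?_ ((Tri.loop (K := n) (N := 2) hb (by norm_num)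
      (fun k τ => k ≤ n ∧ τ 44 = 2 ^ k ∧ τ 45 = n - k ∧ ∀ j, j ≠ 44 → j ≠ 45 → τ j = σ j)
        ?_ ?_ ?_).mono le_rfl ?_))).mono (by omega) (fun _ _ h => h)
  · intro _; simpa [Ex.eval_lit] using h2 0 (by omega)
  · intro _; simpa [Ex.eval_reg, hn] using hnle n (by omega) le_rfl
  · refine ⟨Nat.zero_le _, by simp [Ex.eval_lit], by simp [Ex.eval_reg, hn], fun j hj hj' => ?_⟩
    rw [Function.update_of_ne hj', Function.update_of_ne hj]
  · rintro k τ - ⟨h1, h3, h4, h5⟩ hp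
    omega
  · rintro k τ - ⟨h1, h3, h4, h5⟩ hp
    refine Tri.asg_seq hb rfl (by decide) (by norm_num) ?_ (Tri.asg hb rfl (by decide)
        (by norm_num) ?_ ?_)
    · intro _
      have := h2 (k + 1) (by omega)
      simpa [Ex.eval_reg, Ex.eval_mul, Ex.eval_lit, h3, pow_succ] using this
    · intro _
      have := hnle (n - k - 1) (by omega) (by omega)
      simpa [Ex.eval_reg, Ex.eval_sub, Ex.eval_lit, h4] using this
    · refine ⟨by omega, by simp [Ex.eval_reg, Ex.eval_mul, Ex.eval_lit, h3, pow_succ], ?_,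
        fun j hj hj' => ?_⟩
      · simp [Ex.eval_reg, Ex.eval_sub, Ex.eval_lit, h4]; ring
      · rw [Function.update_of_ne hj', Function.update_of_ne hj, h5 j hj hj']
  · rintro τ - ⟨⟨k, -, h1, h3, h4, h5⟩, hle⟩
    have : k = n := by omega
    subst this
    exact ⟨h3, h5⟩

/-- Register `46` receives the least `k` such that register `0` is at most `2 ^ k`. -/
def lenProg : Prog :=
  .seq (asg 46 (lit 0)) <| .seq (asg 47 (lit 1)) <| .seq (asg 48 (reg 0 - lit 1)) <|
    .loop 48 <| .seq (asg 47 (reg 47 * lit 2)) <| .seq (asg 46 (reg 46 + lit 1)) (asg 48 (reg 0 - reg 47))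

theorem lenProg_tri {b : ℕ} (hb : 5 ≤ b) {σ : ℕ → ℤ} {D : ℕ} (hD : σ 0 = D) (h1 : 1 ≤ D)
    (hDb : 2 * (D : ℤ) ≤ 2 ^ b) :
    Tri b (4 * b + 8) lenProg σ
      (fun τ => (∃ l : ℕ, τ 46 = l ∧ D ≤ 2 ^ l ∧ 2 ^ l < 2 * D) ∧
        ∀ j, j ≠ 46 → j ≠ 47 → j ≠ 48 → τ j = σ j) := by
  have hbpos : (b : ℤ) ≤ 2 ^ b := by exact_mod_cast Nat.lt_two_pow_self.le
  have h32 : (32 : ℤ) ≤ 2 ^ b := by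
    calc (32 : ℤ) = 2 ^ 5 := by norm_num
      _ ≤ _ := pow_le_pow_right₀ (by norm_num) hb
  have hD1 : (1 : ℤ) ≤ D := by exact_mod_cast h1
  refine (Tri.asg_seq (M := ((b + 1) * (3 + 1) + 1) + 1 + 1) hb rfl (by decide) (by norm_num) ?_
    (Tri.asg_seq hb rfl (by decide) (by norm_num) ?_
    (Tri.asg_seq hb rfl (by decide) (by norm_num) ?_
    ((Tri.loop (K := b + 1) (N := 3) hb (by norm_num)
      (fun k τ => τ 46 = k ∧ τ 47 = 2 ^ k ∧ τ 48 = D - 2 ^ k ∧ (2 : ℤ) ^ k < 2 * D ∧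
        ∀ j, j ≠ 46 → j ≠ 47 → j ≠ 48 → τ j = σ j)
        ?_ ?_ ?_).mono le_rfl ?_)))).mono (by omega) (fun _ _ h => h)
  · intro _; simp [Ex.eval_lit]
  · intro _; simp only [Ex.eval_lit]; rw [abs_one]; linarith
  · intro _
    simp only [Ex.eval_lit, Ex.eval_sub, Ex.eval_reg]
    rw [Function.update_of_ne (by norm_num), Function.update_of_ne (by norm_num), hD,
      abs_of_nonneg (by linarith)]
    linarith
  · refine ⟨by simp [Ex.eval_lit], by simp [Ex.eval_lit],
      by simp [Ex.eval_reg, Ex.eval_lit, Ex.eval_sub, hD], by linarith, fun j hj hj' hj'' => ?_⟩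
    rw [Function.update_of_ne hj'', Function.update_of_ne hj', Function.update_of_ne hj]
  · rintro k τ - ⟨h3, h4, h5, h6, h7⟩ hp
    have : (2 : ℤ) ^ k < 2 ^ b := lt_of_lt_of_le h6 hDb
    have := (pow_lt_pow_iff_right₀ (by norm_num : (1 : ℤ) < 2)).1 this
    omega
  · rintro k τ - ⟨h3, h4, h5, h6, h7⟩ hp
    have hlt : (2 : ℤ) ^ (k + 1) < 2 * D := by rw [pow_succ]; linarith
    have hkb : k + 1 ≤ b := by
      have : (2 : ℤ) ^ (k + 1) < 2 ^ b := lt_of_lt_of_le hlt hDb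
      have := (pow_lt_pow_iff_right₀ (by norm_num : (1 : ℤ) < 2)).1 this
      omega
    have h0 : τ 0 = D := by rw [h7 0 (by norm_num) (by norm_num) (by norm_num), hD]
    have hpos : (0 : ℤ) < 2 ^ (k + 1) := by positivity
    refine Tri.asg_seq hb rfl (by decide) (by norm_num) ?_ (Tri.asg_seq hb rfl (by decide)
        (by norm_num) ?_ (Tri.asg hb rfl (by decide) (by norm_num) ?_ ?_))
    · intro _
      simp only [Ex.eval_mul, Ex.eval_reg, Ex.eval_lit, h4]
      rw [← pow_succ, abs_of_pos hpos]
      linarith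
    · intro _
      simp only [Ex.eval_add, Ex.eval_reg, Ex.eval_lit]
      rw [Function.update_of_ne (by norm_num), h3, abs_of_nonneg (by positivity)]
      have : ((k : ℤ) + 1) ≤ b := by exact_mod_cast hkb
      linarith
    · intro _
      have hv : |(D : ℤ) - 2 ^ k * 2| ≤ 2 ^ b := by
        rw [← pow_succ, abs_le]; constructor <;> linarith
      simpa [Ex.eval_sub, Ex.eval_mul, Ex.eval_reg, Ex.eval_lit, h0, h4] using hv
    · refine ⟨by simp [Ex.eval_reg, Ex.eval_add, Ex.eval_lit, h3],
        by simp [Ex.eval_reg, Ex.eval_mul, Ex.eval_lit, h4, pow_succ],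
        by simp [Ex.eval_reg, Ex.eval_sub, Ex.eval_mul, Ex.eval_lit, h0, h4, pow_succ], hlt,
        fun j hj hj' hj'' => ?_⟩
      rw [Function.update_of_ne hj'', Function.update_of_ne hj, Function.update_of_ne hj',
        h7 j hj hj' hj'']
  · rintro τ - ⟨⟨k, -, h3, h4, h5, h6, h7⟩, hle⟩
    refine ⟨⟨k, h3, ?_, by exact_mod_cast h6⟩, h7⟩
    have : (D : ℤ) ≤ 2 ^ k := by linarith
    exact_mod_cast this

/-! ### Blocks of assignments -/

/-- The exponent of a bound for the value of an expression, given exponents for the registers. -/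
def Ex.weight (lv : ℕ → ℕ) : Ex → ℕ
  | lit _ => 1
  | reg i => lv i
  | add e f => e.weight lv + f.weight lv
  | sub e f => e.weight lv + f.weight lv
  | mul e f => e.weight lv + f.weight lv
  | div e f => e.weight lv + f.weight lv

/-- All registers that occur have a positive exponent. -/
def Ex.Tracked (lv : ℕ → ℕ) : Ex → Bool
  | lit _ => true
  | reg i => decide (0 < lv i)
  | add e f => e.Tracked lv && f.Tracked lv
  | sub e f => e.Tracked lv && f.Tracked lv
  | mul e f => e.Tracked lv && f.Tracked lv
  | div e f => e.Tracked lv && f.Tracked lv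

/-- The register `i` is at most `M ^ lv i`, where the exponent `0` stands for no information. -/
def Lev (M : ℤ) (lv : ℕ → ℕ) (σ : ℕ → ℤ) : Prop := ∀ i, 0 < lv i → |σ i| ≤ M ^ lv i

theorem Ex.one_le_weight {lv : ℕ → ℕ} (e : Ex) (h : e.Tracked lv = true) : 1 ≤ e.weight lv := by
  induction e with
  | lit c => exact le_rfl
  | reg i => simpa [Tracked, weight, Nat.one_le_iff_ne_zero, Nat.pos_iff_ne_zero] using h
  | add e f he' hf' | sub e f he' hf' | mul e f he' hf' | div e f he' hf' =>
    simp only [Tracked, Bool.and_eq_true] at h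
    exact (he' h.1).trans (Nat.le_add_right _ _)

theorem Ex.abs_eval_le_weight {M : ℤ} (hM : 32 ≤ M) {lv : ℕ → ℕ} {σ : ℕ → ℤ} (hσ : Lev M lv σ)
    (e : Ex) (hs : e.Small = true) (he : e.Tracked lv = true) : |e.eval σ| ≤ M ^ e.weight lv := by
  have h2 : ∀ e : Ex, e.Tracked lv = true → (2 : ℤ) ≤ M ^ e.weight lv := fun e he => by
    calc (2 : ℤ) ≤ M ^ 1 := by linarith
      _ ≤ _ := pow_le_pow_right₀ (by linarith) (e.one_le_weight he)
  have hsum : ∀ x y : ℤ, 2 ≤ x → 2 ≤ y → x + y ≤ x * y := fun x y hx hy => by nlinarith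
  induction e with
  | lit c =>
    have : c.natAbs ≤ 32 := by simpa [Small] using hs
    simp only [eval, weight, pow_one]
    have : |c| ≤ 32 := by rw [Int.abs_eq_natAbs]; exact_mod_cast this
    linarith
  | reg i => exact hσ i (by simpa [Tracked] using he)
  | add e f he' hf' =>
    simp only [Tracked, Small, Bool.and_eq_true] at he hs
    have h := abs_add_le (e.eval σ) (f.eval σ)
    have := hsum _ _ (h2 e he.1) (h2 f he.2)
    simp only [eval, weight, pow_add]
    linarith [he' hs.1 he.1, hf' hs.2 he.2]
  | sub e f he' hf' =>
    simp only [Tracked, Small, Bool.and_eq_true] at he hs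
    have h := abs_sub (e.eval σ) (f.eval σ)
    have := hsum _ _ (h2 e he.1) (h2 f he.2)
    simp only [eval, weight, pow_add]
    linarith [he' hs.1 he.1, hf' hs.2 he.2]
  | mul e f he' hf' =>
    simp only [Tracked, Small, Bool.and_eq_true] at he hs
    simp only [eval, weight, pow_add, abs_mul]
    exact mul_le_mul (he' hs.1 he.1) (hf' hs.2 he.2) (abs_nonneg _)
      (by linarith [h2 e he.1])
  | div e f he' hf' =>
    simp only [Tracked, Small, Bool.and_eq_true] at he hs
    have h1 : |e.eval σ / f.eval σ| ≤ |e.eval σ| := by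
      have := Int.natAbs_ediv_le_natAbs (e.eval σ) (f.eval σ)
      rw [Int.abs_eq_natAbs, Int.abs_eq_natAbs]; exact_mod_cast this
    simp only [eval, weight, pow_add]
    nlinarith [he' hs.1 he.1, h2 e he.1, h2 f he.2]

/-- A list of assignments, followed by a program. -/
def block : List (ℕ × Ex) → Prog → Prog
  | [], P => P
  | p :: l, P => .seq (asg p.1 p.2) (block l P)

/-- The effect of a list of assignments. -/
def runBlock : List (ℕ × Ex) → (ℕ → ℤ) → ℕ → ℤ
  | [], σ => σ
  | p :: l, σ => runBlock l (Function.update σ p.1 (p.2.eval σ))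

/-- The exponents after a list of assignments. -/
def levBlock : List (ℕ × Ex) → (ℕ → ℕ) → ℕ → ℕ
  | [], lv => lv
  | p :: l, lv => levBlock l (fun j => if j = p.1 then p.2.weight lv else lv j)

/-- All values computed in a list of assignments have exponent at most `w`. -/
def checkBlock (w : ℕ) : List (ℕ × Ex) → (ℕ → ℕ) → Bool
  | [], _ => true
  | p :: l, lv => p.2.Small && decide (p.2.leaves ≤ 40) && decide (p.1 < 64) && p.2.Tracked lv &&
      decide (p.2.weight lv ≤ w) && checkBlock w l (fun j => if j = p.1 then p.2.weight lv else lv j)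

theorem Lev.update {M : ℤ} (hM : 32 ≤ M) {lv : ℕ → ℕ} {σ : ℕ → ℤ} (h : Lev M lv σ) {e : Ex} (i : ℕ)
    (hs : e.Small = true) (he : e.Tracked lv = true) :
    Lev M (fun j => if j = i then e.weight lv else lv j) (Function.update σ i (e.eval σ)) := by
  intro j hj
  by_cases hji : j = i
  · subst hji
    simpa using e.abs_eval_le_weight hM h hs he
  · simp only [hji, if_false] at hj ⊢
    rw [Function.update_of_ne hji]
    exact h j hj

/-- All size conditions of a straight-line program reduce to one Boolean computation: M bounds the
tracked inputs, the exponents of M are propagated syntactically, and M ^ w ≤ 2 ^ b converts the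
largest of them into the register bound. At the call sites the check is settled by `decide`. -/
theorem Tri.block {b N w : ℕ} (hb : 5 ≤ b) {M : ℤ} (hM : 32 ≤ M) (hMb : M ^ w ≤ 2 ^ b) {P : Prog}
    {Q : (ℕ → ℤ) → Prop} (l : List (ℕ × Ex)) (lv : ℕ → ℕ) {σ : ℕ → ℤ} (hσ : Lev M lv σ)
    (hc : checkBlock w l lv = true)
    (hP : Lev M (levBlock l lv) (runBlock l σ) → Tri b N P (runBlock l σ) Q) :
    Tri b (N + l.length) (block l P) σ Q := by
  induction l generalizing lv σ with
  | nil => exact hP hσ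
  | cons p l ih =>
    simp only [checkBlock, Bool.and_eq_true, decide_eq_true_eq] at hc
    obtain ⟨⟨⟨⟨⟨h1, h2⟩, h3⟩, h4⟩, h5⟩, h6⟩ := hc
    refine Tri.asg_seq hb h1 h2 h3 (fun _ => ?_) (ih _ (hσ.update hM p.1 h1 h4) h6 hP)
    exact (p.2.abs_eval_le_weight hM hσ h1 h4).trans
      ((pow_le_pow_right₀ (by linarith) h5).trans hMb)

/-- A program that only writes to the unused register `63`. -/
def skip : Prog := asg 63 (lit 0)

theorem Tri.skip {b : ℕ} (hb : 5 ≤ b) {σ : ℕ → ℤ} {Q : (ℕ → ℤ) → Prop}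
    (hQ : Q (Function.update σ 63 0)) : Tri b 1 skip σ Q :=
  Tri.asg hb rfl (by decide) (by norm_num) (fun _ => by simp [Ex.eval_lit]) hQ

/-- The exponent `1` for the registers of a list. -/
def levOf (l : List ℕ) (i : ℕ) : ℕ := if i ∈ l then 1 else 0

theorem lev_levOf {M : ℤ} {σ : ℕ → ℤ} (l : List ℕ) (h : ∀ i ∈ l, |σ i| ≤ M) :
    Lev M (levOf l) σ := by
  intro i hi
  unfold levOf at hi ⊢
  split_ifs at hi ⊢ with h1
  · simpa using h i h1
  · omega

theorem runBlock_nil (σ : ℕ → ℤ) : runBlock [] σ = σ := rfl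
theorem runBlock_cons (p : ℕ × Ex) (l : List (ℕ × Ex)) (σ : ℕ → ℤ) :
    runBlock (p :: l) σ = runBlock l (Function.update σ p.1 (p.2.eval σ)) := rfl

theorem runBlock_of_notMem {j : ℕ} (l : List (ℕ × Ex)) (σ : ℕ → ℤ) (h : ∀ p ∈ l, p.1 ≠ j) :
    runBlock l σ j = σ j := by
  induction l generalizing σ with
  | nil => rfl
  | cons p l ih =>
    rw [runBlock_cons, ih _ fun q hq => h q (List.mem_cons_of_mem _ hq),
      Function.update_of_ne (h p List.mem_cons_self).symm]

/-! ### The greatest common divisor -/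

/-- The extended Euclidean algorithm for the registers `1` and `2`: the greatest common divisor
goes to register `11`, a coefficient to register `13`. -/
def gcdProg : Prog :=
  block [(11, reg 1), (12, reg 2 - reg 2 / reg 1 * reg 1), (13, lit 0), (14, lit 1)] <|
    .loop 12 <| block [(16, reg 11 - reg 11 / reg 12 * reg 12), (17, reg 13 - reg 11 / reg 12 * reg 14),
      (17, reg 17 - reg 17 / reg 1 * reg 1), (11, reg 12), (12, reg 16), (13, reg 14), (14, reg 17)]
        skip

/-- The invariant of `gcdProg`. -/
structure IsGcdState (a b : ℤ) (k : ℕ) (r₀ r₁ v₀ v₁ : ℤ) : Prop where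
  gcd_eq : Int.gcd r₀ r₁ = Int.gcd a b
  dvd₀ : a ∣ r₀ - v₀ * b
  dvd₁ : a ∣ r₁ - v₁ * b
  nonneg₀ : 0 ≤ v₀
  nonneg₁ : 0 ≤ v₁
  le₀ : v₀ ≤ a
  le₁ : v₁ ≤ a
  nonneg : 0 ≤ r₁
  lt : r₁ < r₀
  le : r₀ ≤ a
  pow_le : 2 ^ k * (r₀ * r₁) ≤ a ^ 2

theorem isGcdState_zero {a b : ℤ} (ha : 0 < a) : IsGcdState a b 0 a (b - b / a * a) 0 1 := by
  have hm : b - b / a * a = b % a := by rw [Int.emod_def]; ring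
  rw [hm]
  have h1 := Int.emod_nonneg b ha.ne'
  have h2 := Int.emod_lt_of_pos b ha
  refine ⟨?_, ?_, ?_, le_rfl, by norm_num, ha.le, by linarith, h1, h2, le_rfl, ?_⟩
  · rw [Int.gcd_comm, Int.gcd_emod, Int.gcd_comm]
  · simp
  · refine ⟨-(b / a), ?_⟩
    rw [Int.emod_def]; ring
  · rw [pow_zero, one_mul, pow_two]
    exact mul_le_mul_of_nonneg_left h2.le ha.le

/-- The remainder is at most r₀/2, so the product of consecutive remainders at least halves, and the
number of steps is logarithmic. Only the congruence r ≡ vb mod a is needed, so the coefficients may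
be reduced modulo a and stay small. -/
theorem IsGcdState.step {a b : ℤ} {k : ℕ} {r₀ r₁ v₀ v₁ : ℤ} (h : IsGcdState a b k r₀ r₁ v₀ v₁)
    (hr : 0 < r₁) : IsGcdState a b (k + 1) r₁ (r₀ - r₀ / r₁ * r₁) v₁
      ((v₀ - r₀ / r₁ * v₁) - (v₀ - r₀ / r₁ * v₁) / a * a) := by
  have ha : 0 < a := by linarith [h.lt, h.le]
  have hm : r₀ - r₀ / r₁ * r₁ = r₀ % r₁ := by rw [Int.emod_def]; ring
  have hm' : ∀ z, z - z / a * a = z % a := fun z => by rw [Int.emod_def]; ring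
  have h1 := Int.emod_nonneg r₀ hr.ne'
  have h2 := Int.emod_lt_of_pos r₀ hr
  refine ⟨?_, h.dvd₁, ?_, h.nonneg₁, ?_, h.le₁, ?_, by rwa [hm], by rwa [hm],
    by linarith [h.lt, h.le], ?_⟩
  · rw [hm, Int.gcd_comm, Int.gcd_emod, h.gcd_eq]
  · obtain ⟨x, hx⟩ := h.dvd₀
    obtain ⟨y, hy⟩ := h.dvd₁
    refine ⟨x - r₀ / r₁ * y + (v₀ - r₀ / r₁ * v₁) / a * b, ?_⟩
    linear_combination hx - r₀ / r₁ * hy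
  · rw [hm']; exact Int.emod_nonneg _ ha.ne'
  · rw [hm']; exact (Int.emod_lt_of_pos _ ha).le
  · have h3 : 1 ≤ r₀ / r₁ := (Int.le_ediv_iff_mul_le hr).2 (by linarith [h.lt])
    have h4 : 2 * (r₀ - r₀ / r₁ * r₁) ≤ r₀ := by
      have : r₁ ≤ r₀ / r₁ * r₁ := le_mul_of_one_le_left hr.le h3
      linarith
    refine le_trans ?_ h.pow_le
    rw [pow_succ, mul_assoc]
    refine mul_le_mul_of_nonneg_left ?_ (by positivity)
    nlinarith

theorem gcdProg_tri {b : ℕ} (hb : 5 ≤ b) {M : ℤ} (hM : 32 ≤ M) (hMb : M ^ 10 ≤ 2 ^ b) {σ : ℕ → ℤ}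
    (h1 : 0 < σ 1) (h1M : σ 1 ≤ M) (h2M : |σ 2| ≤ M) :
    Tri b (9 * b + 20) gcdProg σ (fun τ => τ 11 = Int.gcd (σ 1) (σ 2) ∧
      σ 1 ∣ τ 11 - τ 13 * σ 2 ∧ 0 ≤ τ 13 ∧ τ 13 ≤ σ 1 ∧
      ∀ j, (j < 11 ∨ 17 < j) → j < 63 → τ j = σ j) := by
  have h1a : |σ 1| ≤ M := by rwa [abs_of_pos h1]
  refine (Tri.block hb hM hMb _ (levOf [1, 2]) (lev_levOf _ (by simp [h1a, h2M])) (by decide)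
    fun _ => (Tri.loop (K := b + 1) (N := 8) hb (by norm_num) (fun k τ =>
      IsGcdState (σ 1) (σ 2) k (τ 11) (τ 12) (τ 13) (τ 14) ∧
        ∀ j, (j < 11 ∨ 17 < j) → j < 63 → τ j = σ j) ?_ ?_ ?_).mono le_rfl ?_).mono
          (by simp only [List.length_cons, List.length_nil]; omega) (fun _ _ h => h)
  · refine ⟨?_, fun j hj _ => runBlock_of_notMem _ _ ?_⟩
    · simp only [runBlock_cons, runBlock_nil, Ex.eval_sub, Ex.eval_mul, Ex.eval_div, Ex.eval_reg,
        Function.update_apply]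
      exact isGcdState_zero h1
    · simp only [List.forall_mem_cons, List.not_mem_nil, false_imp_iff, implies_true, and_true]
      omega
  · rintro k τ - ⟨h, -⟩ hp
    have h3 : (2 : ℤ) ^ k ≤ 2 ^ b := by
      have h4 : 1 ≤ τ 11 * τ 12 := by nlinarith [h.lt]
      have h5 : σ 1 ^ 2 ≤ M ^ 10 := (pow_le_pow_left₀ h1.le h1M 2).trans
        (pow_le_pow_right₀ (by linarith) (by norm_num))
      have h6 : (2 : ℤ) ^ k ≤ 2 ^ k * (τ 11 * τ 12) := le_mul_of_one_le_right (by positivity) h4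
      linarith [h.pow_le]
    have := (pow_le_pow_iff_right₀ (by norm_num : (1 : ℤ) < 2)).1 h3
    omega
  · rintro k τ - ⟨h, hf⟩ hp
    have e1 : τ 1 = σ 1 := hf 1 (by norm_num) (by norm_num)
    have hle : ∀ z : ℤ, 0 ≤ z → z ≤ σ 1 → |z| ≤ M := fun z h0 hz => by
      rw [abs_of_nonneg h0]; exact hz.trans h1M
    refine Tri.block hb hM hMb _ (levOf [1, 11, 12, 13, 14]) (lev_levOf _ ?_) (by decide)
      fun _ => Tri.skip hb ⟨?_, fun j hj hj' => ?_⟩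
    · simp only [List.forall_mem_cons, List.not_mem_nil, false_imp_iff, implies_true, and_true]
      have := h.lt
      have := h.le
      exact ⟨by rwa [e1], hle _ (by linarith) h.le, hle _ hp.le (by linarith),
        hle _ h.nonneg₀ h.le₀, hle _ h.nonneg₁ h.le₁⟩
    · have := h.step hp
      simp only [runBlock_cons, runBlock_nil, Ex.eval_sub, Ex.eval_mul, Ex.eval_div, Ex.eval_reg,
        Ex.eval_lit, Function.update_apply]
      simpa [e1] using this
    · rw [Function.update_of_ne (by omega), runBlock_of_notMem _ _ ?_, hf j hj hj']
      simp only [List.forall_mem_cons, List.not_mem_nil, false_imp_iff, implies_true, and_true]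
      omega
  · rintro τ - ⟨⟨k, -, h, hf⟩, hle⟩
    have h0 : τ 12 = 0 := le_antisymm hle h.nonneg
    refine ⟨?_, h.dvd₀, h.nonneg₀, h.le₀, hf⟩
    rw [← h.gcd_eq, h0, Int.gcd_zero_right]
    have := h.lt
    rw [Int.natCast_natAbs, abs_of_pos (by omega)]

/-! ### The search -/

/-- The test in the search. -/
theorem flag_pos_iff {d : ℕ} [NonsquareRat d] {A₀ B₀ G x y : ℤ} (hA₀ : 0 < A₀) (hG : 1 ≤ G)
    (hy : 1 ≤ y) {f : ℕ} (hf : f = Nat.sqrt (y.natAbs ^ 2 * disc d)) {N L : ℤ}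
    (hN : N = 2 * A₀ * x + y * B₀ + f) (hL : L = 2 * A₀ * G) :
    0 < (L - N) * (N + L + 1) ↔ |val (latElt d A₀ B₀ x y)| ≤ G := by
  have hS := sqrt_disc_pos (d := d)
  have hS2 := sqrt_disc_sq d
  set S := √(disc d : ℝ) with hSdef
  have hyR : (1 : ℝ) ≤ y := by exact_mod_cast hy
  have hnat : ((y.natAbs : ℕ) : ℝ) = y := by
    rw [Nat.cast_natAbs, abs_of_pos (by omega : 0 < y)]
  have hX : ((y.natAbs ^ 2 * disc d : ℕ) : ℝ) = (y * S) ^ 2 := by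
    push_cast
    rw [hnat, mul_pow, hS2]
  have hf1 : (f : ℝ) ≤ y * S := by
    have h1 : f ^ 2 ≤ y.natAbs ^ 2 * disc d := by rw [hf]; exact Nat.sqrt_le' _
    have h2 : (f : ℝ) ^ 2 ≤ (y * S) ^ 2 := by rw [← hX]; exact_mod_cast h1
    exact abs_le_of_sq_le_sq' h2 (by positivity) |>.2
  have hf2 : (y : ℝ) * S < f + 1 := by
    have h1 : y.natAbs ^ 2 * disc d < (f + 1) ^ 2 := by rw [hf]; exact Nat.lt_succ_sqrt' _
    have h2 : (y * S) ^ 2 < ((f : ℝ) + 1) ^ 2 := by rw [← hX]; exact_mod_cast h1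
    exact lt_of_pow_lt_pow_left₀ 2 (by positivity) h2
  have hne : ∀ z : ℤ, (z : ℝ) ≠ y * S := fun z => intCast_ne_mul_sqrt_disc (by omega)
  have hA₀' : (0 : ℝ) < A₀ := by exact_mod_cast hA₀
  have hval : val (latElt d A₀ B₀ x y) = (2 * A₀ * x + y * B₀ + y * S) / (2 * A₀) := by
    simp only [latElt, val_add, val_mul, val_intCast, val_quadIrr]
    rw [← hSdef]
    field_simp
    ring
  have hL0 : 0 < L := by rw [hL]; positivity
  have hLR : (L : ℝ) = 2 * A₀ * G := by rw [hL]; push_cast; ring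
  have hNR : (N : ℝ) = 2 * A₀ * x + y * B₀ + f := by rw [hN]; push_cast; ring
  -- N is the integer part of the irrational number 2A₀(x + yθ₀), and L = 2A₀G. Hence |x + yθ₀| ≤ G
  -- means -L ≤ N < L, which a single product of two integers tests.
  have hiff : |val (latElt d A₀ B₀ x y)| ≤ G ↔ -L ≤ N ∧ N < L := by
    rw [hval, abs_div, abs_of_pos (by positivity : (0 : ℝ) < 2 * A₀), div_le_iff₀ (by positivity),
      mul_comm (G : ℝ), ← hLR, abs_le]
    constructor
    · rintro ⟨h1, h2⟩
      constructor
      · have : (-L : ℝ) < N + 1 := by rw [hNR]; linarith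
        have : -L < N + 1 := by exact_mod_cast this
        omega
      · have h3 := hne (L - N + f)
        push_cast at h3
        have : (N : ℝ) < L := by
          rcases lt_or_eq_of_le hf1 with h | h
          · linarith
          · exact absurd h (hne f)
        exact_mod_cast this
    · rintro ⟨h1, h2⟩
      have h1' : (-L : ℝ) ≤ N := by exact_mod_cast h1
      have h2' : (N : ℝ) + 1 ≤ L := by exact_mod_cast h2
      constructor <;> linarith
  rw [hiff]
  constructor
  · intro h
    rcases mul_pos_iff.1 h with ⟨h1, h2⟩ | ⟨h1, h2⟩
    · constructor <;> omega
    · omega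
  · rintro ⟨h1, h2⟩
    exact mul_pos (by omega) (by omega)

/-- A version free of case distinctions, for use in an expression: (-1) / (2C) is -1 for C > 0 and 1
for C < 0, so the subtracted term is 0 or 1. -/
theorem partialQuot_eq {s B C : ℤ} (hC : C ≠ 0) :
    partialQuot s B C = (B + s) / (2 * C) - ((0 - 1) / (2 * C) + 1) / 2 := by
  unfold partialQuot
  rcases lt_or_gt_of_ne hC with h | h
  · have : (0 - 1 : ℤ) / (2 * C) = 1 := by
      have h1 : (0 - 1 : ℤ) / (-(2 * C)) = -1 := by
        rw [Int.ediv_eq_iff_of_pos (by omega)]; omega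
      rw [Int.ediv_neg] at h1
      omega
    rw [this, if_neg (by omega)]
    norm_num
  · have : (0 - 1 : ℤ) / (2 * C) = -1 := by
      rw [Int.ediv_eq_iff_of_pos (by omega)]; omega
    rw [this, if_pos h]
    norm_num

/-- Registers `0`, `10`, `11`, `20`, `21` hold `D`, its integer square root, `G`, `A₀` and `B₀`. The
search leaves the standard form of the result in registers `23` and `24`, and the coordinates of the
minimum in registers `26` and `27`. -/
def searchProg : Prog :=
  block [(23, reg 20), (24, reg 21), (25, (reg 0 - reg 21 * reg 21) / (lit 4 * reg 20)), (26, lit 1),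
    (27, lit 0), (28, lit 0), (29, lit 1), (30, lit 1)] <|
  .loop 30 <|
    block [
      (31, (reg 24 + reg 10) / (lit 2 * reg 25) - ((lit 0 - lit 1) / (lit 2 * reg 25) + lit 1) / lit 2),
      (33, reg 24), (34, reg 23), (23, reg 25), (24, lit 2 * reg 25 * reg 31 - reg 33),
      (25, reg 34 + reg 31 * reg 33 - reg 25 * reg 31 * reg 31),
      (35, reg 26), (26, reg 28), (28, reg 35 + reg 31 * reg 28),
      (36, reg 27), (27, reg 29), (29, reg 36 + reg 31 * reg 29), (40, reg 27 * reg 27 * reg 0)] <|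
    .seq sqrtProg <|
    block [(37, lit 2 * reg 20 * reg 26 + reg 27 * reg 21 + reg 41), (38, lit 2 * reg 20 * reg 11),
      (30, (reg 38 - reg 37) * (reg 37 + reg 38 + lit 1))] skip

theorem searchProg_tri {d : ℕ} [NonsquareRat d] {b : ℕ} (hb : 5 ≤ b)
    (hDb : (disc d : ℤ) ^ 200 ≤ 2 ^ b) {σ : ℕ → ℤ} {C : ℤ}
    (h₀ : IsSearchData d (σ 20) (σ 21) (σ 11)) (hD5 : 5 ≤ disc d) (hσ0 : σ 0 = disc d)
    (hσ10 : σ 10 = Nat.sqrt (disc d)) (hC : (disc d : ℤ) = σ 21 ^ 2 + 4 * σ 20 * C) :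
    Tri b ((b + 2) * (3 * b + 40)) searchProg σ (fun τ =>
      (∃ k, IsSearch d (σ 20) (σ 21) (σ 11) k (τ 23) (τ 24) (τ 25) (τ 26) (τ 27) (τ 28) (τ 29)) ∧
      (σ 11 : ℝ) < |val (latElt d (σ 20) (σ 21) (τ 26) (τ 27))| ∧
      ∀ j, (j < 23 ∨ 42 < j) → j < 63 → τ j = σ j) := by
  obtain ⟨D, hD⟩ : ∃ D : ℤ, D = disc d := ⟨_, rfl⟩
  have hD5' : 5 ≤ D := by rw [hD]; exact_mod_cast hD5
  rw [← hD] at hDb hσ0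
  have hM : 32 ≤ D ^ 5 := by
    calc (32 : ℤ) ≤ 5 ^ 5 := by norm_num
      _ ≤ _ := pow_le_pow_left₀ (by norm_num) hD5' 5
  -- M = D⁵ dominates the state of the search, whose entries are at most 3D⁴ inside the loop, and is
  -- at least 32 because D ≥ 5. Values within one pass stay below M⁴⁰ = D²⁰⁰.
  have hMb : (D ^ 5) ^ 40 ≤ 2 ^ b := by rw [← pow_mul]; exact hDb
  have hpow : ∀ i ≤ 5, D ^ i ≤ D ^ 5 := fun i hi => pow_le_pow_right₀ (by linarith) hi
  have h1D : D ≤ D ^ 5 := by simpa using hpow 1 (by norm_num)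
  have h23 : 5 * D ^ 2 ≤ D ^ 3 := by nlinarith [sq_nonneg D]
  have h45 : 5 * D ^ 4 ≤ D ^ 5 := by
    have := pow_pos (show 0 < D by linarith) 4
    nlinarith
  have h24 : D ^ 2 ≤ D ^ 4 := pow_le_pow_right₀ (by linarith) (by norm_num)
  have h35 := hpow 3 (by norm_num)
  have h25 := hpow 2 (by norm_num)
  have hA₀M : |σ 20| ≤ D ^ 5 := by
    rw [abs_of_pos h₀.pos]; have := h₀.le_disc; rw [← hD] at this; linarith
  have hGM : |σ 11| ≤ D ^ 5 := by
    rw [abs_of_pos (by linarith [h₀.one_le])]; have := h₀.le_disc'; rw [← hD] at this; linarith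
  have hDM : |D| ≤ D ^ 5 := by rwa [abs_of_pos (by linarith)]
  have hsM : |(Nat.sqrt (disc d) : ℤ)| ≤ D ^ 5 := by
    rw [abs_of_nonneg (Int.natCast_nonneg _)]
    have : (Nat.sqrt (disc d) : ℤ) ≤ disc d := by exact_mod_cast Nat.sqrt_le_self _
    rw [← hD] at this; linarith
  have hinit := h₀.init hC
  have hG1 : |val (latElt d (σ 20) (σ 21) 1 0)| ≤ σ 11 := by
    rw [latElt_one, val_one, abs_one]; exact_mod_cast h₀.one_le
  have hB₀M : |σ 21| ≤ D ^ 5 := by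
    have := (hinit.bounds h₀ hG1).2.1
    rw [← hD] at this
    have h0 : 0 ≤ D ^ 2 := sq_nonneg D
    linarith
  have hCeq : (D - σ 21 * σ 21) / (4 * σ 20) = C := by
    have h4 : 0 < 4 * σ 20 := by have := h₀.pos; omega
    rw [hD, hC]
    have : σ 21 ^ 2 + 4 * σ 20 * C - σ 21 * σ 21 = 4 * σ 20 * C := by ring
    rw [this, Int.mul_ediv_cancel_left _ h4.ne']
  refine (Tri.block hb hM hMb _ (levOf [0, 20, 21]) (lev_levOf _ (by simp [hA₀M, hB₀M, hσ0, hDM]))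
    (by decide) fun _ => (Tri.loop (K := b + 1) (N := 3 * b + 23) hb (by norm_num) (fun k τ =>
      IsSearch d (σ 20) (σ 21) (σ 11) k (τ 23) (τ 24) (τ 25) (τ 26) (τ 27) (τ 28) (τ 29) ∧
      (0 < τ 30 ↔ |val (latElt d (σ 20) (σ 21) (τ 26) (τ 27))| ≤ σ 11) ∧
      ∀ j, (j < 23 ∨ 42 < j) → j < 63 → τ j = σ j) ?_ ?_ ?_).mono le_rfl ?_).mono
          (by simp only [List.length_cons, List.length_nil]; nlinarith) (fun _ _ h => h)
  · refine ⟨?_, ?_, fun j hj _ => runBlock_of_notMem _ _ ?_⟩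
    · simp only [runBlock_cons, runBlock_nil, Ex.eval_sub, Ex.eval_mul, Ex.eval_div, Ex.eval_reg,
        Ex.eval_lit, Function.update_apply]
      simpa [hσ0, hCeq] using hinit
    · simp only [runBlock_cons, runBlock_nil, Ex.eval_sub, Ex.eval_mul, Ex.eval_div, Ex.eval_reg,
        Ex.eval_lit, Function.update_apply]
      simpa using hG1
    · simp only [List.forall_mem_cons, List.not_mem_nil, false_imp_iff, implies_true, and_true]
      omega
  · rintro k τ - ⟨h, hfl, -⟩ hp
    have h1 := (h.bounds h₀ (hfl.1 hp)).2.2.2.1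
    rw [← hD] at h1
    -- While the loop runs, y ≤ D², so 2^k ≤ 8D⁴ + 1. This gives the bound for the number of passes.
    have h2 : (2 : ℤ) ^ k ≤ 2 ^ b := by
      have h3 : τ 27 ^ 2 ≤ (D ^ 2) ^ 2 := pow_le_pow_left₀ h.nonneg h1 2
      have h4 : (D ^ 2) ^ 2 = D ^ 4 := by ring
      have h5 : 1 ≤ D ^ 4 := one_le_pow₀ (by linarith)
      have h6 : 2 * D ^ 5 ≤ D ^ 200 := by
        calc 2 * D ^ 5 ≤ D * D ^ 5 := by gcongr; linarith
          _ = D ^ 6 := by ring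
          _ ≤ _ := pow_le_pow_right₀ (by linarith) (by norm_num)
      have := h.pow_le'
      nlinarith
    have := (pow_le_pow_iff_right₀ (by norm_num : (1 : ℤ) < 2)).1 h2
    omega
  · rintro k τ - ⟨h, hfl, hf⟩ hp
    have hG := hfl.1 hp
    obtain ⟨b1, b2, b3, b4, b5, b6⟩ := h.bounds h₀ hG
    rw [← hD] at b1 b2 b3 b4 b5
    have e0 : τ 0 = D := by rw [hf 0 (by norm_num) (by norm_num), hσ0]
    have e10 : τ 10 = Nat.sqrt (disc d) := by rw [hf 10 (by norm_num) (by norm_num), hσ10]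
    have e11 : τ 11 = σ 11 := hf 11 (by norm_num) (by norm_num)
    have e20 : τ 20 = σ 20 := hf 20 (by norm_num) (by norm_num)
    have e21 : τ 21 = σ 21 := hf 21 (by norm_num) (by norm_num)
    have hx := h₀.abs_coeff_le h.conj_le
    have hx' := h₀.abs_coeff_le b6
    have hy := h.nonneg
    have hy' := h.one_le
    rw [abs_of_nonneg hy] at hx
    rw [abs_of_nonneg (show 0 ≤ τ 29 by linarith)] at hx'
    have h5D : 25 ≤ D ^ 2 := by nlinarith
    have hlev : Lev (D ^ 5) (levOf [0, 10, 11, 20, 21, 23, 24, 25, 26, 27, 28, 29]) τ := by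
      refine lev_levOf _ ?_
      simp only [List.forall_mem_cons, List.not_mem_nil, false_imp_iff, implies_true, and_true]
      rw [e0, e10, e11, e20, e21, abs_of_nonneg hy, abs_of_nonneg (show 0 ≤ τ 29 by linarith)]
      refine ⟨hDM, hsM, hGM, hA₀M, hB₀M, ?_, ?_, ?_, ?_, ?_, ?_, ?_⟩ <;> linarith
    obtain ⟨q, hq⟩ : ∃ q, q = partialQuot (Nat.sqrt (disc d)) (τ 24) (τ 25) := ⟨_, rfl⟩
    have hstep := h.step h₀ hG hq
    rw [partialQuot_eq h.isCF.ne_zero'.2] at hq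
    refine (Tri.block (N := 3 * b + 10) hb hM hMb _ _ hlev (by decide) fun hlev' => ?_).mono
      (by simp only [List.length_cons, List.length_nil]; omega) (fun _ _ h => h)
    set υ := runBlock _ τ with hυ
    have hfυ : ∀ j, (j < 23 ∨ 42 < j) → j < 63 → υ j = σ j := fun j hj hj' => by
      rw [hυ, runBlock_of_notMem _ _ ?_, hf j hj hj']
      simp only [List.forall_mem_cons, List.not_mem_nil, false_imp_iff, implies_true, and_true]
      omega
    have hv : υ 23 = τ 25 ∧ υ 24 = 2 * τ 25 * q - τ 24 ∧
        υ 25 = τ 23 + q * τ 24 - τ 25 * q ^ 2 ∧ υ 26 = τ 28 ∧ υ 27 = τ 29 ∧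
        υ 28 = τ 26 + q * τ 28 ∧ υ 29 = τ 27 + q * τ 29 ∧
        υ 40 = τ 29 * τ 29 * D := by
      rw [hυ]
      simp only [runBlock_cons, runBlock_nil, Ex.eval_sub, Ex.eval_add, Ex.eval_mul, Ex.eval_div,
        Ex.eval_reg, Ex.eval_lit, Function.update_apply]
      simp [e0, e10, hq, pow_two, mul_assoc]
    obtain ⟨v23, v24, v25, v26, v27, v28, v29, v40⟩ := hv
    have hX : υ 40 = ((υ 27).natAbs ^ 2 * disc d : ℕ) := by
      rw [v40, v27, hD]; push_cast; rw [sq_abs]; ring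
    have hlev40 : |υ 40| ≤ (D ^ 5) ^ 3 := hlev' 40 (by decide)
    have hl26 : |υ 26| ≤ (D ^ 5) ^ 1 := hlev' 26 (by decide)
    have hl27 : |υ 27| ≤ (D ^ 5) ^ 1 := hlev' 27 (by decide)
    refine (Tri.seq (N := 3 * b + 6) (M := 4) (sqrtProg_tri hb hX) ?_)
    rintro ρ ⟨hρ41, hρ⟩
    have r20 : ρ 20 = σ 20 := by
      rw [hρ 20 (by norm_num) (by norm_num), hfυ 20 (by norm_num) (by norm_num)]
    have r21 : ρ 21 = σ 21 := by
      rw [hρ 21 (by norm_num) (by norm_num), hfυ 21 (by norm_num) (by norm_num)]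
    have r11 : ρ 11 = σ 11 := by
      rw [hρ 11 (by norm_num) (by norm_num), hfυ 11 (by norm_num) (by norm_num)]
    have r26 : ρ 26 = υ 26 := hρ 26 (by norm_num) (by norm_num)
    have r27 : ρ 27 = υ 27 := hρ 27 (by norm_num) (by norm_num)
    refine (Tri.block (N := 1) (M := D ^ 5) (w := 40) hb hM hMb _
      (fun i => if i = 41 then 3 else levOf [11, 20, 21, 26, 27] i) ?_ (by decide) fun _ =>
        Tri.skip hb ?_)
    · intro i hi
      by_cases h41 : i = 41
      · subst h41
        simp only [if_true]
        refine le_trans ?_ hlev40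
        rw [hρ41, hX, Nat.abs_cast, Nat.abs_cast]
        exact_mod_cast Nat.sqrt_le_self _
      · simp only [h41, if_false] at hi ⊢
        refine lev_levOf (M := D ^ 5) [11, 20, 21, 26, 27] ?_ i hi
        simp only [List.forall_mem_cons, List.not_mem_nil, false_imp_iff, implies_true, and_true]
        rw [r11, r20, r21, r26, r27]
        exact ⟨hGM, hA₀M, hB₀M, by simpa using hl26, by simpa using hl27⟩
    · have hfr : ∀ j, j ≠ 37 → j ≠ 38 → j ≠ 30 → j ≠ 41 → j ≠ 42 → j < 63 →
          Function.update (runBlock [(37, lit 2 * reg 20 * reg 26 + reg 27 * reg 21 + reg 41),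
            (38, lit 2 * reg 20 * reg 11), (30, (reg 38 - reg 37) * (reg 37 + reg 38 + lit 1))] ρ)
              63 0 j = υ j := fun j h1 h2 h3 h4 h5 h6 => by
        rw [Function.update_of_ne (by omega), runBlock_of_notMem _ _ ?_, hρ j h4 h5]
        simp only [List.forall_mem_cons, List.not_mem_nil, false_imp_iff, implies_true, and_true]
        omega
      have hflag : Function.update (runBlock [(37, lit 2 * reg 20 * reg 26 + reg 27 * reg 21 + reg 41),
            (38, lit 2 * reg 20 * reg 11), (30, (reg 38 - reg 37) * (reg 37 + reg 38 + lit 1))] ρ)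
              63 0 30 = (2 * σ 20 * σ 11 - (2 * σ 20 * υ 26 + υ 27 * σ 21 + ρ 41)) *
                ((2 * σ 20 * υ 26 + υ 27 * σ 21 + ρ 41) + 2 * σ 20 * σ 11 + 1) := by
        simp only [runBlock_cons, runBlock_nil, Ex.eval_sub, Ex.eval_add, Ex.eval_mul,
          Ex.eval_reg, Ex.eval_lit, Function.update_apply]
        simp [r20, r21, r26, r27, r11]
      refine ⟨?_, ?_, fun j hj hj' => ?_⟩
      · rw [hfr 23, hfr 24, hfr 25, hfr 26, hfr 27, hfr 28, hfr 29, v23, v24, v25, v26, v27, v28,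
          v29]
        · exact hstep
        all_goals norm_num
      · rw [hflag, hfr 26, hfr 27]
        · exact flag_pos_iff h₀.pos h₀.one_le (by rw [v27]; exact h.one_le) rfl
            (by rw [hρ41]) rfl
        all_goals norm_num
      · rw [hfr j (by omega) (by omega) (by omega) (by omega) (by omega) hj', hfυ j hj hj']
  · rintro τ - ⟨⟨k, -, h, hfl, hf⟩, hle⟩
    exact ⟨⟨k, h⟩, not_le.1 fun h => absurd (hfl.2 h) (not_lt.2 hle), hf⟩

/-! ### The logarithm -/

/-- The map w ↦ √(wW) takes the square root of the ratio w/W. Rounding up adds at most 1/W to a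
ratio that is at least 1, hence at most 1/W to its logarithm. -/
theorem log_sqrt_step {W w w' : ℝ} (hW : 0 < W) (hw : W ≤ w) (h1 : √(w * W) ≤ w')
    (h2 : w' ≤ √(w * W) + 1) :
    Real.log (w / W) ≤ 2 * Real.log (w' / W) ∧
      2 * Real.log (w' / W) ≤ Real.log (w / W) + 2 / W := by
  have hr : 1 ≤ w / W := by rwa [le_div_iff₀ hW, one_mul]
  obtain ⟨s, hs⟩ : ∃ s, s = √(w / W) := ⟨_, rfl⟩
  have hs1 : 1 ≤ s := by rw [hs]; exact Real.one_le_sqrt.2 hr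
  have hsW : √(w * W) = s * W := by
    have : w * W = (w / W) * W ^ 2 := by field_simp
    rw [this, Real.sqrt_mul (by linarith), Real.sqrt_sq hW.le, hs]
  have hlog : Real.log (w / W) = 2 * Real.log s := by
    rw [hs, Real.log_sqrt (by linarith)]; ring
  rw [hsW] at h1 h2
  have h3 : s ≤ w' / W := by rwa [le_div_iff₀ hW]
  have h4 : w' / W ≤ s + 1 / W := by
    rw [div_le_iff₀ hW, add_mul, one_div, inv_mul_cancel₀ hW.ne']; exact h2
  rw [hlog]
  refine ⟨mul_le_mul_of_nonneg_left (Real.log_le_log (by linarith) h3) (by norm_num), ?_⟩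
  have h5 : Real.log (w' / W) - Real.log s ≤ 1 / W := by
    rw [← Real.log_div (by linarith) (by linarith)]
    refine (Real.log_le_sub_one_of_pos (div_pos (by linarith) (by linarith))).trans ?_
    rw [sub_le_iff_le_add, div_le_iff₀ (by linarith)]
    have : 0 < 1 / W := by positivity
    nlinarith
  have : 2 / W = 2 * (1 / W) := by ring
  rw [this]
  linarith

/-- For t = ln r in [0, 1], t ≤ r - 1 ≤ t + t². As 2^J t is at most l + 1, the quadratic term
contributes at most 2^E(l + 1)²/2^J ≤ 1/4; the choice of J rests on (l + 1)² ≤ 2^(2l). The factor 16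
in W keeps the accumulated rounding error below 1/4 as well. -/
theorem log_scaled_bounds {L r W : ℝ} {J E l : ℕ} (hJ : J = E + 2 * l + 20)
    (hW : W = 2 ^ (J + E + 4)) (hr : 1 ≤ r) (h1 : L ≤ 2 ^ J * Real.log r)
    (h2 : 2 ^ J * Real.log r ≤ L + (2 + 2 ^ (J + 1)) / W) (hL : L ≤ l) :
    2 ^ E * L ≤ W * (r - 1) / 16 ∧ W * (r - 1) / 16 ≤ 2 ^ E * L + 1 / 2 := by
  obtain ⟨t, ht⟩ : ∃ t, t = Real.log r := ⟨_, rfl⟩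
  rw [← ht] at h1 h2
  have hrt : r = Real.exp t := by rw [ht, Real.exp_log (by linarith)]
  have ht0 : 0 ≤ t := by rw [ht]; exact Real.log_nonneg hr
  have hJp : (0 : ℝ) < 2 ^ J := by positivity
  have hEp : (0 : ℝ) < 2 ^ E := by positivity
  have hW' : W = 2 ^ J * 2 ^ E * 16 := by rw [hW, pow_add, pow_add]; norm_num
  have hJ1 : (2 : ℝ) ≤ 2 ^ J := by
    calc (2 : ℝ) = 2 ^ 1 := by norm_num
      _ ≤ _ := pow_le_pow_right₀ (by norm_num) (by omega)
  have hE1 : (1 : ℝ) ≤ 2 ^ E := one_le_pow₀ (by norm_num)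
  have hfrac : 2 ^ E * ((2 + 2 ^ (J + 1)) / W) ≤ 1 / 4 := by
    rw [hW', mul_div_assoc', div_le_iff₀ (by positivity), pow_succ]
    nlinarith
  have hfrac' : (2 + 2 ^ (J + 1)) / W ≤ 1 := by
    have h0 : 0 ≤ (2 + 2 ^ (J + 1)) / W := by rw [hW']; positivity
    nlinarith
  have hl : (2 : ℝ) ^ J * t ≤ l + 1 := by linarith
  have hlpow : ((l : ℝ) + 1) ≤ 2 ^ l := by exact_mod_cast Nat.lt_two_pow_self
  have hJ2 : (2 : ℝ) ^ J = 2 ^ E * (2 ^ l) ^ 2 * 2 ^ 20 := by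
    rw [hJ, pow_add, pow_add, ← pow_mul, mul_comm l 2]
  have hl0 : (0 : ℝ) < l + 1 := by positivity
  have hsq : ((l : ℝ) + 1) ^ 2 ≤ (2 ^ l) ^ 2 := pow_le_pow_left₀ hl0.le hlpow 2
  have hJl : ((l : ℝ) + 1) ^ 2 * 2 ^ E * 4 ≤ 2 ^ J := by
    rw [hJ2]
    have : (2 : ℝ) ^ E * ((l : ℝ) + 1) ^ 2 ≤ 2 ^ E * (2 ^ l) ^ 2 :=
      mul_le_mul_of_nonneg_left hsq hEp.le
    nlinarith
  have ht1 : t ≤ 1 := by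
    have : (l : ℝ) + 1 ≤ 2 ^ J := by nlinarith
    by_contra h
    push Not at h
    nlinarith
  have he1 : t ≤ r - 1 := by rw [hrt]; linarith [Real.add_one_le_exp t]
  have he2 : r - 1 ≤ t + t ^ 2 := by
    have := Real.abs_exp_sub_one_sub_id_le (x := t) (by rw [abs_of_nonneg ht0]; exact ht1)
    rw [hrt]
    linarith [(abs_le.1 this).2]
  have hWr : W * (r - 1) / 16 = 2 ^ E * (2 ^ J * (r - 1)) := by rw [hW']; ring
  rw [hWr]
  constructor
  · refine mul_le_mul_of_nonneg_left (h1.trans ?_) hEp.le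
    exact mul_le_mul_of_nonneg_left he1 hJp.le
  · have h3 : 2 ^ J * (r - 1) ≤ 2 ^ J * t + 2 ^ J * t ^ 2 := by
      rw [← mul_add]; exact mul_le_mul_of_nonneg_left he2 hJp.le
    have h4 : 2 ^ E * (2 ^ J * t ^ 2) ≤ 1 / 4 := by
      have h5 : (2 ^ J * t) ^ 2 ≤ ((l : ℝ) + 1) ^ 2 :=
        pow_le_pow_left₀ (mul_nonneg hJp.le ht0) hl 2
      have h6 : 2 ^ J * (2 ^ E * (2 ^ J * t ^ 2)) ≤ 2 ^ J * (1 / 4) := by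
        calc (2 : ℝ) ^ J * (2 ^ E * (2 ^ J * t ^ 2)) = 2 ^ E * (2 ^ J * t) ^ 2 := by ring
          _ ≤ 2 ^ E * ((l : ℝ) + 1) ^ 2 := mul_le_mul_of_nonneg_left h5 hEp.le
          _ ≤ _ := by linarith
      exact le_of_mul_le_mul_left h6 hJp
    have h5 : 2 ^ E * (2 ^ J * (r - 1)) ≤ 2 ^ E * (2 ^ J * t + 2 ^ J * t ^ 2) :=
      mul_le_mul_of_nonneg_left h3 hEp.le
    have h6 : 2 ^ E * (2 ^ J * t) ≤ 2 ^ E * (L + (2 + 2 ^ (J + 1)) / W) :=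
      mul_le_mul_of_nonneg_left h2 hEp.le
    rw [mul_add] at h5 h6
    linarith

/-- Repeated square roots of register `54`, scaled by register `50`. -/
def rootProg : Prog :=
  .loop 55 <| block [(40, reg 54 * reg 50)] <| .seq sqrtProg <|
    block [(54, reg 41 + lit 1), (55, reg 55 - lit 1)] skip

/-- The scaled rounding errors form a geometric sum: 4/W at the start and 2^(k+1)/W from step k add
up to (2 + 2^(k+1))/W after k steps. Rounding upwards keeps the ratio at least 1, and X ≥ 2 leaves
room for it below WX. -/
theorem rootProg_tri {b : ℕ} (hb : 5 ≤ b) {M : ℤ} (hM : 32 ≤ M) (hMb : M ^ 16 ≤ 2 ^ b) {σ : ℕ → ℤ}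
    {W X : ℤ} {J : ℕ} {L : ℝ} (h50 : σ 50 = W) (hW : 0 < W) (hX : 2 ≤ X) (hWM : W * X ≤ M)
    (h55 : σ 55 = J) (hJb : J ≤ b) (hJM : J ≤ M) (h54 : W ≤ σ 54) (h54' : σ 54 ≤ W * X)
    (hL : L ≤ Real.log (σ 54 / W)) (hL' : Real.log (σ 54 / W) ≤ L + 4 / W) :
    Tri b (b * (3 * b + 11) + 1) rootProg σ (fun τ => W ≤ τ 54 ∧ τ 54 ≤ W * X ∧
      L ≤ 2 ^ J * Real.log (τ 54 / W) ∧
      2 ^ J * Real.log (τ 54 / W) ≤ L + (2 + 2 ^ (J + 1)) / W ∧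
      ∀ j, (j < 40 ∨ 42 < j ∧ j < 54 ∨ 55 < j) → j < 63 → τ j = σ j) := by
  have hWR : (0 : ℝ) < W := by exact_mod_cast hW
  refine (Tri.loop (K := J) (N := 3 * b + 10) hb (by norm_num) (fun k τ => k ≤ J ∧ τ 55 = J - k ∧
    W ≤ τ 54 ∧ τ 54 ≤ W * X ∧ L ≤ 2 ^ k * Real.log (τ 54 / W) ∧
      2 ^ k * Real.log (τ 54 / W) ≤ L + (2 + 2 ^ (k + 1)) / W ∧
      ∀ j, (j < 40 ∨ 42 < j ∧ j < 54 ∨ 55 < j) → j < 63 → τ j = σ j) ?_ ?_ ?_).mono ?_ ?_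
  · refine ⟨Nat.zero_le _, by simp [h55], h54, h54', by simpa using hL, ?_, fun _ _ _ => rfl⟩
    norm_num
    exact hL'
  · rintro k τ - ⟨h1, h2, -⟩ hp
    omega
  · rintro k τ - ⟨h1, h2, h3, h4, h5, h6, hf⟩ hp
    have e50 : τ 50 = W := by rw [hf 50 (by norm_num) (by norm_num), h50]
    have hWX : W ≤ W * X := le_mul_of_one_le_right hW.le (by omega)
    have hlev : Lev M (levOf [50, 54, 55]) τ := by
      refine lev_levOf _ ?_
      simp only [List.forall_mem_cons, List.not_mem_nil, false_imp_iff, implies_true, and_true]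
      rw [e50, abs_of_pos hW, abs_of_pos (by linarith), abs_of_pos hp]
      exact ⟨by linarith, by linarith, by omega⟩
    refine (Tri.block (N := 3 * b + 9) hb hM hMb _ _ hlev (by decide) fun hlev' => ?_)
    have v40 : runBlock [(40, reg 54 * reg 50)] τ 40 = ((τ 54 * W).toNat : ℤ) := by
      rw [Int.toNat_of_nonneg (mul_nonneg (by linarith) hW.le)]
      simp only [runBlock_cons, runBlock_nil, Ex.eval_mul, Ex.eval_reg, Function.update_apply]
      simp [e50]
    have hv : ∀ j, j ≠ 40 → runBlock [(40, reg 54 * reg 50)] τ j = τ j := fun j hj =>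
      runBlock_of_notMem _ _ (by simpa using hj.symm)
    refine (Tri.seq (N := 3 * b + 6) (M := 3) (sqrtProg_tri hb v40) ?_)
    rintro ρ ⟨hρ41, hρ⟩
    have r55 : ρ 55 = τ 55 := by
      rw [hρ 55 (by norm_num) (by norm_num), hv 55 (by norm_num)]
    have hYle : ((τ 54 * W).toNat : ℤ) = τ 54 * W :=
      Int.toNat_of_nonneg (mul_nonneg (by linarith) hW.le)
    have hs1 := Nat.sqrt_le' (τ 54 * W).toNat
    have hs2 := Nat.lt_succ_sqrt' (τ 54 * W).toNat
    set s := Nat.sqrt (τ 54 * W).toNat with hs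
    have hs1' : (s : ℤ) ^ 2 ≤ τ 54 * W := by rw [← hYle]; exact_mod_cast hs1
    have hs2' : τ 54 * W < ((s : ℤ) + 1) ^ 2 := by rw [← hYle]; exact_mod_cast hs2
    have hs0 : (0 : ℤ) ≤ s := Int.natCast_nonneg _
    have hup : (s : ℤ) + 1 ≤ W * X := by
      by_contra hlt
      push Not at hlt
      have h7 : W * X ≤ s := by omega
      have h8 : (W * X) ^ 2 ≤ (s : ℤ) ^ 2 := pow_le_pow_left₀ (by positivity) h7 2
      nlinarith
    have hlow : W ≤ (s : ℤ) + 1 := by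
      have : W ^ 2 ≤ ((s : ℤ) + 1) ^ 2 := by nlinarith
      exact abs_le_of_sq_le_sq' this (by omega) |>.2
    refine (Tri.block (N := 1) (M := M) (w := 16) hb hM hMb _ (levOf [41, 55]) ?_ (by decide)
      fun _ => Tri.skip hb ?_)
    · refine lev_levOf _ ?_
      simp only [List.forall_mem_cons, List.not_mem_nil, false_imp_iff, implies_true, and_true]
      rw [hρ41, r55, abs_of_pos hp, Nat.abs_cast]
      exact ⟨by linarith, by omega⟩
    · have v : Function.update (runBlock [(54, reg 41 + lit 1), (55, reg 55 - lit 1)] ρ) 63 0 54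
          = s + 1 ∧ Function.update (runBlock [(54, reg 41 + lit 1), (55, reg 55 - lit 1)] ρ) 63 0 55
          = τ 55 - 1 := by
        simp only [runBlock_cons, runBlock_nil, Ex.eval_sub, Ex.eval_add, Ex.eval_reg, Ex.eval_lit,
          Function.update_apply]
        simp [hρ41, r55]
      have hfr : ∀ j, (j < 40 ∨ 42 < j ∧ j < 54 ∨ 55 < j) → j < 63 →
          Function.update (runBlock [(54, reg 41 + lit 1), (55, reg 55 - lit 1)] ρ) 63 0 j = σ j :=
        fun j hj hj' => by
        rw [Function.update_of_ne (by omega), runBlock_of_notMem _ _ ?_, hρ j (by omega) (by omega),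
          hv j (by omega), hf j hj hj']
        simp only [List.forall_mem_cons, List.not_mem_nil, false_imp_iff, implies_true, and_true]
        omega
      obtain ⟨v54, v55⟩ := v
      rw [v54, v55]
      have hk := log_sqrt_step (W := (W : ℝ)) (w := (τ 54 : ℝ)) (w' := (s : ℝ) + 1) hWR
        (by exact_mod_cast h3)
        (by
          rw [Real.sqrt_le_left (by positivity)]
          exact_mod_cast hs2'.le)
        (by
          have : (s : ℝ) ≤ √(τ 54 * W) := Real.le_sqrt_of_sq_le (by exact_mod_cast hs1')
          linarith)
      have h2k : (0 : ℝ) < 2 ^ k := by positivity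
      refine ⟨by omega, by push_cast; omega, hlow, hup, ?_, ?_, hfr⟩
      · push_cast
        calc L ≤ _ := h5
          _ ≤ 2 ^ k * (2 * Real.log ((s + 1) / W)) := mul_le_mul_of_nonneg_left hk.1 h2k.le
          _ = _ := by ring
      · push_cast
        calc (2 : ℝ) ^ (k + 1) * Real.log ((s + 1) / W)
            = 2 ^ k * (2 * Real.log ((s + 1) / W)) := by ring
          _ ≤ 2 ^ k * (Real.log (τ 54 / W) + 2 / W) := mul_le_mul_of_nonneg_left hk.2 h2k.le
          _ ≤ L + (2 + 2 ^ (k + 1)) / W + 2 ^ (k + 1) / W := by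
              rw [mul_add]
              have : (2 : ℝ) ^ k * (2 / W) = 2 ^ (k + 1) / W := by ring
              linarith
          _ = _ := by ring
  · have : J * (3 * b + 10 + 1) ≤ b * (3 * b + 11) := Nat.mul_le_mul_right _ hJb
    omega
  · rintro τ - ⟨⟨k, -, h1, h2, h3, h4, h5, h6, hf⟩, hle⟩
    have : k = J := by omega
    subst this
    exact ⟨h3, h4, h5, h6, hf⟩

/-- With `2 ^ (J + E + 4)` in register `50` and `J` in register `51`, register `56` receives an
approximation of `2 ^ E` times the logarithm of the ratio of the minimum found by the search and its
lower bound. -/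
def logProg : Prog :=
  block [(52, lit 2 * reg 20 * reg 26 + reg 27 * reg 21),
    (40, reg 50 * reg 50 * reg 27 * reg 27 * reg 0)] <|
  .seq sqrtProg <|
  block [(53, reg 52 * reg 50 + reg 41)] <|
  .seq (.ite 53 skip (asg 53 (lit 0 - reg 53))) <|
  block [(54, reg 53 / (lit 2 * reg 20 * reg 11) + lit 2), (55, reg 51)] <|
  .seq rootProg <|
  asg 56 ((reg 54 - reg 50) / lit 16)

/-- The integer square root perturbs the numerator by at most 1, less than the denominator 2A₀G ≥ 2,
and the quotient loses less than 1. Adding 2 therefore yields an overestimate, too large by at most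
4. An overestimate is wanted so that the ratio stays at least 1. -/
theorem abs_val_latElt_approx {d : ℕ} [NonsquareRat d] {A₀ B₀ G x y : ℤ} (hA₀ : 0 < A₀) (hG : 1 ≤ G)
    (hy : 0 ≤ y) {W : ℤ} (hW : 0 < W) {f : ℕ}
    (hf : f = Nat.sqrt ((W * W * y * y).toNat * disc d)) {z : ℤ}
    (hz : z = |(2 * A₀ * x + y * B₀) * W + f|) :
    W * (|val (latElt d A₀ B₀ x y)| / G) ≤ (z / (2 * A₀ * G) + 2 : ℤ) ∧
      ((z / (2 * A₀ * G) + 2 : ℤ) : ℝ) ≤ W * (|val (latElt d A₀ B₀ x y)| / G) + 4 := by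
  have hS := sqrt_disc_pos (d := d)
  have hS2 := sqrt_disc_sq d
  set S := √(disc d : ℝ) with hSdef
  have hyR : (0 : ℝ) ≤ y := by exact_mod_cast hy
  have hWR : (0 : ℝ) < W := by exact_mod_cast hW
  have hGR : (1 : ℝ) ≤ G := by exact_mod_cast hG
  have hA₀' : (1 : ℝ) ≤ A₀ := by exact_mod_cast hA₀
  have hX : (((W * W * y * y).toNat * disc d : ℕ) : ℝ) = (W * y * S) ^ 2 := by
    have : (((W * W * y * y).toNat : ℤ) : ℝ) = W * W * y * y := by
      rw [Int.toNat_of_nonneg (by positivity)]; push_cast; ring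
    rw [Int.cast_natCast] at this
    push_cast
    rw [this, mul_pow, hS2]; ring
  have hf1 : (f : ℝ) ≤ W * y * S := by
    have h1 : f ^ 2 ≤ (W * W * y * y).toNat * disc d := by rw [hf]; exact Nat.sqrt_le' _
    have h2 : (f : ℝ) ^ 2 ≤ (W * y * S) ^ 2 := by rw [← hX]; exact_mod_cast h1
    exact abs_le_of_sq_le_sq' h2 (by positivity) |>.2
  have hf2 : W * y * S < f + 1 := by
    have h1 : (W * W * y * y).toNat * disc d < (f + 1) ^ 2 := by
      rw [hf]; exact Nat.lt_succ_sqrt' _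
    have h2 : (W * y * S) ^ 2 < ((f : ℝ) + 1) ^ 2 := by rw [← hX]; exact_mod_cast h1
    exact lt_of_pow_lt_pow_left₀ 2 (by positivity) h2
  have hval : val (latElt d A₀ B₀ x y) = (2 * A₀ * x + y * B₀ + y * S) / (2 * A₀) := by
    simp only [latElt, val_add, val_mul, val_intCast, val_quadIrr]
    rw [← hSdef]
    field_simp
    ring
  obtain ⟨m, hm⟩ : ∃ m : ℤ, m = 2 * A₀ * G := ⟨_, rfl⟩
  have hmR : (m : ℝ) = 2 * A₀ * G := by rw [hm]; push_cast; ring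
  have hm2 : (2 : ℝ) ≤ m := by rw [hmR]; nlinarith
  have hm0 : 0 < m := by
    have : (0 : ℝ) < m := by linarith
    exact_mod_cast this
  have hβ : W * (|val (latElt d A₀ B₀ x y)| / G)
      = |(2 * A₀ * x + y * B₀) * W + W * y * S| / m := by
    rw [hval, abs_div, abs_of_pos (by linarith : (0 : ℝ) < 2 * A₀), hmR]
    have : (2 * A₀ * x + y * B₀) * W + W * y * S = W * ((2 * A₀ * x + y * B₀ + y * S) : ℝ) := by
      ring
    rw [this, abs_mul, abs_of_pos hWR]
    field_simp
  have hzR : (z : ℝ) = |((2 * A₀ * x + y * B₀) * W + f : ℝ)| := by rw [hz]; push_cast; rfl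
  rw [hβ, ← hm]
  obtain ⟨u, hu⟩ : ∃ u : ℝ, u = |(2 * A₀ * x + y * B₀) * W + W * y * S| := ⟨_, rfl⟩
  have huz : |u - z| ≤ 1 := by
    rw [hu, hzR]
    refine (abs_abs_sub_abs_le_abs_sub _ _).trans ?_
    rw [abs_le]
    constructor <;> linarith
  rw [← hu]
  have hq1 : m * (z / m) ≤ z := Int.mul_ediv_self_le hm0.ne'
  have hq2 : z < m * (z / m) + m := Int.lt_mul_ediv_self_add hm0
  have hq1' : (m : ℝ) * ((z / m : ℤ) : ℝ) ≤ z := by exact_mod_cast hq1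
  have hq2' : (z : ℝ) < m * ((z / m : ℤ) : ℝ) + m := by exact_mod_cast hq2
  have hmpos : (0 : ℝ) < m := by linarith
  obtain ⟨h1, h2⟩ := abs_le.1 huz
  push_cast
  constructor
  · rw [div_le_iff₀ hmpos]
    nlinarith
  · rw [← sub_le_iff_le_add, le_div_iff₀ hmpos]
    nlinarith

theorem logProg_tri {d : ℕ} [NonsquareRat d] {b : ℕ} (hb : 5 ≤ b) {M : ℤ} (hM : 32 ≤ M)
    (hMb : M ^ 16 ≤ 2 ^ b) {σ : ℕ → ℤ} {J E l : ℕ} (hJ : J = E + 2 * l + 20)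
    (hl : disc d ≤ 2 ^ l) (h0 : σ 0 = disc d) (h50 : σ 50 = 2 ^ (J + E + 4)) (h51 : σ 51 = J)
    (hWM : 2 ^ (J + E + 4) * ((disc d : ℤ) + 4) ≤ M) (hA₀ : 0 < σ 20) (hG : 1 ≤ σ 11)
    (hy : 0 ≤ σ 27) (h11M : |σ 11| ≤ M) (h20M : |σ 20| ≤ M) (h21M : |σ 21| ≤ M)
    (h26M : |σ 26| ≤ M) (h27M : |σ 27| ≤ M)
    (hlarge : (σ 11 : ℝ) < |val (latElt d (σ 20) (σ 21) (σ 26) (σ 27))|)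
    (hle : |val (latElt d (σ 20) (σ 21) (σ 26) (σ 27))| ≤ σ 11 * √(disc d : ℝ)) :
    Tri b ((b + 1) * (3 * b + 30)) logProg σ (fun τ =>
      |(τ 56 : ℝ) - 2 ^ E * Real.log (|val (latElt d (σ 20) (σ 21) (σ 26) (σ 27))| / σ 11)| ≤ 1 ∧
      ∀ j, (j < 40 ∨ 42 < j ∧ j < 52 ∨ 56 < j) → j < 63 → τ j = σ j) := by
  obtain ⟨W, hW⟩ : ∃ W : ℤ, W = 2 ^ (J + E + 4) := ⟨_, rfl⟩
  rw [← hW] at h50 hWM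
  have hW0 : 0 < W := by rw [hW]; positivity
  have hWR : (0 : ℝ) < W := by exact_mod_cast hW0
  have hD1 : 1 ≤ disc d := by
    have := sqrt_disc_pos (d := d)
    rcases Nat.eq_zero_or_pos (disc d) with h | h
    · rw [h] at this; simp at this
    · exact h
  have hD1' : (1 : ℤ) ≤ disc d := by exact_mod_cast hD1
  have hWleM : W ≤ M := by nlinarith
  have hDM : (disc d : ℤ) ≤ M := by nlinarith
  have hJW : (J : ℤ) ≤ W := by
    have h1 : (J : ℤ) ≤ 2 ^ J := by exact_mod_cast Nat.lt_two_pow_self.le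
    have h2 : (2 : ℤ) ^ J ≤ W := by rw [hW]; exact pow_le_pow_right₀ (by norm_num) (by omega)
    linarith
  have hJb : J ≤ b := by
    have h2 : (2 : ℤ) ^ J ≤ W := by rw [hW]; exact pow_le_pow_right₀ (by norm_num) (by omega)
    have h3 : M ≤ M ^ 16 := le_self_pow₀ (by linarith) (by norm_num)
    have : (2 : ℤ) ^ J ≤ 2 ^ b := by linarith
    exact (pow_le_pow_iff_right₀ (by norm_num : (1 : ℤ) < 2)).1 this
  have hlev : Lev M (levOf [0, 11, 20, 21, 26, 27, 50, 51]) σ := by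
    refine lev_levOf _ ?_
    simp only [List.forall_mem_cons, List.not_mem_nil, false_imp_iff, implies_true, and_true]
    rw [h0, h50, h51, abs_of_pos hW0, Nat.abs_cast, Nat.abs_cast]
    exact ⟨hDM, h11M, h20M, h21M, h26M, h27M, hWleM, hJW.trans hWleM⟩
  refine (Tri.block (N := (3 * b + 6) + (1 + (2 + (2 + (b * (3 * b + 11) + 1 + 1))))) hb hM hMb _ _
    hlev (by decide) fun hlev' => ?_).mono
      (by simp only [List.length_cons, List.length_nil]; nlinarith) (fun _ _ h => h)
  set υ := runBlock _ σ with hυ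
  have hfυ : ∀ j, j ≠ 52 → j ≠ 40 → υ j = σ j := fun j h1 h2 => by
    rw [hυ, runBlock_of_notMem _ _ ?_]
    simp only [List.forall_mem_cons, List.not_mem_nil, false_imp_iff, implies_true, and_true]
    omega
  have hv : υ 52 = 2 * σ 20 * σ 26 + σ 27 * σ 21 ∧ υ 40 = W * W * σ 27 * σ 27 * disc d := by
    rw [hυ]
    simp only [runBlock_cons, runBlock_nil, Ex.eval_add, Ex.eval_mul,
      Ex.eval_reg, Ex.eval_lit, Function.update_apply]
    simp [h0, h50]
  obtain ⟨v52, v40⟩ := hv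
  have hX : υ 40 = ((W * W * σ 27 * σ 27).toNat * disc d : ℕ) := by
    rw [v40]; push_cast; rw [Int.toNat_of_nonneg (by positivity)]
  have hl40 : |υ 40| ≤ M ^ 5 := hlev' 40 (by decide)
  have hl52 : |υ 52| ≤ M ^ 5 := hlev' 52 (by decide)
  refine Tri.seq (sqrtProg_tri hb hX) ?_
  rintro ρ ⟨hρ41, hρ⟩
  have hρσ : ∀ j, j ≠ 40 → j ≠ 41 → j ≠ 42 → j ≠ 52 → ρ j = σ j := fun j h1 h2 h3 h4 => by
    rw [hρ j h2 h3, hfυ j h4 h1]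
  have r50 : ρ 50 = W := by rw [hρσ 50 (by norm_num) (by norm_num) (by norm_num) (by norm_num), h50]
  have r52 : ρ 52 = υ 52 := hρ 52 (by norm_num) (by norm_num)
  have hl41 : |ρ 41| ≤ M ^ 5 := by
    refine le_trans ?_ hl40
    rw [hρ41, hX, Nat.abs_cast, Nat.abs_cast]
    exact_mod_cast Nat.sqrt_le_self _
  have hlev2 : Lev M (fun i => if i = 41 then 5 else if i = 52 then 5 else levOf [50] i) ρ := by
    intro i hi
    by_cases h41 : i = 41
    · subst h41; exact hl41
    by_cases h52 : i = 52
    · subst h52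
      simp only [h41, if_false, if_true]
      rw [r52]; exact hl52
    · simp only [h41, h52, if_false] at hi ⊢
      refine lev_levOf (M := M) [50] ?_ i hi
      simp only [List.forall_mem_cons, List.not_mem_nil, false_imp_iff, implies_true, and_true]
      rw [r50, abs_of_pos hW0]; exact hWleM
  rw [add_comm 1]
  refine Tri.block (w := 16) hb hM hMb _ _ hlev2 (by decide) fun hlev3 => ?_
  have w53 : runBlock [(53, reg 52 * reg 50 + reg 41)] ρ 53
      = (2 * σ 20 * σ 26 + σ 27 * σ 21) * W + ρ 41 := by
    simp only [runBlock_cons, runBlock_nil, Ex.eval_add, Ex.eval_mul, Ex.eval_reg,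
      Function.update_apply]
    simp [r50, r52, v52]
  have hl53 : |runBlock [(53, reg 52 * reg 50 + reg 41)] ρ 53| ≤ M ^ 11 := hlev3 53 (by decide)
  have hfw : ∀ j, j ≠ 53 → runBlock [(53, reg 52 * reg 50 + reg 41)] ρ j = ρ j := fun j hj =>
    runBlock_of_notMem _ _ (by simpa using hj.symm)
  set ω := runBlock [(53, reg 52 * reg 50 + reg 41)] ρ with hω
  refine Tri.seq (R := fun τ => τ 53 = |ω 53| ∧ ∀ j, j ≠ 53 → j < 63 → τ j = ω j)
    (Tri.ite (N := 1) hb (by norm_num) (fun hp => Tri.skip hb ⟨?_, fun j _ hj => ?_⟩)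
      fun hp => Tri.asg hb rfl (by decide) (by norm_num) ?_ ⟨?_, fun j hj _ => ?_⟩) ?_
  · rw [Function.update_of_ne (by norm_num), abs_of_pos hp]
  · rw [Function.update_of_ne (by omega)]
  · intro _
    rw [Ex.eval_sub, Ex.eval_lit, Ex.eval_reg, zero_sub, abs_neg]
    exact hl53.trans ((pow_le_pow_right₀ (by linarith) (by norm_num)).trans hMb)
  · rw [Function.update_self, Ex.eval_sub, Ex.eval_lit, Ex.eval_reg, zero_sub, abs_of_nonpos hp]
  · rw [Function.update_of_ne hj]
  rintro π ⟨p53, hπ⟩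
  have hπσ : ∀ j, j ≠ 40 → j ≠ 41 → j ≠ 42 → j ≠ 52 → j ≠ 53 → j < 63 → π j = σ j :=
    fun j h1 h2 h3 h4 h5 h6 => by rw [hπ j h5 h6, hfw j h5, hρσ j h1 h2 h3 h4]
  have p11 : π 11 = σ 11 := hπσ 11 (by norm_num) (by norm_num) (by norm_num) (by norm_num) (by norm_num) (by norm_num)
  have p20 : π 20 = σ 20 := hπσ 20 (by norm_num) (by norm_num) (by norm_num) (by norm_num) (by norm_num) (by norm_num)
  have p50 : π 50 = W := by
    rw [hπσ 50 (by norm_num) (by norm_num) (by norm_num) (by norm_num) (by norm_num) (by norm_num), h50]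
  have p51 : π 51 = J := by
    rw [hπσ 51 (by norm_num) (by norm_num) (by norm_num) (by norm_num) (by norm_num) (by norm_num), h51]
  have hlev4 : Lev M (fun i => if i = 53 then 11 else levOf [11, 20, 51] i) π := by
    intro i hi
    by_cases h53 : i = 53
    · subst h53
      simp only [if_true]
      rw [p53, abs_abs]; exact hl53
    · simp only [h53, if_false] at hi ⊢
      refine lev_levOf (M := M) [11, 20, 51] ?_ i hi
      simp only [List.forall_mem_cons, List.not_mem_nil, false_imp_iff, implies_true, and_true]
      rw [p11, p20, p51, Nat.abs_cast]
      exact ⟨h11M, h20M, hJW.trans hWleM⟩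
  rw [add_comm 2]
  refine Tri.block (w := 16) hb hM hMb _ _ hlev4 (by decide) fun _ => ?_
  have hfin : runBlock [(54, reg 53 / (lit 2 * reg 20 * reg 11) + lit 2), (55, reg 51)] π 54
      = |ω 53| / (2 * σ 20 * σ 11) + 2 ∧
      runBlock [(54, reg 53 / (lit 2 * reg 20 * reg 11) + lit 2), (55, reg 51)] π 55 = J := by
    simp only [runBlock_cons, runBlock_nil, Ex.eval_add, Ex.eval_mul, Ex.eval_div, Ex.eval_reg,
      Ex.eval_lit, Function.update_apply]
    simp [p53, p20, p11, p51]
  have hfκ : ∀ j, j ≠ 54 → j ≠ 55 →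
      runBlock [(54, reg 53 / (lit 2 * reg 20 * reg 11) + lit 2), (55, reg 51)] π j = π j :=
    fun j h1 h2 => runBlock_of_notMem _ _ (by simpa using ⟨h1.symm, h2.symm⟩)
  set κ := runBlock [(54, reg 53 / (lit 2 * reg 20 * reg 11) + lit 2), (55, reg 51)] π with hκ
  obtain ⟨k54, k55⟩ := hfin
  obtain ⟨a1, a2⟩ := abs_val_latElt_approx (d := d) (x := σ 26) (B₀ := σ 21) hA₀ hG hy hW0
    (f := Nat.sqrt ((W * W * σ 27 * σ 27).toNat * disc d)) rfl (z := |ω 53|)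
    (by rw [w53, hρ41])
  rw [← k54] at a1 a2
  obtain ⟨β, hβ⟩ : ∃ β, β = |val (latElt d (σ 20) (σ 21) (σ 26) (σ 27))| / σ 11 := ⟨_, rfl⟩
  rw [← hβ] at a1 a2 ⊢
  have hGR : (1 : ℝ) ≤ σ 11 := by exact_mod_cast hG
  have hβ1 : 1 ≤ β := by rw [hβ, le_div_iff₀ (by linarith), one_mul]; exact hlarge.le
  have hβS : β ≤ √(disc d : ℝ) := by
    rw [hβ, div_le_iff₀ (by linarith), mul_comm]; exact hle
  have hDR : (1 : ℝ) ≤ disc d := by exact_mod_cast hD1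
  have hβD : β ≤ disc d := hβS.trans (Real.sqrt_le_left (by linarith) |>.2 (by nlinarith))
  have hlow : (W : ℝ) ≤ κ 54 := by nlinarith
  have hup : (κ 54 : ℝ) ≤ W * (disc d + 4) := by
    have hW1 : (1 : ℝ) ≤ W := by exact_mod_cast hW0
    nlinarith
  have hκ0 : (0 : ℝ) < κ 54 := by linarith
  refine Tri.seq (rootProg_tri (L := Real.log β) (W := W) (X := disc d + 4) hb hM hMb ?_ hW0
    (by linarith) hWM k55 hJb (hJW.trans hWleM) (by exact_mod_cast hlow) (by exact_mod_cast hup)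
    ?_ ?_) ?_
  · rw [hfκ 50 (by norm_num) (by norm_num), p50]
  · exact Real.log_le_log (by linarith) (by rw [le_div_iff₀ hWR, mul_comm]; exact a1)
  -- By ln z ≤ z - 1 applied to the ratio of approximation and exact value, with β ≥ 1.
  · have h4 : Real.log (κ 54 / W) - Real.log β ≤ 4 / W := by
      rw [← Real.log_div (by positivity) (by linarith)]
      refine (Real.log_le_sub_one_of_pos (div_pos (div_pos hκ0 hWR) (by linarith))).trans ?_
      rw [sub_le_iff_le_add, div_le_iff₀ (by linarith), div_le_iff₀ hWR]
      have : (4 / W + 1) * β * W = 4 * β + W * β := by field_simp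
      rw [this]
      linarith
    linarith
  rintro φ ⟨f1, f2, f3, f4, hφ⟩
  have e50 : φ 50 = W := by
    rw [hφ 50 (by norm_num) (by norm_num), hfκ 50 (by norm_num) (by norm_num), p50]
  refine Tri.asg hb rfl (by decide) (by norm_num) ?_ ⟨?_, fun j hj hj' => ?_⟩
  · intro _
    have h1 : |φ 54 - W| ≤ M := by
      rw [abs_of_nonneg (by linarith)]; linarith
    have h3 : M ≤ M ^ 16 := le_self_pow₀ (by linarith) (by norm_num)
    rw [Ex.eval_div, Ex.eval_sub, Ex.eval_reg, Ex.eval_reg, Ex.eval_lit, e50]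
    have h4 : |(φ 54 - W) / 16| ≤ |φ 54 - W| := by
      have := Int.natAbs_ediv_le_natAbs (φ 54 - W) 16
      rw [Int.abs_eq_natAbs, Int.abs_eq_natAbs]; exact_mod_cast this
    linarith
  · rw [Function.update_self, Ex.eval_div, Ex.eval_sub, Ex.eval_reg, Ex.eval_reg, Ex.eval_lit, e50]
    have hL : Real.log β ≤ l := by
      have h1 : Real.log β ≤ Real.log ((2 : ℝ) ^ l) :=
        Real.log_le_log (by linarith) (hβD.trans (by exact_mod_cast hl))
      rw [Real.log_pow] at h1
      have := Real.log_two_lt_d9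
      have : (0 : ℝ) ≤ l := Nat.cast_nonneg l
      nlinarith
    have f1R : (W : ℝ) ≤ φ 54 := by exact_mod_cast f1
    obtain ⟨g1, g2⟩ := log_scaled_bounds (W := (W : ℝ)) (r := φ 54 / W) hJ (by rw [hW]; push_cast; rfl)
      (by rwa [le_div_iff₀ hWR, one_mul]) f3 f4 hL
    have hWr : (W : ℝ) * (φ 54 / W - 1) / 16 = ((φ 54 - W : ℤ) : ℝ) / 16 := by
      push_cast; field_simp
    rw [hWr] at g1 g2
    -- The final quotient loses less than 1 and its argument is too large by at most 1/2, so the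
    -- error lies between -1 and 1/2.
    have q1 : 16 * ((φ 54 - W) / 16) ≤ φ 54 - W := Int.mul_ediv_self_le (by norm_num)
    have q2 : φ 54 - W < 16 * ((φ 54 - W) / 16) + 16 := Int.lt_mul_ediv_self_add (by norm_num)
    have q1' : 16 * (((φ 54 - W) / 16 : ℤ) : ℝ) ≤ ((φ 54 - W : ℤ) : ℝ) := by exact_mod_cast q1
    have q2' : ((φ 54 - W : ℤ) : ℝ) < 16 * (((φ 54 - W) / 16 : ℤ) : ℝ) + 16 := by exact_mod_cast q2
    rw [abs_le]
    constructor <;> linarith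
  · rw [Function.update_of_ne (by omega), hφ j (by omega) hj', hfκ j (by omega) (by omega),
      hπσ j (by omega) (by omega) (by omega) (by omega) (by omega) hj']

/-! ### One `*`-squaring -/

theorem IsReducedForm.bounds [NonsquareRat d] {I : FracIdeal d} {γ : QuadField d} {a b : ℤ}
    (h : IsReducedForm I γ a b) : 0 < a ∧ a ^ 2 ≤ disc d ∧ |b| ≤ disc d := by
  obtain ⟨h1, h2, h3, h4⟩ := h.isStd.isRed h.isMin
  have hS2 := sqrt_disc_sq d
  have hS := sqrt_disc_pos (d := d)
  have ha : (1 : ℝ) ≤ a := by exact_mod_cast h1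
  have haS : (a : ℝ) < √(disc d : ℝ) := by linarith
  have hD : (a : ℝ) ^ 2 ≤ disc d := by rw [← hS2]; exact pow_le_pow_left₀ (by linarith) haS.le 2
  have hSD : √(disc d : ℝ) ≤ disc d := by nlinarith
  refine ⟨h1, by exact_mod_cast hD, ?_⟩
  have : |(b : ℝ)| ≤ disc d := by rw [abs_le]; constructor <;> linarith
  exact_mod_cast this

/-- The integer w = (g - vb)/a completes v to the Bézout relation wa₁ + vb₁ = 1 required by
`mem_latt_sq`. The shift by k brings B₀ into the interval (s - 2A₀, s] with s = ⌊√D⌋, equivalently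
the conjugate of θ₀ between -1 and 0. The sizes follow from a² ≤ D. -/
theorem IsReducedForm.isSearchData [NonsquareRat d] (hd : Squarefree d) (h5 : 5 ≤ disc d)
    {I : FracIdeal d} {γ : QuadField d} {a b : ℤ} (h : IsReducedForm I γ a b)
    {g v c A₀ B₁ k B₀ : ℤ} (hg : g = Int.gcd a b) (hv : a ∣ g - v * b)
    (hc : c = (disc d - b * b) / (4 * a)) (hA₀ : A₀ = a / g * (a / g))
    (hB₁ : B₁ = b + 2 * (a / g) * v * c) (hk : k = (Nat.sqrt (disc d) - B₁) / (2 * A₀))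
    (hB₀ : B₀ = B₁ + 2 * A₀ * k) :
    IsSearchData d A₀ B₀ g ∧ (∃ C, (disc d : ℤ) = B₀ ^ 2 + 4 * A₀ * C) ∧
      ∀ ξ, γ ^ 2 * ξ ∈ (1 : FracIdeal d) ↔ (g : QuadField d) * ξ ∈ latt 1 (quadIrr d A₀ B₀) := by
  obtain ⟨ha, ha2, -⟩ := h.bounds
  have hD : (disc d : ℤ) = b ^ 2 + 4 * a * c := by
    rw [hc, ← pow_two]; exact (h.isStd.isCFState h.isMin).disc_eq
  have hg0 : 0 < g := by
    rw [hg]; exact_mod_cast Int.gcd_pos_of_ne_zero_left b ha.ne'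
  obtain ⟨a₁, ha₁⟩ : g ∣ a := by rw [hg]; exact Int.gcd_dvd_left a b
  obtain ⟨b₁, hb₁⟩ : g ∣ b := by rw [hg]; exact Int.gcd_dvd_right a b
  have hcop : IsCoprime g c := by rw [hg]; exact isCoprime_gcd_of_disc hd hD
  have hdiv : a / g = a₁ := by rw [ha₁, Int.mul_ediv_cancel_left _ hg0.ne']
  rw [hdiv] at hA₀ hB₁
  have ha₁0 : 0 < a₁ := by
    by_contra hn
    nlinarith
  obtain ⟨w, hw⟩ := hv
  have huv : w * a₁ + v * b₁ = 1 := by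
    have : g * (w * a₁ + v * b₁) = g * 1 := by
      rw [ha₁, hb₁] at hw; linear_combination -hw
    exact mul_left_cancel₀ hg0.ne' this
  have hA₀0 : 0 < A₀ := by rw [hA₀]; positivity
  have hmem := mem_latt_sq h.one_eq (a₁ := a₁) (b₁ := b₁) (g := g) (c := c) (u := w) (v := v)
    ha₁0.ne' hg0.ne' (by rw [h.isStd.coe_eq, mul_comm a₁, mul_comm b₁, ← ha₁, ← hb₁]) huv
    (by rw [mul_comm a₁, mul_comm b₁, ← ha₁, ← hb₁]; exact hD) hcop
  have hlatt : latt 1 (quadIrr d (a₁ ^ 2) (b₁ * g + 2 * a₁ * v * c)) = latt 1 (quadIrr d A₀ B₀) := by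
    have hsh := latt_shift 1 (quadIrr d A₀ B₁) k
    rw [mul_one] at hsh
    rw [hB₀, ← quadIrr_add_int hA₀0.ne', hsh, hB₁, hA₀, mul_comm b₁, ← hb₁, pow_two]
  have hS := natSqrt_lt_sqrt (d := d)
  have hS' := sqrt_lt_natSqrt_add_one (d := d)
  have hq1 : 2 * A₀ * k ≤ Nat.sqrt (disc d) - B₁ := by
    rw [hk]; exact Int.mul_ediv_self_le (by positivity)
  have hq2 : (Nat.sqrt (disc d) : ℤ) - B₁ < 2 * A₀ * k + 2 * A₀ := by
    rw [hk]; exact Int.lt_mul_ediv_self_add (by positivity)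
  have hB1 : B₀ ≤ Nat.sqrt (disc d) := by rw [hB₀]; linarith
  have hB2 : (Nat.sqrt (disc d) : ℤ) + 1 ≤ B₀ + 2 * A₀ := by rw [hB₀]; linarith
  have hB1' : (B₀ : ℝ) ≤ ((Nat.sqrt (disc d) : ℤ) : ℝ) := by exact_mod_cast hB1
  have hB2' : ((Nat.sqrt (disc d) : ℤ) : ℝ) + 1 ≤ B₀ + 2 * A₀ := by exact_mod_cast hB2
  have hA₀R : (0 : ℝ) < A₀ := by exact_mod_cast hA₀0
  have hg1 : 1 ≤ g := hg0
  refine ⟨⟨hA₀0, ?_, ?_, hg0, ?_, ?_, by omega⟩, ?_, fun ξ => by rw [hmem, hlatt]⟩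
  · rw [conjVal_quadIrr, lt_div_iff₀ (by positivity)]; linarith
  · rw [conjVal_quadIrr, div_lt_iff₀ (by positivity)]; linarith
  · refine le_trans ?_ ha2
    have : a₁ ≤ a := by rw [ha₁]; exact le_mul_of_one_le_left ha₁0.le hg1
    rw [hA₀, pow_two]; exact mul_le_mul this this ha₁0.le ha.le
  · refine le_trans ?_ ha2
    have : g ≤ a := by rw [ha₁]; exact le_mul_of_one_le_right hg0.le ha₁0
    nlinarith
  -- The cross terms in B₁² and 4A₀(gcw - v²c²) combine by the Bézout relation to 4ac, which leaves
  -- D. The terms in k account for the shift.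
  · refine ⟨g * c * w - v ^ 2 * c ^ 2 - B₁ * k - A₀ * k ^ 2, ?_⟩
    have e1 : (disc d : ℤ) = B₁ ^ 2 + 4 * A₀ * (g * c * w - v ^ 2 * c ^ 2) := by
      rw [hD, hB₁, hA₀, ha₁, hb₁]
      linear_combination (-4 * a₁ * c * g) * huv
    rw [hB₀, e1]; ring

/-- From the standard form in registers `1` and `2`, registers `11`, `20`, `21` receive the data of
the search. -/
def latticeProg : Prog :=
  block [(18, (reg 0 - reg 2 * reg 2) / (lit 4 * reg 1))] <|
  .seq gcdProg <|
  block [(19, reg 1 / reg 11), (20, reg 19 * reg 19), (21, reg 2 + lit 2 * reg 19 * reg 13 * reg 18),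
    (22, (reg 10 - reg 21) / (lit 2 * reg 20)), (21, reg 21 + lit 2 * reg 20 * reg 22)] skip

theorem latticeProg_tri [NonsquareRat d] (hd : Squarefree d) (h5 : 5 ≤ disc d) {b : ℕ} (hb : 5 ≤ b)
    {M : ℤ} (hM32 : 32 ≤ M) (hDM : (disc d : ℤ) ≤ M) (hMb : M ^ 40 ≤ 2 ^ b) {σ : ℕ → ℤ}
    (h0 : σ 0 = disc d) (h10 : σ 10 = Nat.sqrt (disc d)) {I : FracIdeal d} {γ : QuadField d}
    (h : IsReducedForm I γ (σ 1) (σ 2)) :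
    Tri b (9 * b + 27) latticeProg σ (fun τ =>
      IsSearchData d (τ 20) (τ 21) (τ 11) ∧
      (∃ C, (disc d : ℤ) = τ 21 ^ 2 + 4 * τ 20 * C) ∧
      (∀ ξ, γ ^ 2 * ξ ∈ (1 : FracIdeal d) ↔
        (τ 11 : QuadField d) * ξ ∈ latt 1 (quadIrr d (τ 20) (τ 21))) ∧
      ∀ j, (j < 11 ∨ 22 < j) → j < 63 → τ j = σ j) := by
  obtain ⟨D, hD⟩ : ∃ D : ℤ, D = disc d := ⟨_, rfl⟩
  have hD5 : 5 ≤ D := by rw [hD]; exact_mod_cast h5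
  rw [← hD] at h0 hDM
  have hMpow : ∀ w ≤ 40, M ^ w ≤ 2 ^ b := fun w hw =>
    (pow_le_pow_right₀ (by linarith) hw).trans hMb
  obtain ⟨ha, ha2, hbD⟩ := h.bounds
  rw [← hD] at ha2 hbD
  have haD : σ 1 ≤ D := by nlinarith
  have ha1M : |σ 1| ≤ M := by rw [abs_of_pos ha]; linarith
  have hb2M : |σ 2| ≤ M := hbD.trans hDM
  have hD0M : |D| ≤ M := by rwa [abs_of_pos (by linarith)]
  have hsM : |(Nat.sqrt (disc d) : ℤ)| ≤ M := by
    rw [Nat.abs_cast]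
    have : (Nat.sqrt (disc d) : ℤ) ≤ disc d := by exact_mod_cast Nat.sqrt_le_self _
    rw [← hD] at this; linarith
  refine Tri.block (N := (9 * b + 20) + (1 + 5)) hb hM32 (hMpow 10 (by norm_num)) _
    (levOf [0, 1, 2]) (lev_levOf _ ?_) (by decide) fun hlev => ?_
  · simp only [List.forall_mem_cons, List.not_mem_nil, false_imp_iff, implies_true, and_true]
    rw [h0]
    exact ⟨hD0M, ha1M, hb2M⟩
  set υ := runBlock _ σ with hυ
  have hfυ : ∀ j, j ≠ 18 → υ j = σ j := fun j hj => runBlock_of_notMem _ _ (by simpa using hj.symm)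
  have v18 : υ 18 = (disc d - σ 2 * σ 2) / (4 * σ 1) := by
    rw [hυ, ← hD, ← h0]
    simp [runBlock_cons, runBlock_nil, Ex.eval_sub, Ex.eval_mul, Ex.eval_div, Ex.eval_reg,
      Ex.eval_lit]
  have hl18 : |υ 18| ≤ M ^ 5 := hlev 18 (by decide)
  have v1 : υ 1 = σ 1 := hfυ 1 (by norm_num)
  have v2 : υ 2 = σ 2 := hfυ 2 (by norm_num)
  refine Tri.seq (gcdProg_tri hb hM32 (hMpow 10 (by norm_num)) (by rwa [v1])
    (by rw [v1]; linarith) (by rwa [v2])) ?_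
  rw [v1, v2]
  rintro ρ ⟨r11, r13, r13a, r13b, hρ⟩
  have hρσ : ∀ j, (j < 11 ∨ 18 < j) → j < 63 → ρ j = σ j := fun j hj hj' => by
    rw [hρ j (by omega) hj', hfυ j (by omega)]
  have r0 : ρ 0 = D := by rw [hρσ 0 (by norm_num) (by norm_num), h0]
  have r1 : ρ 1 = σ 1 := hρσ 1 (by norm_num) (by norm_num)
  have r2 : ρ 2 = σ 2 := hρσ 2 (by norm_num) (by norm_num)
  have r10 : ρ 10 = Nat.sqrt (disc d) := by rw [hρσ 10 (by norm_num) (by norm_num), h10]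
  have r18 : ρ 18 = υ 18 := hρ 18 (by norm_num) (by norm_num)
  have hgle : ρ 11 ≤ σ 1 := by
    rw [r11]; exact Int.le_of_dvd ha (Int.gcd_dvd_left _ _)
  have hg0 : 0 ≤ ρ 11 := by rw [r11]; exact Int.natCast_nonneg _
  have hlev2 : Lev M (fun i => if i = 18 then 5 else levOf [0, 1, 2, 10, 11, 13] i) ρ := by
    intro i hi
    by_cases h18 : i = 18
    · subst h18
      simp only [if_true]
      rw [r18]; exact hl18
    · simp only [h18, if_false] at hi ⊢
      refine lev_levOf (M := M) [0, 1, 2, 10, 11, 13] ?_ i hi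
      simp only [List.forall_mem_cons, List.not_mem_nil, false_imp_iff, implies_true, and_true]
      rw [r0, r1, r2, r10, abs_of_nonneg hg0, abs_of_nonneg r13a]
      exact ⟨hD0M, ha1M, hb2M, hsM, by linarith, by linarith⟩
  refine Tri.block hb hM32 hMb _ _ hlev2 (by decide) fun _ => Tri.skip hb ?_
  set κ := runBlock _ ρ with hκ
  have hfκ : ∀ j, j < 19 ∨ 22 < j → κ j = ρ j := fun j hj => by
    rw [hκ]
    refine runBlock_of_notMem _ _ ?_
    simp only [List.forall_mem_cons, List.not_mem_nil, false_imp_iff, implies_true, and_true]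
    omega
  have hκσ : ∀ j, (j < 11 ∨ 22 < j) → j < 63 → κ j = σ j := fun j hj hj' => by
    rw [hfκ j (by omega), hρσ j (by omega) hj']
  have k20 : κ 20 = σ 1 / ρ 11 * (σ 1 / ρ 11) := by
    rw [hκ]
    simp only [runBlock_cons, runBlock_nil, Ex.eval_sub, Ex.eval_add, Ex.eval_mul, Ex.eval_div,
      Ex.eval_reg, Ex.eval_lit, Function.update_apply]
    simp [r1]
  have k21 : κ 21 = (σ 2 + 2 * (σ 1 / ρ 11) * ρ 13 * υ 18) + 2 * κ 20 *
      ((Nat.sqrt (disc d) - (σ 2 + 2 * (σ 1 / ρ 11) * ρ 13 * υ 18)) / (2 * κ 20)) := by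
    rw [k20, hκ]
    simp only [runBlock_cons, runBlock_nil, Ex.eval_sub, Ex.eval_add, Ex.eval_mul, Ex.eval_div,
      Ex.eval_reg, Ex.eval_lit, Function.update_apply]
    simp [r1, r2, r10, r18]
  have k11 : κ 11 = ρ 11 := hfκ 11 (by norm_num)
  obtain ⟨hdata, ⟨C, hC⟩, hmem⟩ := h.isSearchData hd h5 (g := κ 11) (v := ρ 13) (c := υ 18)
    (A₀ := κ 20) (B₀ := κ 21) (by rw [k11, r11]) (by rwa [k11]) v18 (by rw [k11, k20]) rfl rfl
    (by rw [k11]; exact k21)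
  have hup : ∀ j, j < 63 → Function.update κ 63 0 j = κ j := fun j hj =>
    Function.update_of_ne (by omega) _ _
  refine ⟨?_, ⟨C, ?_⟩, ?_, fun j hj hj' => by rw [hup j hj', hκσ j hj hj']⟩
  all_goals rw [hup 20 (by norm_num), hup 21 (by norm_num)]
  · rw [hup 11 (by norm_num)]; exact hdata
  · exact hC
  · rw [hup 11 (by norm_num)]; exact hmem

/-- The search, followed by the logarithm. -/
def distanceProg : Prog := .seq searchProg logProg

theorem distanceProg_tri [NonsquareRat d] (h5 : 5 ≤ disc d) {b : ℕ} (hb : 5 ≤ b)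
    {M : ℤ} (hM : (disc d : ℤ) ^ 5 ≤ M) (hMb : M ^ 40 ≤ 2 ^ b) {κ : ℕ → ℤ} {J E l : ℕ}
    (hJ : J = E + 2 * l + 20) (hl : disc d ≤ 2 ^ l) (k0 : κ 0 = disc d)
    (k10 : κ 10 = Nat.sqrt (disc d)) (h50 : κ 50 = 2 ^ (J + E + 4)) (h51 : κ 51 = J)
    (hWM : 2 ^ (J + E + 4) * ((disc d : ℤ) + 4) ≤ M) (hdata : IsSearchData d (κ 20) (κ 21) (κ 11))
    {C : ℤ} (hC : (disc d : ℤ) = κ 21 ^ 2 + 4 * κ 20 * C) {I : FracIdeal d} {γ : QuadField d}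
    (hγ : (1 : FracIdeal d) = γ • I)
    (hmem : ∀ ξ, γ ^ 2 * ξ ∈ (1 : FracIdeal d) ↔
      (κ 11 : QuadField d) * ξ ∈ latt 1 (quadIrr d (κ 20) (κ 21))) :
    Tri b ((b + 2) * (3 * b + 40) + (b + 1) * (3 * b + 30)) distanceProg κ (fun τ =>
      (∃ (I' : FracIdeal d) (y : ℝ), IsStarSquare (I, Real.log |val γ|) (I', y) ∧
        IsStandardForm I' (τ 23) (τ 24) ∧
        |(τ 56 : ℝ) - 2 ^ E * (y - 2 * Real.log |val γ|)| ≤ 1 ∧ |τ 56| ≤ 2 ^ E * l + 1) ∧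
      ∀ j, (j < 11 ∨ 42 < j ∧ j < 52 ∨ 56 < j) → j < 63 → τ j = κ j) := by
  obtain ⟨D, hD⟩ : ∃ D : ℤ, D = disc d := ⟨_, rfl⟩
  have hD5 : 5 ≤ D := by rw [hD]; exact_mod_cast h5
  rw [← hD] at hM hWM
  have hM32 : 32 ≤ M := by
    refine le_trans ?_ hM
    calc (32 : ℤ) ≤ 5 ^ 5 := by norm_num
      _ ≤ _ := pow_le_pow_left₀ (by norm_num) hD5 5
  have hMpow : ∀ w ≤ 40, M ^ w ≤ 2 ^ b := fun w hw =>
    (pow_le_pow_right₀ (by linarith) hw).trans hMb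
  have hpow : ∀ i ≤ 5, D ^ i ≤ M := fun i hi =>
    (pow_le_pow_right₀ (by linarith) hi).trans hM
  have hDM : D ≤ M := by simpa using hpow 1 (by norm_num)
  have hDb : (disc d : ℤ) ^ 200 ≤ 2 ^ b := by
    rw [← hD]
    calc D ^ 200 = (D ^ 5) ^ 40 := by ring
      _ ≤ M ^ 40 := pow_le_pow_left₀ (by positivity) hM 40
      _ ≤ _ := hMb
  refine Tri.seq (searchProg_tri hb hDb hdata h5 k0 k10 hC) ?_
  rintro π ⟨⟨k, hs⟩, hlarge, hπ⟩
  obtain ⟨-, hle, I', hsq, hstd⟩ := hs.exists_isStarSquare hdata hlarge hγ hmem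
  have hyle := (hs.large hlarge).1
  have hxle := hdata.abs_coeff_le hs.conj_le
  have hy0 := hs.nonneg
  rw [abs_of_nonneg hy0] at hxle
  rw [← hD] at hyle
  have hG1 : |val (latElt d (κ 20) (κ 21) 1 0)| ≤ κ 11 := by
    rw [latElt_one, val_one, abs_one]; exact_mod_cast hdata.one_le
  have hB₀ := ((hdata.init hC).bounds hdata hG1).2.1
  rw [← hD] at hB₀
  have h45 : 5 * D ^ 4 ≤ M := by
    refine le_trans ?_ hM
    have := pow_pos (show 0 < D by linarith) 4
    nlinarith
  have h23 : 5 * D ^ 2 ≤ M := by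
    refine le_trans ?_ (hpow 3 (by norm_num))
    nlinarith [sq_nonneg D]
  have hD4 : 1 ≤ D ^ 4 := one_le_pow₀ (by linarith)
  have p0 : π 0 = disc d := by rw [hπ 0 (by norm_num) (by norm_num), k0]
  have p11 : π 11 = κ 11 := hπ 11 (by norm_num) (by norm_num)
  have p20 : π 20 = κ 20 := hπ 20 (by norm_num) (by norm_num)
  have p21 : π 21 = κ 21 := hπ 21 (by norm_num) (by norm_num)
  have p50 : π 50 = 2 ^ (J + E + 4) := by
    rw [hπ 50 (by norm_num) (by norm_num), h50]
  have p51 : π 51 = J := by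
    rw [hπ 51 (by norm_num) (by norm_num), h51]
  have hA₀D := hdata.le_disc
  have hGD := hdata.le_disc'
  rw [← hD] at hA₀D hGD
  refine (logProg_tri hb hM32 (hMpow 16 (by norm_num)) hJ hl p0 p50 p51
    (by rwa [← hD]) (by rw [p20]; exact hdata.pos) (by rw [p11]; exact hdata.one_le) hy0 ?_ ?_ ?_
    ?_ ?_ (by rwa [p11, p20, p21]) (by rwa [p11, p20, p21])).mono le_rfl ?_
  · rw [p11, abs_of_pos (by linarith [hdata.one_le])]; linarith
  · rw [p20, abs_of_pos hdata.pos]; linarith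
  · rw [p21]; nlinarith
  · linarith
  · rw [abs_of_nonneg hy0]; linarith
  rw [p11, p20, p21]
  rintro φ - ⟨f56, hφ⟩
  obtain ⟨β, hβ⟩ : ∃ β, β = |val (latElt d (κ 20) (κ 21) (π 26) (π 27))| / (κ 11 : ℝ) := ⟨_, rfl⟩
  rw [← hβ] at f56 hsq
  have hGR : (1 : ℝ) ≤ κ 11 := by exact_mod_cast hdata.one_le
  have hβ1 : 1 ≤ β := by rw [hβ, le_div_iff₀ (by linarith), one_mul]; exact hlarge.le
  have hlog0 : 0 ≤ Real.log β := Real.log_nonneg hβ1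
  have hlogl : Real.log β ≤ l := by
    have hβS : β ≤ √(disc d : ℝ) := by
      rw [hβ, div_le_iff₀ (by linarith), mul_comm]; exact hle
    have hDR : (1 : ℝ) ≤ disc d := by exact_mod_cast (by omega : 1 ≤ disc d)
    have hβD : β ≤ disc d := hβS.trans (Real.sqrt_le_left (by linarith) |>.2 (by nlinarith))
    have h1 : Real.log β ≤ Real.log ((2 : ℝ) ^ l) :=
      Real.log_le_log (by linarith) (hβD.trans (by exact_mod_cast hl))
    rw [Real.log_pow] at h1
    have := Real.log_two_lt_d9
    have : (0 : ℝ) ≤ l := Nat.cast_nonneg l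
    nlinarith
  have hE0 : (0 : ℝ) < 2 ^ E := by positivity
  have h56 : |φ 56| ≤ 2 ^ E * l + 1 := by
    have h1 : |(φ 56 : ℝ)| ≤ 2 ^ E * l + 1 := by
      have h2 : 2 ^ E * Real.log β ≤ 2 ^ E * l := mul_le_mul_of_nonneg_left hlogl hE0.le
      have h3 : 0 ≤ 2 ^ E * Real.log β := mul_nonneg hE0.le hlog0
      obtain ⟨h4, h5⟩ := abs_le.1 f56
      rw [abs_le]; constructor <;> linarith
    exact_mod_cast h1
  have e23 : φ 23 = π 23 := hφ 23 (by norm_num) (by norm_num)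
  have e24 : φ 24 = π 24 := hφ 24 (by norm_num) (by norm_num)
  refine ⟨⟨I', _, hsq, by rwa [e23, e24], ?_, h56⟩, fun j hj hj' => by
    rw [hφ j (by omega) hj', hπ j (by omega) hj']⟩
  rwa [add_sub_cancel_left]

/-- One `*`-squaring of the ideal whose standard form is in registers `1` and `2`, with a scaled
approximation of the distance in register `5`; register `6` is a counter. -/
def squareProg : Prog :=
  .seq latticeProg <| .seq distanceProg <|
  .seq (asg 5 (lit 2 * reg 5 + reg 56)) <| .seq (asg 1 (reg 23)) <| .seq (asg 2 (reg 24)) <|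
  asg 6 (reg 6 - lit 1)

theorem squareProg_tri [NonsquareRat d] (hd : Squarefree d) (h5 : 5 ≤ disc d) {b : ℕ} (hb : 5 ≤ b)
    {M : ℤ} (hM : (disc d : ℤ) ^ 5 ≤ M) (hMb : M ^ 40 ≤ 2 ^ b) {σ : ℕ → ℤ} {J E l : ℕ}
    (hJ : J = E + 2 * l + 20) (hl : disc d ≤ 2 ^ l) (h0 : σ 0 = disc d)
    (h10 : σ 10 = Nat.sqrt (disc d)) (h50 : σ 50 = 2 ^ (J + E + 4)) (h51 : σ 51 = J)
    (hWM : 2 ^ (J + E + 4) * ((disc d : ℤ) + 4) ≤ M) (h6 : |σ 6 - 1| ≤ 2 ^ b)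
    (hσ5 : 2 * |σ 5| + M ≤ 2 ^ b) {I : FracIdeal d} {γ : QuadField d}
    (h : IsReducedForm I γ (σ 1) (σ 2)) :
    Tri b ((b + 3) * (7 * b + 100)) squareProg σ (fun τ =>
      (∃ (I' : FracIdeal d) (y : ℝ), IsStarSquare (I, Real.log |val γ|) (I', y) ∧
        IsStandardForm I' (τ 1) (τ 2) ∧
        |(τ 5 : ℝ) - 2 * σ 5 - 2 ^ E * (y - 2 * Real.log |val γ|)| ≤ 1 ∧
        |τ 5| ≤ 2 * |σ 5| + 2 ^ E * l + 1) ∧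
      τ 6 = σ 6 - 1 ∧ ∀ j, (j = 0 ∨ j = 3 ∨ j = 4 ∨ j = 10 ∨ j = 46 ∨ j = 50 ∨ j = 51) →
        τ j = σ j) := by
  obtain ⟨D, hD⟩ : ∃ D : ℤ, D = disc d := ⟨_, rfl⟩
  have hD5 : 5 ≤ D := by rw [hD]; exact_mod_cast h5
  rw [← hD] at h0 hM hWM
  have hM32 : 32 ≤ M := by
    refine le_trans ?_ hM
    calc (32 : ℤ) ≤ 5 ^ 5 := by norm_num
      _ ≤ _ := pow_le_pow_left₀ (by norm_num) hD5 5
  have hDM : D ≤ M := by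
    refine le_trans ?_ hM
    simpa using pow_le_pow_right₀ (show 1 ≤ D by linarith) (show 1 ≤ 5 by norm_num)
  refine (Tri.seq (N := 9 * b + 27) (M := (b + 2) * (3 * b + 40) + (b + 1) * (3 * b + 30) + 4)
    (latticeProg_tri hd h5 hb hM32 (by rwa [← hD]) hMb (by rw [h0, hD]) h10 h) ?_).mono
      (by nlinarith) (fun _ _ h => h)
  rintro κ ⟨hdata, ⟨C, hC⟩, hmem, hκ⟩
  refine Tri.seq (distanceProg_tri h5 hb (by rwa [← hD]) hMb hJ hl
    (by rw [hκ 0 (by norm_num) (by norm_num), h0, hD])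
    (by rw [hκ 10 (by norm_num) (by norm_num), h10])
    (by rw [hκ 50 (by norm_num) (by norm_num), h50])
    (by rw [hκ 51 (by norm_num) (by norm_num), h51]) (by rwa [← hD]) hdata hC h.one_eq hmem) ?_
  rintro φ ⟨⟨I', y, hsq, hstd, f56, h56⟩, hφ⟩
  -- The increment of the distance register is within M, since l + 1 ≤ 2^l and the scaling factor
  -- already contains 2^(E + l).
  have h56M : (2 : ℤ) ^ E * l + 1 ≤ M := by
    have h1 : (l : ℤ) + 1 ≤ 2 ^ l := by exact_mod_cast Nat.lt_two_pow_self
    have h2 : (1 : ℤ) ≤ 2 ^ E := one_le_pow₀ (by norm_num)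
    have h3 : (2 : ℤ) ^ E * 2 ^ l ≤ 2 ^ (J + E + 4) := by
      rw [← pow_add]; exact pow_le_pow_right₀ (by norm_num) (by omega)
    have h4 : (2 : ℤ) ^ E * (l + 1) ≤ 2 ^ E * 2 ^ l := mul_le_mul_of_nonneg_left h1 (by positivity)
    have h5 : (2 : ℤ) ^ (J + E + 4) * 1 ≤ 2 ^ (J + E + 4) * (D + 4) :=
      mul_le_mul_of_nonneg_left (by linarith) (by positivity)
    linarith
  have hfl : ∀ j, (j < 11 ∨ 42 < j ∧ j < 52 ∨ 56 < j) → j < 63 → φ j = σ j := fun j hj hj' => by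
    rw [hφ j (by omega) hj', hκ j (by omega) hj']
  have e5 : φ 5 = σ 5 := hfl 5 (by norm_num) (by norm_num)
  have e6 : φ 6 = σ 6 := hfl 6 (by norm_num) (by norm_num)
  have ev : (lit 2 * reg 5 + reg 56 : Ex).eval φ = 2 * σ 5 + φ 56 := by
    rw [Ex.eval_add, Ex.eval_mul, Ex.eval_lit, Ex.eval_reg, Ex.eval_reg, e5]
  have hle5 : |2 * σ 5 + φ 56| ≤ 2 * |σ 5| + 2 ^ E * l + 1 := by
    have h1 := abs_add_le (2 * σ 5) (φ 56)
    rw [abs_mul, abs_two] at h1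
    linarith
  refine Tri.of_bdd fun hbdd => ?_
  refine Tri.asg_seq (M := 3) hb rfl (by decide) (by norm_num) (fun _ => by rw [ev]; linarith) ?_
  rw [ev]
  refine Tri.asg_seq (M := 2) hb rfl (by decide) (by norm_num)
    (fun _ => by simpa [Ex.eval_reg] using hbdd 23 (by norm_num)) ?_
  refine Tri.asg_seq (M := 1) hb rfl (by decide) (by norm_num)
    (fun _ => by simpa [Ex.eval_reg] using hbdd 24 (by norm_num)) ?_
  refine Tri.asg hb rfl (by decide) (by norm_num) (fun _ => ?_) ⟨⟨I', y, hsq, ?_, ?_, ?_⟩, ?_, ?_⟩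
  · rw [Ex.eval_sub, Ex.eval_reg, Ex.eval_lit]
    simpa [e6] using h6
  · simpa [Ex.eval_reg] using hstd
  · simpa using f56
  · simpa using hle5
  · simp [Ex.eval_sub, Ex.eval_reg, Ex.eval_lit, e6]
  · intro j hj
    rw [Function.update_of_ne (by omega), Function.update_of_ne (by omega),
      Function.update_of_ne (by omega), Function.update_of_ne (by omega), hfl j (by omega) (by omega)]

/-! ### Existence and uniqueness of the iterated `*`-squares -/

theorem exists_isReducedForm [NonsquareRat d] (hd0 : 0 < d) {I : FracIdeal d} {x : ℝ}
    (hI : IsReducedPrincipal I) (hx : IsDistance I x) :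
    ∃ γ a b, IsReducedForm I γ a b ∧ x = Real.log |val γ| := by
  obtain ⟨γ, hγ, rfl⟩ := hx
  obtain ⟨a, b, hab⟩ := exists_isStandardForm hd0 hγ hI.2
  exact ⟨γ, a, b, ⟨hγ, hI.2, hab⟩, rfl⟩

/-- A run of `squareProg` from suitable registers ends, and its postcondition provides the
`*`-square. Precision does not matter here, so E = 0 and l = D will do. -/
theorem exists_starSquare (hd : Squarefree d) (h1 : 1 < d) {p : FracIdeal d × ℝ}
    (hI : IsReducedPrincipal p.1) (hx : IsDistance p.1 p.2) : ∃ q, IsStarSquare p q := by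
  obtain ⟨I, x⟩ := p
  have := nonsquareRat hd h1
  obtain ⟨γ, a, b, h, hxγ⟩ := exists_isReducedForm (by omega) hI hx
  have h5 := five_le_disc h1
  obtain ⟨D, hD⟩ : ∃ D : ℤ, D = disc d := ⟨_, rfl⟩
  have hD5 : 5 ≤ D := by rw [hD]; exact_mod_cast h5
  obtain ⟨J, hJ⟩ : ∃ J : ℕ, J = 0 + 2 * disc d + 20 := ⟨_, rfl⟩
  obtain ⟨M, hM⟩ : ∃ M : ℤ, M = D ^ 5 * (2 ^ (J + 0 + 4) * (D + 4)) := ⟨_, rfl⟩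
  have hD1 : 1 ≤ D ^ 5 := one_le_pow₀ (by linarith)
  have hW1 : (1 : ℤ) ≤ 2 ^ (J + 0 + 4) := one_le_pow₀ (by norm_num)
  have hW1' : (1 : ℤ) ≤ 2 ^ (J + 0 + 4) * (D + 4) := by nlinarith
  have hDM : D ^ 5 ≤ M := by rw [hM]; exact le_mul_of_one_le_right (by linarith) hW1'
  have hWM : 2 ^ (J + 0 + 4) * (D + 4) ≤ M := by
    rw [hM]; exact le_mul_of_one_le_left (by linarith) hD1
  have hM0 : 0 ≤ M := by linarith
  set σ : ℕ → ℤ := fun i => if i = 0 then D else if i = 1 then a else if i = 2 then b else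
    if i = 10 then (Nat.sqrt (disc d) : ℤ) else if i = 50 then 2 ^ (J + 0 + 4) else
    if i = 51 then (J : ℤ) else 0 with hσ
  -- A crude bit bound that dominates all initial registers, M and M⁴⁰; the cost of this run is
  -- irrelevant.
  obtain ⟨c, hc⟩ : ∃ c : ℕ, c = (∑ i ∈ Finset.range 64, (σ i).natAbs) + (M ^ 40).toNat + M.toNat + 5 :=
    ⟨_, rfl⟩
  have hc2 : (c : ℤ) ≤ 2 ^ c := by exact_mod_cast Nat.lt_two_pow_self.le
  have hbdd : Bdd c σ := by
    intro i hi
    have : (σ i).natAbs ≤ ∑ i ∈ Finset.range 64, (σ i).natAbs :=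
      Finset.single_le_sum (f := fun i => (σ i).natAbs) (fun _ _ => Nat.zero_le _)
        (Finset.mem_range.2 hi)
    rw [Int.abs_eq_natAbs]
    have h2 : ((σ i).natAbs : ℤ) ≤ c := by exact_mod_cast (by omega)
    linarith
  have hMc : M ≤ 2 ^ c := by
    have := Int.toNat_of_nonneg hM0
    omega
  have hM40 : M ^ 40 ≤ 2 ^ c := by
    have := Int.toNat_of_nonneg (pow_nonneg hM0 40)
    omega
  have htri := squareProg_tri (γ := γ) (I := I) hd h5 (b := c) (by omega) (σ := σ) (M := M) (J := J)
    (E := 0) (l := disc d) (by rwa [← hD]) hM40 hJ Nat.lt_two_pow_self.le (by simp [hσ, hD])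
    (by simp [hσ]) (by simp [hσ]) (by simp [hσ]) (by rwa [← hD])
    (by simp only [hσ]; norm_num; exact one_le_pow₀ (by norm_num))
    (by simpa [hσ] using hMc) (by simpa [hσ] using h)
  obtain ⟨τ, τ', T, -, -, -, -, ⟨I', y, hsq, -⟩, -⟩ := htri σ (fun _ _ => rfl) hbdd
  exact ⟨(I', y), by rwa [show x = _ from hxγ]⟩

theorem IsStarSequence.isReducedPrincipal {I : FracIdeal d} {x : ℝ} {s : ℕ → FracIdeal d × ℝ}
    (hs : IsStarSequence I x s) (hI : IsReducedPrincipal I) (hx : IsDistance I x) (n : ℕ) :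
    IsReducedPrincipal (s n).1 ∧ IsDistance (s n).1 (s n).2 := by
  cases n with
  | zero => rw [hs.1]; exact ⟨hI, hx⟩
  | succ n => exact ⟨(hs.2 n).1, (hs.2 n).2.1⟩

theorem IsStarSequence.lt {I : FracIdeal d} {x : ℝ} {s : ℕ → FracIdeal d × ℝ}
    (hs : IsStarSequence I x s) {n : ℕ} (hn : 1 ≤ n) : 2 ^ n * x < (s n).2 := by
  induction n, hn using Nat.le_induction with
  | base =>
    have := (hs.2 0).2.2.1
    rw [hs.1] at this
    simpa using this
  | succ n hn ih =>
    have := (hs.2 n).2.2.1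
    rw [pow_succ]
    linarith

theorem existsUnique_isStarSequence (hd : Squarefree d) (h1 : 1 < d) {I : FracIdeal d} {x : ℝ}
    (hI : IsReducedPrincipal I) (hx : IsDistance I x) :
    ∃! s : ℕ → FracIdeal d × ℝ, IsStarSequence I x s := by
  have := nonsquareRat hd h1
  have hex : ∀ p : {p : FracIdeal d × ℝ // IsReducedPrincipal p.1 ∧ IsDistance p.1 p.2},
      ∃ q : {p : FracIdeal d × ℝ // IsReducedPrincipal p.1 ∧ IsDistance p.1 p.2},
        IsStarSquare p.1 q.1 := fun p => by
    obtain ⟨q, hq⟩ := exists_starSquare hd h1 p.2.1 p.2.2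
    exact ⟨⟨q, hq.1, hq.2.1⟩, hq⟩
  choose f hf using hex
  refine ⟨fun n => (f^[n] ⟨(I, x), hI, hx⟩).1, ⟨rfl, fun k => ?_⟩, fun s hs => ?_⟩
  · simp only [Function.iterate_succ_apply']
    exact hf _
  · funext n
    induction n with
    | zero => exact hs.1
    | succ n ih =>
      have h2 := hs.2 n
      rw [ih] at h2
      simp only [Function.iterate_succ_apply']
      exact h2.unique (hf _)

/-! ### The main program -/

/-- The precomputation: the integer square root of `D`, the binary length of `D`, and the scaling
factor for the logarithms. -/
def setupProg : Prog :=
  .seq (asg 40 (reg 0)) <| .seq sqrtProg <| .seq (asg 10 (reg 41)) <| .seq lenProg <|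
  .seq (asg 51 (reg 3 + reg 4 + lit 22 + lit 2 * reg 46)) <|
  .seq (asg 43 (reg 51 + reg 3 + reg 4 + lit 6)) <| .seq powProg <| .seq (asg 50 (reg 44)) <|
  asg 6 (reg 3)

/-- In terms of E = n + m + 2, register 51 holds J = E + 2l + 20 and register 50 holds 2^(J+E+4),
the parameters of `logProg`. -/
theorem setupProg_tri {b : ℕ} (hb : 5 ≤ b) {σ : ℕ → ℤ} {D n m : ℕ} (h0 : σ 0 = D) (h1 : 1 ≤ D)
    (hDb : 2 * (D : ℤ) ≤ 2 ^ b) (h3 : σ 3 = n) (h4 : σ 4 = m)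
    (hlb : ∀ l : ℕ, 2 ^ l < 2 * D → n + m + 22 + 2 * l + n + m + 6 ≤ b) :
    Tri b (10 * b + 30) setupProg σ (fun τ => (∃ l : ℕ, D ≤ 2 ^ l ∧ 2 ^ l < 2 * D ∧
      τ 51 = (n + m + 22 + 2 * l : ℕ) ∧ τ 50 = 2 ^ (n + m + 22 + 2 * l + n + m + 6)) ∧
      τ 10 = Nat.sqrt D ∧ τ 6 = n ∧ ∀ j < 6, τ j = σ j) := by
  have hsmall : ∀ k : ℕ, k ≤ b → |(k : ℤ)| ≤ 2 ^ b := fun k hk => by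
    rw [Nat.abs_cast]
    have : (b : ℤ) ≤ 2 ^ b := by exact_mod_cast Nat.lt_two_pow_self.le
    have : (k : ℤ) ≤ b := by exact_mod_cast hk
    linarith
  refine (Tri.asg_seq (M := (3 * b + 6) + ((4 * b + 8) + ((3 * b + 6) + (1 + 1) + 1 + 1) + 1)) hb rfl
    (by decide) (by norm_num) (fun hbdd => hbdd 0 (by norm_num)) ?_).mono (by omega) (fun _ _ h => h)
  rw [Ex.eval_reg, h0]
  refine Tri.seq (sqrtProg_tri hb (X := D) (by simp)) ?_
  rintro ρ ⟨r41, hρ⟩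
  have hρ' : ∀ j, j < 40 → ρ j = σ j := fun j hj => by
    rw [hρ j (by omega) (by omega), Function.update_of_ne (by omega)]
  refine Tri.asg_seq hb rfl (by decide) (by norm_num) (fun hbdd => hbdd 41 (by norm_num)) ?_
  rw [Ex.eval_reg, r41]
  refine Tri.seq (lenProg_tri hb (D := D)
    (by rw [Function.update_of_ne (by norm_num), hρ' 0 (by norm_num), h0]) h1 hDb) ?_
  rintro κ ⟨⟨l, k46, hl1, hl2⟩, hκ⟩
  have hb' := hlb l hl2
  have hκ' : ∀ j, j < 10 → κ j = σ j := fun j hj => by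
    rw [hκ j (by omega) (by omega) (by omega), Function.update_of_ne (by omega), hρ' j (by omega)]
  have k10 : κ 10 = Nat.sqrt D := by
    rw [hκ 10 (by norm_num) (by norm_num) (by norm_num), Function.update_self]
  have k3 : κ 3 = n := by rw [hκ' 3 (by norm_num), h3]
  have k4 : κ 4 = m := by rw [hκ' 4 (by norm_num), h4]
  have e51 : (reg 3 + reg 4 + lit 22 + lit 2 * reg 46 : Ex).eval κ = (n + m + 22 + 2 * l : ℕ) := by
    simp only [Ex.eval_add, Ex.eval_mul, Ex.eval_reg, Ex.eval_lit, k3, k4, k46]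
    push_cast; ring
  refine Tri.asg_seq (M := (3 * b + 6) + (1 + 1) + 1) hb rfl (by decide) (by norm_num)
    (fun _ => by rw [e51]; exact hsmall _ (by omega)) ?_
  rw [e51]
  obtain ⟨F, hF⟩ : ∃ F, F = n + m + 22 + 2 * l + n + m + 6 := ⟨_, rfl⟩
  rw [← hF] at hb'
  have e43 : (reg 51 + reg 3 + reg 4 + lit 6 : Ex).eval
      (Function.update κ 51 ((n + m + 22 + 2 * l : ℕ) : ℤ)) = F := by
    simp only [Ex.eval_add, Ex.eval_reg, Ex.eval_lit, Function.update_apply]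
    simp [k3, k4, hF]
  refine Tri.asg_seq (M := (3 * b + 6) + (1 + 1)) hb rfl (by decide) (by norm_num)
    (fun _ => by rw [e43]; exact hsmall _ hb') ?_
  rw [e43]
  refine Tri.seq (powProg_tri hb (n := F) (by rw [Function.update_self]) hb') ?_
  rintro φ ⟨f44, hφ⟩
  have hφ' : ∀ j, j ≤ 10 → φ j = κ j := fun j hj => by
    rw [hφ j (by omega) (by omega), Function.update_of_ne (by omega),
      Function.update_of_ne (by omega)]
  have f51 : φ 51 = (n + m + 22 + 2 * l : ℕ) := by
    rw [hφ 51 (by norm_num) (by norm_num), Function.update_of_ne (by norm_num),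
      Function.update_self]
  refine Tri.asg_seq hb rfl (by decide) (by norm_num) (fun hbdd => hbdd 44 (by norm_num)) ?_
  refine Tri.asg hb rfl (by decide) (by norm_num) (fun hbdd => hbdd 3 (by norm_num)) ?_
  refine ⟨⟨l, hl1, hl2, ?_, ?_⟩, ?_, ?_, fun j hj => ?_⟩
  · simp [f51]
  · simp [Ex.eval_reg, f44, hF]
  · simp [hφ', k10]
  · simp [Ex.eval_reg, hφ', k3]
  · rw [Function.update_of_ne (by omega), Function.update_of_ne (by omega), hφ' j (by omega),
      hκ' j (by omega)]

/-- The iterated `*`-squaring: the standard form in registers `1`, `2` is replaced by that of the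
iterated `*`-square, the scaled distance in register `5` accordingly. -/
def mainProg : Prog := .seq setupProg (.loop 6 squareProg)

/-- If the register for the distance is off by e, it is off by at most 2e + 1 after one squaring.
Apart from 2^i times the initial error this accumulates to 2^i - 1. Its size obeys a similar
recursion, so |T| + 2^K at most doubles in each pass. -/
theorem mainProg_tri (hd : Squarefree d) (h1 : 1 < d) {I : FracIdeal d} {x : ℝ}
    (hI : IsReducedPrincipal I) (hx : IsDistance I x) {s : ℕ → FracIdeal d × ℝ}
    (hs : IsStarSequence I x s) {b k w n m : ℕ} (hk : disc d ≤ 2 ^ k) {σ : ℕ → ℤ}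
    (hw : |σ 5| ≤ 2 ^ w) (hb : n + w + 40 * (2 * (n + m + 2) + 5 * k + 25) + 5 ≤ b)
    (h0 : σ 0 = disc d) (h3 : σ 3 = n) (h4 : σ 4 = m) (hstd : IsStandardForm I (σ 1) (σ 2)) :
    Tri b (10 * b + 31 + n * ((b + 3) * (7 * b + 100) + 1)) mainProg σ (fun τ =>
      IsStandardForm (s n).1 (τ 1) (τ 2) ∧ τ 3 = n ∧ τ 4 = m ∧ |τ 5| + 2 ^ (n + 2) ≤ 2 ^ b ∧
      |(τ 5 : ℝ) - 2 ^ (n + m + 2) * (s n).2 - 2 ^ n * (σ 5 - 2 ^ (n + m + 2) * x)| ≤ 2 ^ n - 1) := by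
  have := nonsquareRat hd h1
  have h5 := five_le_disc h1
  have h5b : 5 ≤ b := by omega
  obtain ⟨D, hD⟩ : ∃ D : ℤ, D = disc d := ⟨_, rfl⟩
  have hD5 : 5 ≤ D := by rw [hD]; exact_mod_cast h5
  have hDk : D ≤ 2 ^ k := by rw [hD]; exact_mod_cast hk
  have hlk : ∀ l : ℕ, 2 ^ l < 2 * disc d → l ≤ k := fun l hl => by
    have : 2 ^ l < 2 ^ (k + 1) := by rw [pow_succ]; omega
    have := (Nat.pow_lt_pow_iff_right (by norm_num)).1 this
    omega
  -- M = 2^K dominates D⁵ ≤ 2^(5k) and 2^(J+E+4)(D + 4) ≤ 2^(2E+3k+25). The factor 40 in the bound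
  -- for b reflects the requirement M⁴⁰ ≤ 2^b.
  obtain ⟨K, hK⟩ : ∃ K, K = 2 * (n + m + 2) + 5 * k + 25 := ⟨_, rfl⟩
  rw [← hK] at hb
  have hM : D ^ 5 ≤ 2 ^ K := by
    calc D ^ 5 ≤ (2 ^ k) ^ 5 := pow_le_pow_left₀ (by linarith) hDk 5
      _ = 2 ^ (k * 5) := by rw [pow_mul]
      _ ≤ _ := pow_le_pow_right₀ (by norm_num) (by omega)
  have hMb : ((2 : ℤ) ^ K) ^ 40 ≤ 2 ^ b := by
    rw [← pow_mul]; exact pow_le_pow_right₀ (by norm_num) (by omega)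
  have h2pow : ∀ i, i ≤ b → (2 : ℤ) ^ i ≤ 2 ^ b := fun i hi => pow_le_pow_right₀ (by norm_num) hi
  have hTb : (2 : ℤ) ^ (n + 1) * (2 ^ w + 2 ^ K) + 2 ^ K ≤ 2 ^ b := by
    have h6 : (2 : ℤ) ^ w ≤ 2 ^ (w + K) := pow_le_pow_right₀ (by norm_num) (by omega)
    have h7 : (2 : ℤ) ^ K ≤ 2 ^ (w + K) := pow_le_pow_right₀ (by norm_num) (by omega)
    have h8 : (1 : ℤ) ≤ 2 ^ (n + 1) := one_le_pow₀ (by norm_num)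
    calc (2 : ℤ) ^ (n + 1) * (2 ^ w + 2 ^ K) + 2 ^ K
        ≤ 2 ^ (n + 1) * (2 ^ (w + K) + 2 ^ (w + K)) + 2 ^ (n + 1) * 2 ^ (w + K) := by
          refine add_le_add (mul_le_mul_of_nonneg_left (by linarith) (by positivity)) ?_
          exact h7.trans (le_mul_of_one_le_left (by positivity) h8)
      _ ≤ 2 ^ (n + 1) * 2 ^ (w + K) * 4 := by
          have : (0 : ℤ) < 2 ^ (n + 1) * 2 ^ (w + K) := by positivity
          linarith
      _ = 2 ^ (n + 1 + (w + K) + 2) := by ring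
      _ ≤ _ := h2pow _ (by omega)
  have hDb : 2 * (disc d : ℤ) ≤ 2 ^ b := by
    rw [← hD]
    calc 2 * D ≤ 2 * 2 ^ k := by linarith
      _ = 2 ^ (k + 1) := by ring
      _ ≤ _ := h2pow _ (by omega)
  refine (Tri.seq (N := 10 * b + 30) (M := n * ((b + 3) * (7 * b + 100) + 1) + 1)
    (setupProg_tri h5b h0 (by omega) hDb h3 h4
    (fun l hl => by have := hlk l hl; omega)) ?_).mono (by omega) (fun _ _ h => h)
  rintro τ₀ ⟨⟨l, hl1, hl2, t51, t50⟩, t10, t6, ht⟩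
  have hl := hlk l hl2
  obtain ⟨E, hE⟩ : ∃ E, E = n + m + 2 := ⟨_, rfl⟩
  obtain ⟨J, hJ⟩ : ∃ J, J = E + 2 * l + 20 := ⟨_, rfl⟩
  have hJ' : n + m + 22 + 2 * l = J := by omega
  have hF' : n + m + 22 + 2 * l + n + m + 6 = J + E + 4 := by omega
  rw [hJ'] at t51
  rw [hF'] at t50
  rw [← hE]
  have hWM : 2 ^ (J + E + 4) * (D + 4) ≤ 2 ^ K := by
    calc 2 ^ (J + E + 4) * (D + 4) ≤ 2 ^ (J + E + 4) * 2 ^ (k + 1) := by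
          refine mul_le_mul_of_nonneg_left ?_ (by positivity)
          rw [pow_succ]; linarith
      _ = 2 ^ (J + E + 4 + (k + 1)) := by rw [← pow_add]
      _ ≤ _ := pow_le_pow_right₀ (by norm_num) (by omega)
  have hlM : (2 : ℤ) ^ E * l + 1 ≤ 2 ^ K := by
    have h6 : (l : ℤ) + 1 ≤ 2 ^ l := by exact_mod_cast Nat.lt_two_pow_self
    have h7 : (1 : ℤ) ≤ 2 ^ E := one_le_pow₀ (by norm_num)
    calc (2 : ℤ) ^ E * l + 1 ≤ 2 ^ E * (l + 1) := by linarith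
      _ ≤ 2 ^ E * 2 ^ l := mul_le_mul_of_nonneg_left h6 (by positivity)
      _ = 2 ^ (E + l) := by rw [pow_add]
      _ ≤ _ := pow_le_pow_right₀ (by norm_num) (by omega)
  refine (Tri.loop (K := n) (N := (b + 3) * (7 * b + 100)) h5b (by norm_num) (fun i τ => i ≤ n ∧
    τ 6 = n - i ∧ IsStandardForm (s i).1 (τ 1) (τ 2) ∧
    |(τ 5 : ℝ) - 2 ^ E * (s i).2 - 2 ^ i * (σ 5 - 2 ^ E * x)| ≤ 2 ^ i - 1 ∧
    |τ 5| + 2 ^ K ≤ 2 ^ i * (2 ^ w + 2 ^ K) ∧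
    ∀ j, (j = 0 ∨ j = 3 ∨ j = 4 ∨ j = 10 ∨ j = 46 ∨ j = 50 ∨ j = 51) → τ j = τ₀ j)
      ?_ ?_ ?_).mono le_rfl ?_
  · refine ⟨Nat.zero_le _, by simp [t6], ?_, ?_, ?_, fun _ _ => rfl⟩
    · rw [hs.1, ht 1 (by norm_num), ht 2 (by norm_num)]; exact hstd
    · rw [hs.1, ht 5 (by norm_num)]; simp
    · rw [ht 5 (by norm_num), pow_zero, one_mul]; linarith
  · rintro i τ - ⟨i1, i2, -⟩ hp
    omega
  · rintro i τ - ⟨i1, i2, i3, i4, i5, i6⟩ hp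
    obtain ⟨γ, _, _, hform, hγ⟩ := exists_isReducedForm (by omega)
      (hs.isReducedPrincipal hI hx i).1 (hs.isReducedPrincipal hI hx i).2
    have hform' : IsReducedForm (s i).1 γ (τ 1) (τ 2) := ⟨hform.one_eq, hform.isMin, i3⟩
    have hipow : (2 : ℤ) ^ i * (2 ^ w + 2 ^ K) ≤ 2 ^ n * (2 ^ w + 2 ^ K) :=
      mul_le_mul_of_nonneg_right (pow_le_pow_right₀ (by norm_num) i1) (by positivity)
    have hnpow : (2 : ℤ) ^ (n + 1) * (2 ^ w + 2 ^ K) = 2 * (2 ^ n * (2 ^ w + 2 ^ K)) := by ring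
    have hK0 : (0 : ℤ) < 2 ^ K := by positivity
    refine (squareProg_tri (M := 2 ^ K) hd h5 h5b (by rwa [← hD]) hMb hJ hl1
      (by rw [i6 0 (by norm_num), ht 0 (by norm_num), h0])
      (by rw [i6 10 (by norm_num), t10]) (by rw [i6 50 (by norm_num), t50])
      (by rw [i6 51 (by norm_num), t51]) (by rwa [← hD]) ?_ ?_ hform').mono le_rfl ?_
    · rw [abs_of_nonneg (by linarith)]
      have : (b : ℤ) ≤ 2 ^ b := by exact_mod_cast Nat.lt_two_pow_self.le
      omega
    · linarith
    · rintro ρ - ⟨⟨I', y, hsq, hstd', hap, hle⟩, r6, hρ⟩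
      -- The program yields some `*`-square; uniqueness identifies it with the next member of the
      -- given sequence.
      have heq : (I', y) = s (i + 1) := by
        refine hsq.unique ?_
        rw [← hγ]
        exact hs.2 i
      rw [← heq]
      refine ⟨by omega, by rw [r6, i2]; push_cast; ring, hstd', ?_, ?_, fun j hj => by
        rw [hρ j hj, i6 j hj]⟩
      · rw [← hγ] at hap
        have e : (ρ 5 : ℝ) - 2 ^ E * y - 2 ^ (i + 1) * (σ 5 - 2 ^ E * x)
            = ((ρ 5 : ℝ) - 2 * τ 5 - 2 ^ E * (y - 2 * (s i).2)) +
              2 * ((τ 5 : ℝ) - 2 ^ E * (s i).2 - 2 ^ i * (σ 5 - 2 ^ E * x)) := by ring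
        have h6 := abs_add_le ((ρ 5 : ℝ) - 2 * τ 5 - 2 ^ E * (y - 2 * (s i).2))
          (2 * ((τ 5 : ℝ) - 2 ^ E * (s i).2 - 2 ^ i * (σ 5 - 2 ^ E * x)))
        rw [abs_mul, abs_two] at h6
        simp only
        rw [e, pow_succ]
        linarith
      · rw [pow_succ]
        linarith
  · rintro τ - ⟨⟨i, -, i1, i2, i3, i4, i5, i6⟩, hle⟩
    have : i = n := by omega
    subst this
    refine ⟨i3, by rw [i6 3 (by norm_num), ht 3 (by norm_num), h3],
      by rw [i6 4 (by norm_num), ht 4 (by norm_num), h4], ?_, i4⟩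
    have h6 : (2 : ℤ) ^ (i + 1) * (2 ^ w + 2 ^ K) = 2 ^ i * (2 ^ w + 2 ^ K) + 2 ^ i * (2 ^ w + 2 ^ K) := by
      ring
    have h7 : (2 : ℤ) ^ (i + 2) ≤ 2 ^ i * (2 ^ w + 2 ^ K) := by
      rw [pow_add]
      refine mul_le_mul_of_nonneg_left ?_ (by positivity)
      have : (2 : ℤ) ^ 2 ≤ 2 ^ K := pow_le_pow_right₀ (by norm_num) (by omega)
      have : (0 : ℤ) < 2 ^ w := by positivity
      linarith
    have hK0 : (0 : ℤ) < 2 ^ K := by positivity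
    linarith

/-! ### The cost of the algorithms -/

/-- With b = O(X), a number N = O(b³) of units, each of O(b²) bit operations, costs O(X⁵). Since X ≥
1, one large C serves both as coefficient and as exponent. -/
theorem exists_cost_bound : ∃ C : ℕ, ∀ (b N : ℕ) (X : ℝ), 1 ≤ X → (b : ℝ) + 10 ≤ 2000 * X →
    N ≤ 20 * (b + 10) ^ 3 → ((N * unitCost b : ℕ) : ℝ) ≤ C * X ^ C := by
  obtain ⟨C, hC5, hC⟩ : ∃ C : ℕ, 5 ≤ C ∧ (20 * 130 * 1600 * 2000 ^ 5 : ℝ) ≤ C :=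
    ⟨20 * 130 * 1600 * 2000 ^ 5, by norm_num, by norm_num⟩
  refine ⟨C, fun b N X hX hb hN => ?_⟩
  have h1 : N * unitCost b ≤ 20 * (b + 10) ^ 3 * (130 * (1600 * (b + 10) ^ 2)) := by
    refine Nat.mul_le_mul hN (Nat.mul_le_mul_left _ ?_)
    calc (40 * b + 2) ^ 2 ≤ (40 * (b + 10)) ^ 2 := Nat.pow_le_pow_left (by omega) 2
      _ = 1600 * (b + 10) ^ 2 := by ring
  have hb0 : (0 : ℝ) ≤ b := Nat.cast_nonneg b
  calc ((N * unitCost b : ℕ) : ℝ)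
      ≤ ((20 * (b + 10) ^ 3 * (130 * (1600 * (b + 10) ^ 2)) : ℕ) : ℝ) := by exact_mod_cast h1
    _ = 20 * 130 * 1600 * ((b : ℝ) + 10) ^ 5 := by push_cast; ring
    _ ≤ 20 * 130 * 1600 * (2000 * X) ^ 5 :=
        mul_le_mul_of_nonneg_left (pow_le_pow_left₀ (by linarith) hb 5) (by norm_num)
    _ = (20 * 130 * 1600 * 2000 ^ 5) * X ^ 5 := by ring
    _ ≤ C * X ^ C := mul_le_mul hC (pow_le_pow_right₀ hX hC5) (by positivity) (by positivity)

theorem exists_le_two_pow {y : ℝ} (hy : 1 ≤ y) : ∃ k : ℕ, y ≤ 2 ^ k ∧ (k : ℝ) ≤ 2 * Real.log y + 1 := by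
  have h2 := Real.log_two_gt_d9
  have hl := Real.log_nonneg hy
  refine ⟨⌈Real.log y / Real.log 2⌉₊, ?_, ?_⟩
  · rw [← Real.log_le_log_iff (by linarith) (by positivity), Real.log_pow, ← div_le_iff₀ (by linarith)]
    exact Nat.le_ceil _
  · refine (Nat.ceil_lt_add_one (by positivity)).le.trans ?_
    have : Real.log y / Real.log 2 ≤ 2 * Real.log y := by
      rw [div_le_iff₀ (by linarith)]; nlinarith
    linarith

theorem abs_initRegs_le {B : ℤ} (hB : 0 ≤ B) {inputs : List ℤ} (h : ∀ z ∈ inputs, |z| ≤ B) (i : ℕ) :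
    |initRegs inputs i| ≤ B := by
  unfold initRegs
  by_cases hi : i < inputs.length
  · rw [List.getD_eq_getElem _ _ hi]; exact h _ (List.getElem_mem hi)
  · rw [List.getD_eq_default _ _ (not_lt.1 hi), abs_zero]; exact hB

theorem one_le_log_disc (h5 : 5 ≤ disc d) : 1 ≤ Real.log (disc d) := by
  have h : (5 : ℝ) ≤ disc d := by exact_mod_cast h5
  rw [Real.le_log_iff_exp_le (by linarith)]
  linarith [Real.exp_one_lt_d9]

/-! ### The two algorithms and their correctness. -/

/-- The algorithm for the standard form of the iterated `*`-square. -/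
def idealProg : Prog := .seq mainProg <| .seq (asg 0 (reg 1)) (asg 1 (reg 2))

/-- The main program is run with m = 0 and 0 in place of the scaled distance. The ideals do not
depend on register 5, whose content is meaningless here but stays bounded. -/
theorem idealProg_tri (hd : Squarefree d) (h1 : 1 < d) {I : FracIdeal d} {x : ℝ}
    (hI : IsReducedPrincipal I) (hx : IsDistance I x) {s : ℕ → FracIdeal d × ℝ}
    (hs : IsStarSequence I x s) {b k n : ℕ} (hk : disc d ≤ 2 ^ k) {σ : ℕ → ℤ}
    (hb : n + 0 + 40 * (2 * (n + 0 + 2) + 5 * k + 25) + 5 ≤ b)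
    (h0 : σ 0 = disc d) (h3 : σ 3 = n) (h4 : σ 4 = 0) (h5 : σ 5 = 0)
    (hstd : IsStandardForm I (σ 1) (σ 2)) :
    Tri b (20 * (b + 10) ^ 3) idealProg σ (fun τ => IsStandardForm (s n).1 (τ 0) (τ 1)) := by
  have hb5 : 5 ≤ b := by omega
  have hn : n * ((b + 3) * (7 * b + 100) + 1) ≤ b * ((b + 3) * (7 * b + 100) + 1) :=
    Nat.mul_le_mul_right _ (by omega)
  refine (Tri.seq (mainProg_tri hd h1 hI hx hs (m := 0) (w := 0) hk (by simp [h5]) hb h0 h3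
    (by simpa using h4) hstd) (M := 2) ?_).mono (by nlinarith) (fun _ _ h => h)
  rintro τ ⟨hstd', -⟩
  refine Tri.of_bdd fun hbdd => ?_
  refine Tri.asg_seq (M := 1) hb5 rfl (by decide) (by norm_num) (fun _ => hbdd 1 (by norm_num)) ?_
  refine Tri.asg hb5 rfl (by decide) (by norm_num)
    (fun _ => by simpa [Ex.eval_reg] using hbdd 2 (by norm_num)) ?_
  simpa [Ex.eval_reg] using hstd'

/-- The algorithm for the unreduced distance of the iterated `*`-square. -/
def unreducedDistanceProg : Prog :=
  .seq mainProg <| .seq (asg 43 (reg 3 + lit 1)) <| .seq powProg <|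
    asg 0 ((reg 5 + reg 44) / (lit 2 * reg 44))

/-- In units of 2^-(n+m+2) the tolerance 2^-m is 2^(n+2). The error of T is below half of it, and
rounding T / 2^(n+2) to the nearest integer uses at most the other half. -/
theorem abs_sub_round_le {y : ℝ} {T : ℤ} {n m : ℕ}
    (h : |(T : ℝ) - 2 ^ (n + m + 2) * y| ≤ 2 ^ (n + 1) - 1) :
    |y - ((T + 2 ^ (n + 1)) / (2 * 2 ^ (n + 1)) : ℤ) / 2 ^ m| ≤ 1 / 2 ^ m := by
  obtain ⟨q, hq⟩ : ∃ q : ℤ, q = (T + 2 ^ (n + 1)) / (2 * 2 ^ (n + 1)) := ⟨_, rfl⟩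
  have q1 : 2 * 2 ^ (n + 1) * q ≤ T + 2 ^ (n + 1) := by
    rw [hq]; exact Int.mul_ediv_self_le (by positivity)
  have q2 : T + 2 ^ (n + 1) < 2 * 2 ^ (n + 1) * q + 2 * 2 ^ (n + 1) := by
    rw [hq]; exact Int.lt_mul_ediv_self_add (by positivity)
  rw [← hq]
  have q1' : (2 * 2 ^ (n + 1) * q : ℝ) ≤ T + 2 ^ (n + 1) := by exact_mod_cast q1
  have q2' : (T : ℝ) + 2 ^ (n + 1) < 2 * 2 ^ (n + 1) * q + 2 * 2 ^ (n + 1) := by exact_mod_cast q2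
  obtain ⟨P, hP⟩ : ∃ P : ℝ, P = 2 ^ (n + 1) := ⟨_, rfl⟩
  have hE : (2 : ℝ) ^ (n + m + 2) = 2 * P * 2 ^ m := by rw [hP]; ring
  have hP0 : 0 < P := by rw [hP]; positivity
  have hm0 : (0 : ℝ) < 2 ^ m := by positivity
  rw [hE] at h
  rw [← hP] at h q1' q2'
  obtain ⟨a1, a2⟩ := abs_le.1 h
  have e : y - q / 2 ^ m = (2 ^ m * y - q) / 2 ^ m := by field_simp
  rw [e, abs_div, abs_of_pos hm0]
  refine div_le_div_of_nonneg_right ?_ hm0.le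
  rw [abs_le]
  constructor
  · refine le_of_mul_le_mul_left (a := 2 * P) ?_ (by linarith)
    linarith
  · refine le_of_mul_le_mul_left (a := 2 * P) ?_ (by linarith)
    linarith

theorem unreducedDistanceProg_tri (hd : Squarefree d) (h1 : 1 < d) {I : FracIdeal d} {x : ℝ}
    (hI : IsReducedPrincipal I) (hx : IsDistance I x) {s : ℕ → FracIdeal d × ℝ}
    (hs : IsStarSequence I x s) {b k w n m : ℕ} (hk : disc d ≤ 2 ^ k) {σ : ℕ → ℤ}
    (hw : |σ 5| ≤ 2 ^ w) (hb : n + w + 40 * (2 * (n + m + 2) + 5 * k + 25) + 5 ≤ b)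
    (h0 : σ 0 = disc d) (h3 : σ 3 = n) (h4 : σ 4 = m) (hstd : IsStandardForm I (σ 1) (σ 2))
    (hap : |(σ 5 : ℝ) - 2 ^ (n + m + 2) * x| ≤ 1) :
    Tri b (20 * (b + 10) ^ 3) unreducedDistanceProg σ
      (fun τ => |(s n).2 - (τ 0 : ℝ) / 2 ^ m| ≤ 1 / 2 ^ m) := by
  have hb5 : 5 ≤ b := by omega
  have hn : n * ((b + 3) * (7 * b + 100) + 1) ≤ b * ((b + 3) * (7 * b + 100) + 1) :=
    Nat.mul_le_mul_right _ (by omega)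
  refine (Tri.seq (mainProg_tri hd h1 hI hx hs hk hw hb h0 h3 h4 hstd)
    (M := (3 * b + 6) + 1 + 1) ?_).mono ?_ (fun _ _ h => h)
  swap
  · have e : 20 * (b + 10) ^ 3 = 10 * b + 31 + b * ((b + 3) * (7 * b + 100) + 1) + (3 * b + 6 + 1 + 1)
        + (13 * b ^ 3 + 479 * b ^ 2 + 5686 * b + 19961) := by ring
    omega
  rintro τ ⟨-, t3, t4, t5, hT⟩
  have e43 : (reg 3 + lit 1 : Ex).eval τ = (n + 1 : ℕ) := by
    rw [Ex.eval_add, Ex.eval_reg, Ex.eval_lit, t3]; push_cast; rfl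
  refine Tri.asg_seq (M := (3 * b + 6) + 1) hb5 rfl (by decide) (by norm_num) (fun _ => ?_) ?_
  · rw [e43, Nat.abs_cast]
    have : (b : ℤ) ≤ 2 ^ b := by exact_mod_cast Nat.lt_two_pow_self.le
    have : ((n + 1 : ℕ) : ℤ) ≤ b := by exact_mod_cast (by omega)
    linarith
  rw [e43]
  refine Tri.seq (powProg_tri hb5 (n := n + 1) (by rw [Function.update_self]) (by omega)) ?_
  rintro ρ ⟨r44, hρ⟩
  have r5 : ρ 5 = τ 5 := by
    rw [hρ 5 (by norm_num) (by norm_num), Function.update_of_ne (by norm_num)]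
  have e0 : ((reg 5 + reg 44) / (lit 2 * reg 44) : Ex).eval ρ
      = (τ 5 + 2 ^ (n + 1)) / (2 * 2 ^ (n + 1)) := by
    rw [Ex.eval_div, Ex.eval_add, Ex.eval_mul, Ex.eval_reg, Ex.eval_reg, Ex.eval_lit, r5, r44]
  refine Tri.asg hb5 rfl (by decide) (by norm_num) (fun _ => ?_) ?_
  · rw [e0]
    have h6 : |(τ 5 + 2 ^ (n + 1)) / (2 * 2 ^ (n + 1))| ≤ |τ 5 + 2 ^ (n + 1)| := by
      have := Int.natAbs_ediv_le_natAbs (τ 5 + 2 ^ (n + 1)) (2 * 2 ^ (n + 1))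
      rw [Int.abs_eq_natAbs, Int.abs_eq_natAbs]; exact_mod_cast this
    have h7 := abs_add_le (τ 5) (2 ^ (n + 1))
    rw [abs_of_pos (show (0 : ℤ) < 2 ^ (n + 1) by positivity)] at h7
    have h8 : (2 : ℤ) ^ (n + 1) ≤ 2 ^ (n + 2) := pow_le_pow_right₀ (by norm_num) (by omega)
    linarith
  · rw [e0, Function.update_self]
    refine abs_sub_round_le ?_
    -- The error of the input, at most one unit, is doubled n times and added to the 2^n - 1 from
    -- the program.
    have h6 : |2 ^ n * ((σ 5 : ℝ) - 2 ^ (n + m + 2) * x)| ≤ 2 ^ n := by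
      rw [abs_mul, abs_of_pos (show (0 : ℝ) < 2 ^ n by positivity)]
      exact mul_le_of_le_one_right (by positivity) hap
    have h7 := abs_add_le ((τ 5 : ℝ) - 2 ^ (n + m + 2) * (s n).2 -
      2 ^ n * (σ 5 - 2 ^ (n + m + 2) * x)) (2 ^ n * ((σ 5 : ℝ) - 2 ^ (n + m + 2) * x))
    rw [sub_add_cancel] at h7
    have h8 : (2 : ℝ) ^ (n + 1) = 2 ^ n * 2 := pow_succ _ _
    linarith

end PrincipalCycle

theorem proposition7p5 :
    -- the iterated `*`-squares exist, are unique, and are reduced principal ideals at growing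
    -- distances
    (∀ d : ℕ, Squarefree d → 1 < d → ∀ (I : FracIdeal d) (x : ℝ),
      IsReducedPrincipal I → IsDistance I x →
        (∃! s : ℕ → FracIdeal d × ℝ, IsStarSequence I x s) ∧
        ∀ s : ℕ → FracIdeal d × ℝ, IsStarSequence I x s → ∀ n : ℕ, 1 ≤ n →
          IsReducedPrincipal (s n).1 ∧ IsDistance (s n).1 (s n).2 ∧ 2 ^ n * x < (s n).2) ∧
    -- the ideal is computed from `D`, the standard form of `I`, and `n`
    (∃ (P : Prog) (C : ℕ), ∀ d : ℕ, Squarefree d → 1 < d → ∀ (I : FracIdeal d) (x : ℝ),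
      IsReducedPrincipal I → IsDistance I x →
        ∀ s : ℕ → FracIdeal d × ℝ, IsStarSequence I x s →
          ∀ (a b : ℤ) (n : ℕ), IsStandardForm I a b →
            ∃ (τ : ℕ → ℤ) (T : ℕ),
              Runs P (initRegs [(disc d : ℤ), a, b, (n : ℤ)]) τ T ∧
              (T : ℝ) ≤ C * (Real.log (disc d) + n) ^ C ∧
              IsStandardForm (s n).1 (τ 0) (τ 1)) ∧
    -- its unreduced distance is computed to within `2 ^ (-m)`, given that of `I`
    (∃ (P : Prog) (C : ℕ), ∀ d : ℕ, Squarefree d → 1 < d → ∀ (I : FracIdeal d) (x : ℝ),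
      IsReducedPrincipal I → IsDistance I x →
        ∀ s : ℕ → FracIdeal d × ℝ, IsStarSequence I x s →
          ∀ (a b : ℤ) (n m : ℕ) (t : ℤ), IsStandardForm I a b →
            |x - t / 2 ^ (n + m + 2)| ≤ 1 / 2 ^ (n + m + 2) →
            ∃ (τ : ℕ → ℤ) (T : ℕ),
              Runs P (initRegs [(disc d : ℤ), a, b, (n : ℤ), (m : ℤ), t]) τ T ∧
              (T : ℝ) ≤ C * (Real.log (disc d) + n + m + Real.log (1 + |x| / regulator d)) ^ C ∧
              |(s n).2 - (τ 0 : ℝ) / 2 ^ m| ≤ 1 / 2 ^ m) := by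
  obtain ⟨C, hC⟩ := exists_cost_bound
  refine ⟨fun d hd h1 I x hI hx => ⟨existsUnique_isStarSequence hd h1 hI hx, fun s hs n hn =>
    ⟨(hs.isReducedPrincipal hI hx n).1, (hs.isReducedPrincipal hI hx n).2, hs.lt hn⟩⟩,
    ⟨idealProg, C, ?_⟩, ⟨unreducedDistanceProg, C, ?_⟩⟩
  · intro d hd h1 I x hI hx s hs a b n hstd
    have := nonsquareRat hd h1
    have h5 := five_le_disc h1
    have hlogD := one_le_log_disc h5
    obtain ⟨γ, hγ, -⟩ := id hx
    obtain ⟨ha, ha2, hb2⟩ := (IsReducedForm.mk hγ hI.2 hstd).bounds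
    obtain ⟨k, hk, hk'⟩ := exists_le_two_pow (y := disc d) (by exact_mod_cast (by omega : 1 ≤ disc d))
    have hkN : disc d ≤ 2 ^ k := by exact_mod_cast hk
    have hkZ : (disc d : ℤ) ≤ 2 ^ k := by exact_mod_cast hkN
    obtain ⟨c, hc⟩ : ∃ c, c = n + 0 + 40 * (2 * (n + 0 + 2) + 5 * k + 25) + 5 := ⟨_, rfl⟩
    have hcc : (c : ℤ) ≤ 2 ^ c := by exact_mod_cast Nat.lt_two_pow_self.le
    have hkc : (2 : ℤ) ^ k ≤ 2 ^ c := pow_le_pow_right₀ (by norm_num) (by omega)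
    have hbdd : Bdd c (initRegs [(disc d : ℤ), a, b, (n : ℤ)]) := by
      refine fun i _ => abs_initRegs_le (by positivity) ?_ i
      simp only [List.forall_mem_cons, List.not_mem_nil, false_imp_iff, implies_true, and_true]
      rw [Nat.abs_cast, Nat.abs_cast, abs_of_pos ha]
      refine ⟨by linarith, by nlinarith, by linarith, by omega⟩
    obtain ⟨τ, τ', T, hR, hT, hτ, -, hpost⟩ := idealProg_tri hd h1 hI hx hs (b := c) (k := k) (n := n)
      hkN (σ := initRegs [(disc d : ℤ), a, b, (n : ℤ)]) hc.ge rfl rfl rfl rfl hstd _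
      (fun _ _ => rfl) hbdd
    refine ⟨τ', T, hR, ?_, by rwa [hτ 0 (by norm_num), hτ 1 (by norm_num)]⟩
    refine le_trans (by exact_mod_cast hT) (hC c _ _ ?_ ?_ le_rfl)
    · have : (0 : ℝ) ≤ n := Nat.cast_nonneg n
      linarith
    · rw [hc]; push_cast
      have : (0 : ℝ) ≤ n := Nat.cast_nonneg n
      linarith
  · intro d hd h1 I x hI hx s hs a b n m t hstd hap
    have := nonsquareRat hd h1
    have h5 := five_le_disc h1
    have hlogD := one_le_log_disc h5
    obtain ⟨γ, hγ, -⟩ := id hx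
    have hform := IsReducedForm.mk hγ hI.2 hstd
    obtain ⟨ha, ha2, hb2⟩ := hform.bounds
    obtain ⟨hR0, -⟩ := regulator_bounds hform (by omega)
    have hreg := log_one_add_le_of_regulator hform (by omega) x
    have hr0 : 0 ≤ Real.log (1 + |x| / regulator d) :=
      Real.log_nonneg (by linarith [div_nonneg (abs_nonneg x) hR0.le])
    obtain ⟨k, hk, hk'⟩ := exists_le_two_pow (y := disc d) (by exact_mod_cast (by omega : 1 ≤ disc d))
    have hkN : disc d ≤ 2 ^ k := by exact_mod_cast hk
    have hkZ : (disc d : ℤ) ≤ 2 ^ k := by exact_mod_cast hkN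
    -- The input t is at most 2^(n+m+2)(1 + |x|) in absolute value, so its length involves log(1 +
    -- |x|), which `hreg` exchanges for log(1 + |x|/R).
    obtain ⟨w, hw, hw'⟩ := exists_le_two_pow (y := 1 + |x|) (by linarith [abs_nonneg x])
    have hE0 : (0 : ℝ) < 2 ^ (n + m + 2) := by positivity
    have hE1 : (1 : ℝ) ≤ 2 ^ (n + m + 2) := one_le_pow₀ (by norm_num)
    have hap' : |(t : ℝ) - 2 ^ (n + m + 2) * x| ≤ 1 := by
      have e : (t : ℝ) - 2 ^ (n + m + 2) * x = -(2 ^ (n + m + 2) * (x - t / 2 ^ (n + m + 2))) := by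
        field_simp; ring
      rw [e, abs_neg, abs_mul, abs_of_pos hE0]
      rwa [le_div_iff₀ hE0, mul_comm] at hap
    have ht : |t| ≤ 2 ^ (n + m + 2 + w) := by
      have h6 : |(t : ℝ)| ≤ 2 ^ (n + m + 2 + w) := by
        have h7 := abs_add_le ((t : ℝ) - 2 ^ (n + m + 2) * x) (2 ^ (n + m + 2) * x)
        rw [sub_add_cancel, abs_mul, abs_of_pos hE0] at h7
        rw [pow_add 2 (n + m + 2) w]
        have h8 : (2 : ℝ) ^ (n + m + 2) * (1 + |x|) ≤ 2 ^ (n + m + 2) * 2 ^ w :=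
          mul_le_mul_of_nonneg_left hw hE0.le
        linarith
      exact_mod_cast h6
    obtain ⟨c, hc⟩ : ∃ c, c = n + (n + m + 2 + w) + 40 * (2 * (n + m + 2) + 5 * k + 25) + 5 := ⟨_, rfl⟩
    have hcc : (c : ℤ) ≤ 2 ^ c := by exact_mod_cast Nat.lt_two_pow_self.le
    have hkc : (2 : ℤ) ^ k ≤ 2 ^ c := pow_le_pow_right₀ (by norm_num) (by omega)
    have htc : (2 : ℤ) ^ (n + m + 2 + w) ≤ 2 ^ c := pow_le_pow_right₀ (by norm_num) (by omega)
    have hbdd : Bdd c (initRegs [(disc d : ℤ), a, b, (n : ℤ), (m : ℤ), t]) := by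
      refine fun i _ => abs_initRegs_le (by positivity) ?_ i
      simp only [List.forall_mem_cons, List.not_mem_nil, false_imp_iff, implies_true, and_true]
      rw [Nat.abs_cast, Nat.abs_cast, Nat.abs_cast, abs_of_pos ha]
      refine ⟨by linarith, by nlinarith, by linarith, by omega, by omega, by linarith⟩
    obtain ⟨τ, τ', T, hR, hT, hτ, -, hpost⟩ := unreducedDistanceProg_tri hd h1 hI hx hs (b := c)
      (k := k) (w := n + m + 2 + w) (n := n) (m := m) hkN
      (σ := initRegs [(disc d : ℤ), a, b, (n : ℤ), (m : ℤ), t]) ht hc.ge rfl rfl rfl hstd hap' _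
      (fun _ _ => rfl) hbdd
    have hn0 : (0 : ℝ) ≤ n := Nat.cast_nonneg n
    have hm0 : (0 : ℝ) ≤ m := Nat.cast_nonneg m
    refine ⟨τ', T, hR, ?_, by rwa [hτ 0 (by norm_num)]⟩
    refine le_trans (by exact_mod_cast hT) (hC c _ _ ?_ ?_ le_rfl)
    · linarith
    -- All terms of the bit bound c are linear in n, m, k and w, hence in the quantity of the cost
    -- bound; constants are absorbed by log D ≥ 1.
    · have h4 : Real.log (4 * disc d) ≤ 2 + Real.log (disc d) := by
        rw [Real.log_mul (by norm_num) (by norm_cast; omega)]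
        have : Real.log 4 = 2 * Real.log 2 := by
          rw [show (4 : ℝ) = 2 ^ 2 by norm_num, Real.log_pow]; norm_num
        linarith [Real.log_two_lt_d9]
      rw [hc]; push_cast
      linarith
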